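/- Let $\widetilde M$ be a complex manifold of dimension $n+1$, and let $\Omega\subset\widetilde M$ be a relatively compact domain with $C^\infty$-smooth boundary $M=\partial\Omega$. A smooth defining function of $\Omega$ is a smooth $\rho:\widetilde M\to\mathbb R$ with $\Omega=\{\rho<0\}$ and $d\rho\neq0$ on $M$. Give $M$ its CR structure $T^{1,0}_M=(\mathbb C\otimes TM)\cap T^{1,0}\widetilde M$, and put $T^{0,1}_M=\overline{T^{1,0}_M}$. A trivialization is a smooth, purely imaginary, nowhere vanishing 1-form $\eta$ on $M$ that annihilates $T^{1,0}_M\oplus T^{0,1}_M$. Its Levi form is $\lambda_\eta(L,L')=\eta([L,\overline{L'}])$ for sections $L,L'$ of $T^{1,0}_M$, and $\eta$ is called positive if $\lambda_\eta(L,L)\ge0$ for all $L$. The null space $\mathcal N\subset T^{1,0}_M$ is the kernel of $\lambda_\eta$ (it does not depend on $\eta$). Assume that the boundary $M$ is pseudoconvex, i.e. $\eta_\rho=(\partial\rho-\bar\partial\rho)/2$ is positive on $M$ for a smooth defining function $\rho$ of $\Omega$. Given $\eta$, choose a smooth purely imaginary vector field $T$ with $\eta(T)=1$. The D'Angelo $(1,0)$-form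 $\omega_\eta$ is the complex-linear 1-form on $\mathbb C\otimes TM$ with $\omega_\eta(L)=\eta([T,L])$ for sections $L$ of $T^{1,0}_M$ that annihilates $T^{0,1}_M$ and $T$. On $\mathcal N$ one considers the quadratic forms $$\bar\partial_b\omega_\eta(L,\overline L)=-\overline L\bigl(\omega_\eta(L)\bigr)-\omega_\eta([L,\overline L]),\qquad \omega_\eta\wedge\overline{\omega}_\eta(L,\overline L)=|\omega_\eta(L)|^2 ,$$ (the first is the value of the 2-form $\bar\partial_b\omega_\eta$ on the pair $(L,\overline L)$, for any section of $T^{1,0}_M$ extending the given vector $L\in\mathcal N$). On $\mathcal N$ they are real and do not depend on the choice of $T$ or of the extension. An inequality "$>0$" or "$<0$ on $\mathcal N$" is meant at all nonzero vectors of $\mathcal N$. Define $$DF_s(M)=\sup\Bigl\{0<\gamma<1:\ \exists\,\eta,\ \bar\partial_b\omega_\eta-\tfrac{\gamma}{1-\gamma}\,\omega_\eta\wedge\overline{\omega}_\eta>0\text{ on }\mathcal N\Bigr\},$$ $$S_s(M)=\inf\Bigl\{\gamma>1:\ \exists\,\eta,\ -\bar\partial_b\omega_\eta-\tfrac{\gamma}{\gamma-1}\,\omega_\eta\wedge\overline{\omega}_\eta>0\text{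 on }\mathcal N\Bigr\},$$ where $\eta$ runs over all positive trivializations, and $$DF_s(\Omega)=\sup\{0<\gamma<1:\ \exists\,\rho,W,\ -(-\rho)^\gamma\text{ is strictly plurisubharmonic on }\Omega\cap W\},$$ $$S_s(\Omega)=\inf\{\gamma>1:\ \exists\,\rho,W,\ \rho^\gamma\text{ is strictly plurisubharmonic on }(\widetilde M\setminus\overline\Omega)\cap W\},$$ where $\rho$ runs over the smooth defining functions of $\Omega$ and $W$ over the open neighbourhoods of $M$. Define $DF_w(M),S_w(M)$ with $\ge0$ in place of $>0$, and $DF_w(\Omega),S_w(\Omega)$ with "plurisubharmonic" in place of "strictly plurisubharmonic". The supremum of the empty set is taken to be $0$, and the infimum of the empty set to be $\infty$. Then: 1. If there is a positive trivialization $\eta$ with $\bar\partial_b\omega_\eta>0$ on $\mathcal N$, then $$0<DF_s(M)=DF_s(\Omega)=DF_w(\Omega)=DF_w(M).$$ 2. If there is a positive trivialization $\eta$ with $\bar\partial_b\omega_\eta+\omega_\eta\wedge\overline{\omega}_\eta<0$ on $\mathcal N$, then $$S_w(M)=S_w(\Omega)=S_s(\Omega)=S_s(M)<\infty.$$ -/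

import Mathlib

open scoped Manifold ContDiff TensorProduct Topology
open Bundle

noncomputable section

namespace CRIndex

/-! ### Complexified tangent vectors -/

section LinearAlgebra

variable {V : Type*} [AddCommGroup V] [Module ℝ V]

/-- Real part of a vector of the complexification `ℂ ⊗ V`. -/
def rePart : ℂ ⊗[ℝ] V →ₗ[ℝ] V :=
  (TensorProduct.lid ℝ V).toLinearMap ∘ₗ LinearMap.rTensor V Complex.reLm

/-- Imaginary part of a vector of the complexification `ℂ ⊗ V`. -/
def imPart : ℂ ⊗[ℝ] V →ₗ[ℝ] V :=
  (TensorProduct.lid ℝ V).toLinearMap ∘ₗ LinearMap.rTensor V Complex.imLm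

/-- The vector `v + i w` of `ℂ ⊗ V`. -/
def mkC (v w : V) : ℂ ⊗[ℝ] V := (1 : ℂ) ⊗ₜ[ℝ] v + Complex.I ⊗ₜ[ℝ] w

/-- Complex conjugation of `ℂ ⊗ V`. -/
def conjC (Z : ℂ ⊗[ℝ] V) : ℂ ⊗[ℝ] V := mkC (rePart Z) (-imPart Z)

end LinearAlgebra

section CR

variable {F : Type*} [NormedAddCommGroup F] [NormedSpace ℝ F]
  {M : Type*} [TopologicalSpace M] [ChartedSpace F M] [IsManifold 𝓘(ℝ, F) ∞ M]

/-! ### Complex vector fields on a smooth manifold `M` -/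

/-- A complex vector field: a section of `ℂ ⊗ TM`, with no regularity imposed. -/
abbrev CVectorField (F : Type*) [NormedAddCommGroup F] [NormedSpace ℝ F]
    (M : Type*) [TopologicalSpace M] [ChartedSpace F M] : Type _ :=
  (p : M) → ℂ ⊗[ℝ] TangentSpace 𝓘(ℝ, F) p

/-- Smoothness of a complex vector field: its real and imaginary parts are smooth. -/
def SmoothField (Z : CVectorField F M) : Prop :=
  ContMDiff 𝓘(ℝ, F) 𝓘(ℝ, F).tangent ∞ (fun p => (⟨p, rePart (Z p)⟩ : TangentBundle 𝓘(ℝ, F) M)) ∧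
  ContMDiff 𝓘(ℝ, F) 𝓘(ℝ, F).tangent ∞ (fun p => (⟨p, imPart (Z p)⟩ : TangentBundle 𝓘(ℝ, F) M))

/-- The conjugate field. -/
def conjField (Z : CVectorField F M) : CVectorField F M := fun p => conjC (Z p)

/-- The complex bilinear extension of the Lie bracket of vector fields. -/
def bracket (Z W : CVectorField F M) : CVectorField F M := fun p =>
  mkC
    (VectorField.mlieBracket 𝓘(ℝ, F) (fun q => rePart (Z q)) (fun q => rePart (W q)) p
      - VectorField.mlieBracket 𝓘(ℝ, F) (fun q => imPart (Z q)) (fun q => imPart (W q)) p)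
    (VectorField.mlieBracket 𝓘(ℝ, F) (fun q => rePart (Z q)) (fun q => imPart (W q)) p
      + VectorField.mlieBracket 𝓘(ℝ, F) (fun q => imPart (Z q)) (fun q => rePart (W q)) p)

/-- The derivative `Z f` at `p` of a complex function `f` along a complex tangent vector `Z`. -/
def derivC (f : M → ℂ) (p : M) (Z : ℂ ⊗[ℝ] TangentSpace 𝓘(ℝ, F) p) : ℂ :=
  let df : TangentSpace 𝓘(ℝ, F) p →L[ℝ] ℂ := mfderiv 𝓘(ℝ, F) 𝓘(ℝ, ℂ) f p
  df (rePart Z) + Complex.I * df (imPart Z)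

/-- A complex valued 1-form on `M`, with no regularity imposed. -/
abbrev CForm (F : Type*) [NormedAddCommGroup F] [NormedSpace ℝ F]
    (M : Type*) [TopologicalSpace M] [ChartedSpace F M] : Type _ :=
  (p : M) → TangentSpace 𝓘(ℝ, F) p →L[ℝ] ℂ

/-- Smoothness of a complex valued 1-form, as a section of the bundle `Hom(TM, ℂ)`. -/
def SmoothForm (η : CForm F M) : Prop :=
  ContMDiff 𝓘(ℝ, F) (𝓘(ℝ, F).prod 𝓘(ℝ, F →L[ℝ] ℂ)) ∞
    (fun p => TotalSpace.mk' (F →L[ℝ] ℂ)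
      (E := fun p : M => TangentSpace 𝓘(ℝ, F) p →L[ℝ] Trivial M ℂ p) p (η p))

/-- The complex linear extension of a 1-form to `ℂ ⊗ TM`. -/
def evalC (η : CForm F M) (p : M) (Z : ℂ ⊗[ℝ] TangentSpace 𝓘(ℝ, F) p) : ℂ :=
  η p (rePart Z) + Complex.I * η p (imPart Z)

/-! ### CR structures, Levi form, D'Angelo form

The bundle `T^{1,0}` of a CR manifold `M` is given by its fibres, complex subspaces of `ℂ ⊗ T_pM`.
-/

/-- The fibres of a field of complex subspaces of `ℂ ⊗ TM`. -/
abbrev CRBundle (F : Type*) [NormedAddCommGroup F] [NormedSpace ℝ F]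
    (M : Type*) [TopologicalSpace M] [ChartedSpace F M] : Type _ :=
  (p : M) → Submodule ℂ (ℂ ⊗[ℝ] TangentSpace 𝓘(ℝ, F) p)

/-- `L ∈ Γ(T^{1,0})`: a smooth section of `T^{1,0}`. -/
def IsSection (T10 : CRBundle F M) (L : CVectorField F M) : Prop :=
  SmoothField L ∧ ∀ p, L p ∈ T10 p

/-- A trivialization of `ℂ ⊗ TM / (T^{1,0} ⊕ T^{0,1})`: a purely imaginary non-vanishing smooth
1-form that annihilates `T^{1,0} ⊕ T^{0,1}`. -/
structure IsTrivialization (T10 : CRBundle F M) (η : CForm F M) : Prop where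
  smooth : SmoothForm η
  imaginary : ∀ p v, (η p v).re = 0
  nonvanishing : ∀ p, η p ≠ 0
  annihilates : ∀ p, ∀ Z ∈ T10 p, evalC η p Z = 0 ∧ evalC η p (conjC Z) = 0

/-- The Levi form `λ_η(L, L') = -dη(L, conj L') = η([L, conj L'])` at `p`, for sections `L, L'` of
`T^{1,0}`; its value depends only on `L p` and `L' p`. -/
def levi (η : CForm F M) (L L' : CVectorField F M) (p : M) : ℂ :=
  evalC η p (bracket L (conjField L') p)

/-- `λ_η ≥ 0` on `T^{1,0}`. -/
def LeviNonneg (T10 : CRBundle F M) (η : CForm F M) : Prop :=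
  ∀ L, IsSection T10 L → ∀ p, 0 ≤ (levi η L L p).re

/-- A positive trivialization. -/
def IsPositiveTrivialization (T10 : CRBundle F M) (η : CForm F M) : Prop :=
  IsTrivialization T10 η ∧ LeviNonneg T10 η

/-- The kernel `N_p` of the Levi form at `p`. -/
def nullSpace (T10 : CRBundle F M) (η : CForm F M) (p : M) :
    Set (ℂ ⊗[ℝ] TangentSpace 𝓘(ℝ, F) p) :=
  {v | v ∈ T10 p ∧ ∀ L L', IsSection T10 L → IsSection T10 L' → L p = v → levi η L L' p = 0}

/-- A transversal vector field normalized with respect to `η`: smooth, purely imaginary,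
with `η(T) = 1`. -/
structure IsTransversal (η : CForm F M) (T : CVectorField F M) : Prop where
  smooth : SmoothField T
  imaginary : ∀ p, rePart (T p) = 0
  normalized : ∀ p, evalC η p (T p) = 1

/-- `θ` is a D'Angelo (1,0)-form with respect to `η`: for some normalized transversal field `T`,
`θ(L) = -dη(T, L) = η([T, L])` on `T^{1,0}`, and `θ` annihilates `T^{0,1}` and `T`.
Since `ℂ ⊗ TM = T^{1,0} ⊕ T^{0,1} ⊕ ℂ T`, this determines `θ` once `T` is chosen. -/
def IsDAngeloForm (T10 : CRBundle F M) (η : CForm F M)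
    (θ : (p : M) → (ℂ ⊗[ℝ] TangentSpace 𝓘(ℝ, F) p) →ₗ[ℂ] ℂ) : Prop :=
  ∃ T : CVectorField F M, IsTransversal η T ∧
    (∀ L, IsSection T10 L → ∀ p, θ p (L p) = evalC η p (bracket T L p)) ∧
    (∀ p, ∀ Z ∈ T10 p, θ p (conjC Z) = 0) ∧
    (∀ p, θ p (T p) = 0)

/-- The (1,1)-form `∂̄_b θ` evaluated as a 2-form on `(L, conj L')` at `p`, for a (1,0)-form `θ` and
sections `L, L'` of `T^{1,0}`: by Cartan's formula for `dθ`, and since `θ(conj L') = 0`,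
`(∂̄_b θ)(L, conj L') = -(conj L')(θ(L)) - θ([L, conj L'])`. -/
def dbarForm (θ : (p : M) → (ℂ ⊗[ℝ] TangentSpace 𝓘(ℝ, F) p) →ₗ[ℂ] ℂ)
    (L L' : CVectorField F M) (p : M) : ℂ :=
  -derivC (fun q => θ q (L q)) p (conjField L' p) - θ p (bracket L (conjField L') p)

/-- A pointwise condition `R` on the two quadratic forms
`(∂̄_b θ_η)(L, conj L)` and `(θ_η ∧ conj θ_η)(L, conj L) = |θ_η(L)|²`
holds at all nonzero vectors `L_p` of the null space.
On the null space of a pseudoconvex manifold both forms are real, and depend only on `η` and `L_p`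
(neither on the transversal field nor on the section extending `L_p`). -/
def OnNull (T10 : CRBundle F M) (η : CForm F M) (R : ℝ → ℝ → Prop) : Prop :=
  ∀ θ, IsDAngeloForm T10 η θ → ∀ L, IsSection T10 L → ∀ p, L p ∈ nullSpace T10 η p → L p ≠ 0 →
    R (dbarForm θ L L p).re (‖θ p (L p)‖ ^ 2)

/-! ### The indices of a pseudoconvex CR manifold

In `ℝ`, `sSup ∅ = 0`; in `EReal`, `sInf ∅ = ⊤`. -/

/-- Diederich–Fornæss index of `M` in the strong sense. -/
def DFStrongCR (T10 : CRBundle F M) : ℝ :=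
  sSup {γ : ℝ | 0 < γ ∧ γ < 1 ∧ ∃ η, IsPositiveTrivialization T10 η ∧
    OnNull T10 η (fun d w => 0 < d - γ / (1 - γ) * w)}

/-- Diederich–Fornæss index of `M` in the weak sense. -/
def DFWeakCR (T10 : CRBundle F M) : ℝ :=
  sSup {γ : ℝ | 0 < γ ∧ γ < 1 ∧ ∃ η, IsPositiveTrivialization T10 η ∧
    OnNull T10 η (fun d w => 0 ≤ d - γ / (1 - γ) * w)}

/-- Steinness index of `M` in the strong sense. -/
def SteinStrongCR (T10 : CRBundle F M) : EReal :=
  sInf (Real.toEReal '' {γ : ℝ | 1 < γ ∧ ∃ η, IsPositiveTrivialization T10 η ∧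
    OnNull T10 η (fun d w => 0 < -d - γ / (γ - 1) * w)})

/-- Steinness index of `M` in the weak sense. -/
def SteinWeakCR (T10 : CRBundle F M) : EReal :=
  sInf (Real.toEReal '' {γ : ℝ | 1 < γ ∧ ∃ η, IsPositiveTrivialization T10 η ∧
    OnNull T10 η (fun d w => 0 ≤ -d - γ / (γ - 1) * w)})

end CR

section Domain

variable {E : Type*} [NormedAddCommGroup E] [NormedSpace ℂ E]
  {X : Type*} [TopologicalSpace X] [ChartedSpace E X]

/-! ### Domains in a complex manifold `X` -/

/-- The complex structure of the complex manifold `X` on its real tangent space at `x`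
(identified with `E` through the preferred holomorphic chart at `x`). -/
def complexStructure (x : X) : TangentSpace 𝓘(ℝ, E) x →L[ℝ] TangentSpace 𝓘(ℝ, E) x :=
  (Complex.I • ContinuousLinearMap.id ℝ E : E →L[ℝ] E)

/-- The fibre of `T^{1,0}X` at `x`. -/
def holTangent (x : X) : Submodule ℂ (ℂ ⊗[ℝ] TangentSpace 𝓘(ℝ, E) x) :=
  Module.End.eigenspace ((complexStructure (E := E) x).toLinearMap.baseChange ℂ) Complex.I

/-- `∂∂̄u(v, conj v)`, for `v` a tangent vector `∑ v_j ∂/∂z_j` at `x`: the complex Hessian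
`∑ ∂²u/∂z_j∂z̄_k v_j v̄_k = (D²u(v, v) + D²u(iv, iv)) / 4` in the preferred holomorphic chart at `x`
(its value is the same in all holomorphic charts). -/
def complexHessian (u : X → ℝ) (x : X) (v : E) : ℝ :=
  (fderiv ℝ (fderiv ℝ (u ∘ (extChartAt 𝓘(ℝ, E) x).symm)) (extChartAt 𝓘(ℝ, E) x x) v v
    + fderiv ℝ (fderiv ℝ (u ∘ (extChartAt 𝓘(ℝ, E) x).symm)) (extChartAt 𝓘(ℝ, E) x x)
        (Complex.I • v) (Complex.I • v)) / 4

variable (E) in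
/-- A smooth plurisubharmonic function on the open set `S`. -/
def IsPSHOn (u : X → ℝ) (S : Set X) : Prop :=
  ContMDiffOn 𝓘(ℝ, E) 𝓘(ℝ, ℝ) ∞ u S ∧ ∀ x ∈ S, ∀ v : E, 0 ≤ complexHessian u x v

variable (E) in
/-- A smooth strictly plurisubharmonic function on the open set `S`. -/
def IsStrictPSHOn (u : X → ℝ) (S : Set X) : Prop :=
  ContMDiffOn 𝓘(ℝ, E) 𝓘(ℝ, ℝ) ∞ u S ∧ ∀ x ∈ S, ∀ v : E, v ≠ 0 → 0 < complexHessian u x v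

variable (E) in
/-- A smooth defining function of `Ω`. -/
structure IsDefiningFunction (Ω : Set X) (ρ : X → ℝ) : Prop where
  smooth : ContMDiff 𝓘(ℝ, E) 𝓘(ℝ, ℝ) ∞ ρ
  sublevel : Ω = {x | ρ x < 0}
  nondegenerate : ∀ x ∈ frontier Ω, mfderiv 𝓘(ℝ, E) 𝓘(ℝ, ℝ) ρ x ≠ 0

variable (E) in
/-- Diederich–Fornæss index of `Ω` in the strong sense. -/
def DFStrong (Ω : Set X) : ℝ :=
  sSup {γ : ℝ | 0 < γ ∧ γ < 1 ∧ ∃ ρ : X → ℝ, IsDefiningFunction E Ω ρ ∧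
    ∃ W : Set X, IsOpen W ∧ frontier Ω ⊆ W ∧
      IsStrictPSHOn E (fun x => -(-ρ x) ^ γ) (Ω ∩ W)}

variable (E) in
/-- Diederich–Fornæss index of `Ω` in the weak sense. -/
def DFWeak (Ω : Set X) : ℝ :=
  sSup {γ : ℝ | 0 < γ ∧ γ < 1 ∧ ∃ ρ : X → ℝ, IsDefiningFunction E Ω ρ ∧
    ∃ W : Set X, IsOpen W ∧ frontier Ω ⊆ W ∧
      IsPSHOn E (fun x => -(-ρ x) ^ γ) (Ω ∩ W)}

variable (E) in
/-- Steinness index of `Ω` in the strong sense. -/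
def SteinStrong (Ω : Set X) : EReal :=
  sInf (Real.toEReal '' {γ : ℝ | 1 < γ ∧ ∃ ρ : X → ℝ, IsDefiningFunction E Ω ρ ∧
    ∃ W : Set X, IsOpen W ∧ frontier Ω ⊆ W ∧
      IsStrictPSHOn E (fun x => ρ x ^ γ) ((closure Ω)ᶜ ∩ W)})

variable (E) in
/-- Steinness index of `Ω` in the weak sense. -/
def SteinWeak (Ω : Set X) : EReal :=
  sInf (Real.toEReal '' {γ : ℝ | 1 < γ ∧ ∃ ρ : X → ℝ, IsDefiningFunction E Ω ρ ∧
    ∃ W : Set X, IsOpen W ∧ frontier Ω ⊆ W ∧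
      IsPSHOn E (fun x => ρ x ^ γ) ((closure Ω)ᶜ ∩ W)})

/-! ### The CR structure of an embedded real hypersurface `ι : M → X` -/

variable {F : Type*} [NormedAddCommGroup F] [NormedSpace ℝ F]
  {M : Type*} [TopologicalSpace M] [ChartedSpace F M] [IsManifold 𝓘(ℝ, F) ∞ M]

/-- `T^{1,0}M = (ℂ ⊗ TM) ∩ T^{1,0}X`, where `M` is embedded in `X` by `ι`. -/
def inducedCR (E : Type*) [NormedAddCommGroup E] [NormedSpace ℂ E]
    {X : Type*} [TopologicalSpace X] [ChartedSpace E X]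
    {F : Type*} [NormedAddCommGroup F] [NormedSpace ℝ F]
    {M : Type*} [TopologicalSpace M] [ChartedSpace F M] (ι : M → X) : CRBundle F M := fun p =>
  (holTangent (E := E) (ι p)).comap
    ((mfderiv 𝓘(ℝ, F) 𝓘(ℝ, E) ι p).toLinearMap.baseChange ℂ)

/-- The 1-form `η_ρ = (∂ρ - ∂̄ρ)/2` pulled back to `M` by `ι`: since
`∂ρ(v) = (dρ(v) - i dρ(Jv))/2` and `∂̄ρ(v) = (dρ(v) + i dρ(Jv))/2` for a real tangent vector `v`,
one has `η_ρ(v) = -(i/2) dρ(Jv)`. -/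
def hypersurfaceForm (ι : M → X) (ρ : X → ℝ) : CForm F M := fun p =>
  (-(Complex.I / 2)) • (Complex.ofRealCLM ∘L
    ((mfderiv 𝓘(ℝ, E) 𝓘(ℝ, ℝ) ρ (ι p) : TangentSpace 𝓘(ℝ, E) (ι p) →L[ℝ] ℝ) ∘L
      complexStructure (E := E) (ι p) ∘L mfderiv 𝓘(ℝ, F) 𝓘(ℝ, E) ι p))

/-- `Ω` has smooth pseudoconvex boundary, the boundary being the image of the embedding `ι`:
`Ω` has a smooth defining function `ρ`, and the Levi form of the boundary with respect to
`η_ρ = (∂ρ - ∂̄ρ)/2`, that is, the restriction of `∂∂̄ρ`, is nonnegative. -/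
def HasSmoothPseudoconvexBoundary (Ω : Set X) (ι : M → X) : Prop :=
  ∃ ρ : X → ℝ, IsDefiningFunction E Ω ρ ∧
    LeviNonneg (inducedCR E ι : CRBundle F M) (hypersurfaceForm (E := E) ι ρ)

end Domain

end CRIndex

end

noncomputable section

namespace CRIndex

open Filter

/-! ### Real jets on a complex normed space -/

section Jets

variable {E : Type*} [NormedAddCommGroup E] [NormedSpace ℂ E]

/-! Both indices are governed by one computation at the boundary. Take σ = -1 inside and σ = 1
outside, and m = σ(γ - 1) > 0. On the side σρ > 0 the complex Hessian of σ(σρ)^γ is a positive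
multiple of Lev_ρ + m/(σρ)·|2∂ρ|² (`levB_hes_power`, `powerForm`). Move from a boundary point y by
(tσ/2)N, where ∂ρ(N) = 1, and evaluate on a + tCN with a complex tangent at y. The result is
Lev_y(a,a) + t·Q(a,C) + o(t), with Q quadratic in C (`expansion`). Minimizing over C turns Q into
-σ∂̄_bω - (σ + 1/m)|ω|² (`le_limitForm`, `exists_limitForm_eq`), where σ + 1/m is γ/(1-γ) inside and
γ/(γ-1) outside. These are the forms in the CR indices.

If the power is plurisubharmonic, the term of order 0 gives pseudoconvexity and the term of order t
gives the weak inequality on null vectors (`levB_nonneg_of_powerForm_nonneg`,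
`dAngelo_ineq_of_powerForm_nonneg`). Conversely the strict inequality gives strict
plurisubharmonicity near the boundary. Vectors violating it would accumulate at a null vector with C
bounded, and the limit would contradict the inequality (`eventually_powerForm_pos_at`).

The CR objects are matched with derivatives of a defining function r in a chart by
`LocalModel.levi_eq`, `LocalModel.dAngelo_eq` and `LocalModel.dbarForm_eq`. A transversal field T
corresponds to a normal vector N. On null vectors the choice is immaterial: r = 0 being
pseudoconvex, a Lagrange multiplier argument applies (`leviDrop_congr`). Every trivialization is
locally ±η_r for a single global defining function r = e^g ρ
(`IsSmoothBoundary.exists_isSignedForm`), so conditions on trivializations and on defining functions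
are equivalent. Hence strong on M implies strong on Ω, weak on Ω and weak on M, with the same
exponent.

The cycle is closed by passing from weak to strict on M with an arbitrarily small change of the
exponent. Replacing ρ by e^g ρ adds 2∂g to ω and subtracts the Levi form of g from ∂̄_bω on null
vectors (`levB_exp_mul_normal`, `dbarD_exp_mul`). Both changes are linear in g, so interpolating the
logarithms of the factors interpolates ω and ∂̄_bω affinely. The trivialization of the hypothesis,
by compactness, controls |ω|² by a multiple of ±∂̄_bω. A small amount of it mixed into a weak
solution therefore gains at first order and loses only at second order
(`exists_interpolation_bound`, `IsSmoothBoundary.exists_strict_of_weak`). The same compactness makes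
the first index positive and the second finite (`IsSmoothBoundary.exists_onNull_gap`). -/

instance instNormedGroupLinear : NormedAddCommGroup (E →L[ℝ] ℝ) :=
  ContinuousLinearMap.toNormedAddCommGroup

instance instNormedSpaceLinear : NormedSpace ℝ (E →L[ℝ] ℝ) :=
  ContinuousLinearMap.toNormedSpace

instance instNormedGroupBilinear : NormedAddCommGroup (E →L[ℝ] E →L[ℝ] ℝ) :=
  ContinuousLinearMap.toNormedAddCommGroup

instance instNormedSpaceBilinear : NormedSpace ℝ (E →L[ℝ] E →L[ℝ] ℝ) :=
  ContinuousLinearMap.toNormedSpace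


/-- Four times the real part of the Hermitian part of a real bilinear form. -/
def levB (B : E →L[ℝ] E →L[ℝ] ℝ) (a b : E) : ℝ := B a b + B (Complex.I • a) (Complex.I • b)

/-- Twice the complex linear part of a real linear form. -/
def delB (l : E →L[ℝ] ℝ) (v : E) : ℂ := (l v : ℂ) - Complex.I * (l (Complex.I • v) : ℂ)

/-- The second derivative of `r`. -/
abbrev hes (r : E → ℝ) (y : E) : E →L[ℝ] E →L[ℝ] ℝ := fderiv ℝ (fderiv ℝ r) y

/-- The third derivative of `r`. -/
abbrev third (r : E → ℝ) (y : E) : E →L[ℝ] E →L[ℝ] E →L[ℝ] ℝ :=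
  fderiv ℝ (fderiv ℝ (fderiv ℝ r)) y

lemma I_smul_I_smul (a : E) : Complex.I • (Complex.I • a) = -a := by
  rw [smul_smul, Complex.I_mul_I, neg_one_smul]

lemma complex_smul_eq (z : ℂ) (a : E) : z • a = z.re • a + z.im • (Complex.I • a) := by
  conv_lhs => rw [← Complex.re_add_im z]
  rw [add_smul, mul_smul, Complex.coe_smul, Complex.coe_smul]

lemma I_smul_real (t : ℝ) (a : E) : Complex.I • (t • a) = t • (Complex.I • a) := smul_comm _ _ _

lemma delB_apply_I (l : E →L[ℝ] ℝ) (v : E) : delB l (Complex.I • v) = Complex.I * delB l v := by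
  simp only [delB, I_smul_I_smul, map_neg, Complex.ofReal_neg]
  linear_combination (l v : ℂ) * Complex.I_mul_I - (l v : ℂ) * Complex.I_mul_I
    + (l (Complex.I • v) : ℂ) * Complex.I_mul_I

lemma delB_add (l : E →L[ℝ] ℝ) (v w : E) : delB l (v + w) = delB l v + delB l w := by
  simp only [delB, smul_add, map_add, Complex.ofReal_add]; ring

lemma delB_sub (l : E →L[ℝ] ℝ) (v w : E) : delB l (v - w) = delB l v - delB l w := by
  simp only [delB, smul_sub, map_sub, Complex.ofReal_sub]; ring

lemma delB_real_smul (l : E →L[ℝ] ℝ) (t : ℝ) (v : E) : delB l (t • v) = t * delB l v := by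
  simp only [delB, I_smul_real, map_smul, smul_eq_mul, Complex.ofReal_mul]; ring

lemma delB_smul (l : E →L[ℝ] ℝ) (z : ℂ) (v : E) : delB l (z • v) = z * delB l v := by
  rw [complex_smul_eq, delB_add, delB_real_smul, delB_real_smul, delB_apply_I]
  conv_rhs => rw [← Complex.re_add_im z]
  ring

lemma delB_eq_zero_iff {l : E →L[ℝ] ℝ} {v : E} :
    delB l v = 0 ↔ l v = 0 ∧ l (Complex.I • v) = 0 := by
  rw [Complex.ext_iff]; simp [delB]

lemma delB_eq_two_iff {l : E →L[ℝ] ℝ} {v : E} :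
    delB l v = 2 ↔ l v = 2 ∧ l (Complex.I • v) = 0 := by
  rw [Complex.ext_iff]; simp [delB]

lemma delB_smul_left (t : ℝ) (l : E →L[ℝ] ℝ) (v : E) : delB (t • l) v = t * delB l v := by
  simp only [delB, smul_apply, smul_eq_mul, Complex.ofReal_mul]; ring

lemma delB_sub_left (l l' : E →L[ℝ] ℝ) (v : E) : delB (l - l') v = delB l v - delB l' v := by
  simp only [delB, sub_apply, Complex.ofReal_sub]; ring

/-- If `l` is real and `delB l v = 0`, then subtracting multiples makes every vector tangent. -/
lemma delB_sub_div_smul {l : E →L[ℝ] ℝ} {N : E} (hN : delB l N ≠ 0) (v : E) :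
    delB l (v - (delB l v / delB l N) • N) = 0 := by
  rw [delB_sub, delB_smul, div_mul_cancel₀ _ hN, sub_self]

section levB

variable (B B' : E →L[ℝ] E →L[ℝ] ℝ)

lemma levB_add_right (a b c : E) : levB B a (b + c) = levB B a b + levB B a c := by
  simp only [levB, smul_add, map_add]; ring

lemma levB_add_apply (a b c : E) : levB B (a + b) c = levB B a c + levB B b c := by
  simp only [levB, smul_add, map_add, add_apply]; ring

lemma levB_smul_right (t : ℝ) (a b : E) : levB B a (t • b) = t * levB B a b := by
  simp only [levB, I_smul_real, map_smul, smul_eq_mul]; ring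

lemma levB_smul_apply (t : ℝ) (a b : E) : levB B (t • a) b = t * levB B a b := by
  simp only [levB, I_smul_real, map_smul, smul_apply, smul_eq_mul]; ring

lemma levB_sub_left (a b : E) : levB (B - B') a b = levB B a b - levB B' a b := by
  simp only [levB, sub_apply]; ring

lemma levB_smul_left (t : ℝ) (a b : E) : levB (t • B) a b = t * levB B a b := by
  simp only [levB, smul_apply, smul_eq_mul]; ring

lemma levB_complex_smul_right (z : ℂ) (a b : E) :
    levB B a (z • b) = z.re * levB B a b + z.im * levB B a (Complex.I • b) := by
  rw [complex_smul_eq, levB_add_right, levB_smul_right, levB_smul_right]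

lemma levB_I_I (a b : E) : levB B (Complex.I • a) (Complex.I • b) = levB B a b := by
  simp only [levB, I_smul_I_smul, map_neg, neg_apply, neg_neg]; ring

lemma levB_I_left (a b : E) : levB B (Complex.I • a) b = -levB B a (Complex.I • b) := by
  simp only [levB, I_smul_I_smul, map_neg, neg_apply]; ring

variable {B}

lemma levB_symm (hB : ∀ u v, B u v = B v u) (a b : E) : levB B a b = levB B b a := by
  simp only [levB]; rw [hB a b, hB (Complex.I • a)]

/-- Invariance under multiplication by i makes this value its own negative once the arguments are
exchanged. -/
lemma levB_self_I (hB : ∀ u v, B u v = B v u) (a : E) : levB B a (Complex.I • a) = 0 := by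
  have := levB_symm hB a (Complex.I • a)
  rw [levB_I_left] at this
  linarith

lemma levB_complex_smul_self (hB : ∀ u v, B u v = B v u) (z : ℂ) (a : E) :
    levB B (z • a) (z • a) = ‖z‖ ^ 2 * levB B a a := by
  rw [levB_complex_smul_right, levB_symm hB (z • a) a, levB_symm hB (z • a) (Complex.I • a),
    levB_complex_smul_right, levB_complex_smul_right B z (Complex.I • a), levB_I_I, levB_I_left,
    levB_self_I hB, ← Complex.normSq_eq_norm_sq, Complex.normSq_apply]
  ring

lemma levB_add_self (hB : ∀ u v, B u v = B v u) (a b : E) :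
    levB B (a + b) (a + b) = levB B a a + 2 * levB B a b + levB B b b := by
  rw [levB_add_right, levB_add_apply, levB_add_apply, levB_symm hB b a]; ring

/-- Cauchy--Schwarz for the degenerate direction of a form that is nonnegative on the kernel of
`delB l`. -/
lemma levB_eq_zero_of_null {l : E →L[ℝ] ℝ} (hB : ∀ u v, B u v = B v u)
    (hpos : ∀ a, delB l a = 0 → 0 ≤ levB B a a) {a b : E} (ha : delB l a = 0)
    (haa : levB B a a = 0) (hb : delB l b = 0) : levB B a b = 0 := by
  -- Nonnegativity on a + s b for all real s, with no constant term, forces the coefficient of s to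
  -- vanish. Below, s is the vertex of the parabola, or minus that coefficient if the quadratic term
  -- is zero.
  have key : ∀ s : ℝ, 0 ≤ 2 * s * levB B a b + s ^ 2 * levB B b b := fun s => by
    have := hpos (a + s • b) (by rw [delB_add, delB_real_smul, ha, hb]; simp)
    rw [levB_add_self hB, levB_smul_right, levB_smul_right, levB_smul_apply, haa] at this
    nlinarith
  by_contra hne
  have hbb : 0 ≤ levB B b b := hpos b hb
  rcases hbb.eq_or_lt with h0 | h0
  · have := key (-levB B a b)
    rw [← h0] at this
    have : 0 < levB B a b ^ 2 := by positivity
    nlinarith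
  · have := key (-(levB B a b / levB B b b))
    have h1 : 2 * -(levB B a b / levB B b b) * levB B a b
        + (-(levB B a b / levB B b b)) ^ 2 * levB B b b = -(levB B a b ^ 2 / levB B b b) := by
      field_simp; ring
    rw [h1] at this
    have : 0 < levB B a b ^ 2 / levB B b b := by positivity
    linarith

end levB

lemma tendsto_clm_apply {α G H : Type*} [NormedAddCommGroup G] [NormedSpace ℝ G]
    [NormedAddCommGroup H] [NormedSpace ℝ H] {l : Filter α} {B : α → G →L[ℝ] H} {a : α → G}
    {B₀ : G →L[ℝ] H} {a₀ : G} (hB : Tendsto B l (𝓝 B₀)) (ha : Tendsto a l (𝓝 a₀)) :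
    Tendsto (fun k => B k (a k)) l (𝓝 (B₀ a₀)) :=
  (isBoundedBilinearMap_apply.continuous.tendsto (B₀, a₀)).comp (hB.prodMk_nhds ha)

lemma tendsto_levB {α : Type*} {l : Filter α} {B : α → E →L[ℝ] E →L[ℝ] ℝ} {a b : α → E}
    {B₀ : E →L[ℝ] E →L[ℝ] ℝ} {a₀ b₀ : E}
    (hB : Tendsto B l (𝓝 B₀)) (ha : Tendsto a l (𝓝 a₀)) (hb : Tendsto b l (𝓝 b₀)) :
    Tendsto (fun k => levB (B k) (a k) (b k)) l (𝓝 (levB B₀ a₀ b₀)) :=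
  (tendsto_clm_apply (tendsto_clm_apply hB ha) hb).add
    (tendsto_clm_apply (tendsto_clm_apply hB (ha.const_smul Complex.I)) (hb.const_smul Complex.I))

lemma tendsto_delB {α : Type*} {l : Filter α} {B : α → E →L[ℝ] ℝ} {a : α → E} {B₀ : E →L[ℝ] ℝ}
    {a₀ : E} (hB : Tendsto B l (𝓝 B₀)) (ha : Tendsto a l (𝓝 a₀)) :
    Tendsto (fun k => delB (B k) (a k)) l (𝓝 (delB B₀ a₀)) :=
  ((Complex.continuous_ofReal.tendsto _).comp (tendsto_clm_apply hB ha)).sub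
    (((Complex.continuous_ofReal.tendsto _).comp
      (tendsto_clm_apply hB (ha.const_smul Complex.I))).const_mul _)

/-! ### The D'Angelo quantities of a function -/

/-- The value of the D'Angelo form on the vector `a`, computed with the normal vector `N`. -/
def dAngelo (B : E →L[ℝ] E →L[ℝ] ℝ) (N a : E) : ℂ :=
  (1 / 2 : ℂ) * (levB B a N + Complex.I * levB B a (Complex.I • N))

/-- The squared norm of the D'Angelo form on the vector `a`. -/
def dAngeloSq (r : E → ℝ) (y N a : E) : ℝ :=
  (levB (hes r y) a N ^ 2 + levB (hes r y) a (Complex.I • N) ^ 2) / 4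

/-- Minus half of the normal derivative of the Levi form along its kernel. -/
def leviDrop (r : E → ℝ) (y N a : E) : ℝ :=
  (-levB (third r y N) a a + levB (hes r y) a N * hes r y N a
    - levB (hes r y) a (Complex.I • N) * hes r y N (Complex.I • a)) / 2

/-- The quadratic form `∂̄_b ω` on the vector `a`. -/
def dbarD (r : E → ℝ) (y N a : E) : ℝ := leviDrop r y N a - dAngeloSq r y N a

lemma norm_dAngelo_sq (r : E → ℝ) (y N a : E) :
    ‖dAngelo (hes r y) N a‖ ^ 2 = dAngeloSq r y N a := by
  rw [dAngelo, norm_mul, mul_pow, ← Complex.normSq_eq_norm_sq (_ + _), Complex.normSq_apply,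
    dAngeloSq]
  simp
  ring

/-- Together with real linearity this gives complex linearity in the vector: `dAngelo` is of type
(1,0). -/
lemma dAngelo_symm_smul (B : E →L[ℝ] E →L[ℝ] ℝ) (N a : E) :
    dAngelo B N (Complex.I • a) = Complex.I * dAngelo B N a := by
  have h : levB B a (-N) = -levB B a N := by simpa using levB_smul_right B (-1) a N
  simp only [dAngelo, levB_I_left, I_smul_I_smul, h]
  push_cast
  linear_combination -(1/2 : ℂ) * (levB B a (Complex.I • N)) * Complex.I_mul_I

/-- `a` is a nonzero null vector of the Levi form of `{r = 0}` at `y`. -/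
structure IsNull (r : E → ℝ) (y a : E) : Prop where
  zero : r y = 0
  tangent : delB (fderiv ℝ r y) a = 0
  null : levB (hes r y) a a = 0
  ne : a ≠ 0

/-- Near `y₀`, the Levi form of `{r = 0}` is nonnegative. -/
def LeviNear (r : E → ℝ) (y₀ : E) : Prop :=
  ∀ᶠ y in 𝓝 y₀, r y = 0 → ∀ a, delB (fderiv ℝ r y) a = 0 → 0 ≤ levB (hes r y) a a

lemma LeviNear.self {r : E → ℝ} {y : E} (h : LeviNear r y) (hr : r y = 0) :
    ∀ a, delB (fderiv ℝ r y) a = 0 → 0 ≤ levB (hes r y) a a :=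
  h.self_of_nhds hr

lemma hes_symm {r : E → ℝ} {y : E} (hr : ContDiffAt ℝ ∞ r y) (u v : E) :
    hes r y u v = hes r y v u :=
  (hr.isSymmSndFDerivAt (by simp only [minSmoothness_of_isRCLikeNormedField]; exact
      WithTop.coe_le_coe.mpr le_top)).eq u v

lemma contDiffAt_fderiv {G : Type*} [NormedAddCommGroup G] [NormedSpace ℝ G] {r : E → G} {y : E}
    (hr : ContDiffAt ℝ ∞ r y) : ContDiffAt ℝ ∞ (fderiv ℝ r) y :=
  hr.fderiv_right le_rfl

end Jets

/-! ### First order expansion of the Hessian of a power along a normal direction -/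

section Expansion

variable {E : Type*} [NormedAddCommGroup E] [NormedSpace ℂ E]

/-- Strict differentiability is essential: the base point y moves at the same time as the increment
shrinks. -/
lemma HasStrictFDerivAt.tendsto_quotient {G : Type*} [NormedAddCommGroup G] [NormedSpace ℝ G]
    {f : E → G} {f' : E →L[ℝ] G} {y₀ : E} (hf : HasStrictFDerivAt f f' y₀) {α : Type*}
    {l : Filter α} {y : α → E} {t : α → ℝ} (hy : Tendsto y l (𝓝 y₀)) (ht : Tendsto t l (𝓝 0))
    (htp : ∀ᶠ k in l, 0 < t k) (u : E) :
    Tendsto (fun k => (t k)⁻¹ • (f (y k + t k • u) - f (y k))) l (𝓝 (f' u)) := by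
  have h1 : Tendsto (fun k => (y k + t k • u, y k)) l (𝓝 (y₀, y₀)) := by
    refine Tendsto.prodMk_nhds ?_ hy
    simpa using hy.add (ht.smul_const u)
  have h2 := (hf.isLittleO.comp_tendsto h1)
  have h3 : (fun k => f (y k + t k • u) - f (y k) - f' (t k • u)) =o[l] fun k => t k := by
    refine (h2.congr_left fun k => ?_).trans_isBigO ?_
    · simp
    · refine Asymptotics.IsBigO.of_bound ‖u‖ (Eventually.of_forall fun k => ?_)
      simp [norm_smul, mul_comm]
  have h4 : Tendsto (fun k => (t k)⁻¹ • (f (y k + t k • u) - f (y k) - f' (t k • u))) l (𝓝 0) := by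
    have := h3.tendsto_inv_smul_nhds_zero
    simpa using this
  have h5 := h4.add_const (f' u)
  rw [zero_add] at h5
  refine h5.congr' ?_
  filter_upwards [htp] with k hk
  rw [smul_sub _ _ (f' _), map_smul, smul_smul, inv_mul_cancel₀ hk.ne', one_smul, sub_add_cancel]

lemma hasStrictFDerivAt_of_smooth {G : Type*} [NormedAddCommGroup G] [NormedSpace ℝ G]
    {f : E → G} {y : E} (hf : ContDiffAt ℝ ∞ f y) : HasStrictFDerivAt f (fderiv ℝ f y) y :=
  hf.hasStrictFDerivAt (by simp)

/-- The limit of the rescaled form `lev + m |∂r|² / (σ r)`. -/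
def limitForm (r : E → ℝ) (y : E) (σ m : ℝ) (N a : E) (C : ℂ) : ℝ :=
  σ / 2 * levB (third r y N) a a + 2 * levB (hes r y) a (C • N)
    + m * ‖2 * C + (σ / 2 : ℝ) * delB (hes r y N) a‖ ^ 2

/-- The form whose positivity on one side of `{r = 0}` is plurisubharmonicity of a power of `r`. -/
def powerForm (r : E → ℝ) (σ m : ℝ) (x v : E) : ℝ :=
  levB (hes r x) v v + m / (σ * r x) * ‖delB (fderiv ℝ r x) v‖ ^ 2

/-- The displacement u = (σ/2)N has σ dr(u) = 1, so σr is asymptotic to t at the displaced point. As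
∂r annihilates a at y, its value on the displaced vector is O(t), and its square divided by σr is
again of order t. It therefore competes with the change of the Hessian and with the cross term. Base
points, vectors and coefficients may all vary along the filter, so the statement covers a fixed line
as well as an arbitrary degenerating family. -/
lemma expansion {r : E → ℝ} {y₀ : E} (hr : ∀ᶠ y in 𝓝 y₀, ContDiffAt ℝ ∞ r y) {σ m : ℝ}
    (hσ : σ * σ = 1) {N : E} (hN : delB (fderiv ℝ r y₀) N = 2) {α : Type*} {l : Filter α}
    {y a : α → E} {t : α → ℝ} {C : α → ℂ} {a₀ : E} {C₀ : ℂ} (hy : Tendsto y l (𝓝 y₀))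
    (ht : Tendsto t l (𝓝 0)) (htp : ∀ᶠ k in l, 0 < t k) (ha : Tendsto a l (𝓝 a₀))
    (hC : Tendsto C l (𝓝 C₀)) (hry : ∀ᶠ k in l, r (y k) = 0)
    (hay : ∀ᶠ k in l, delB (fderiv ℝ r (y k)) (a k) = 0) :
    Tendsto (fun k => (t k)⁻¹ * (powerForm r σ m (y k + t k • ((σ / 2) • N))
      (a k + (t k : ℂ) • (C k • N)) - levB (hes r (y k)) (a k) (a k))) l
      (𝓝 (limitForm r y₀ σ m N a₀ C₀)) := by
  have hr0 := hr.self_of_nhds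
  set u : E := (σ / 2) • N with hu
  have hN' := delB_eq_two_iff.1 hN
  have hB1 : HasStrictFDerivAt (fderiv ℝ r) (hes r y₀) y₀ :=
    hasStrictFDerivAt_of_smooth (contDiffAt_fderiv hr0)
  have hB2 : HasStrictFDerivAt (hes r) (third r y₀) y₀ :=
    hasStrictFDerivAt_of_smooth (contDiffAt_fderiv (contDiffAt_fderiv hr0))
  have q0 := HasStrictFDerivAt.tendsto_quotient (hasStrictFDerivAt_of_smooth hr0) hy ht htp u
  have q1 := HasStrictFDerivAt.tendsto_quotient hB1 hy ht htp u
  have q2 := HasStrictFDerivAt.tendsto_quotient hB2 hy ht htp u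
  set v : α → E := fun k => a k + (t k : ℂ) • (C k • N) with hv
  have hvlim : Tendsto v l (𝓝 a₀) := by
    have h1 : Tendsto (fun k => (t k : ℂ)) l (𝓝 0) := by
      simpa [Function.comp_def] using (Complex.continuous_ofReal.tendsto 0).comp ht
    simpa [hv] using ha.add (h1.smul (hC.smul_const N))
  have hhes : Tendsto (fun k => hes r (y k)) l (𝓝 (hes r y₀)) :=
    (hB2.hasFDerivAt.continuousAt.tendsto).comp hy
  have hd1 : Tendsto (fun k => fderiv ℝ r (y k)) l (𝓝 (fderiv ℝ r y₀)) :=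
    (hB1.hasFDerivAt.continuousAt.tendsto).comp hy
  have hCN : Tendsto (fun k => C k • N) l (𝓝 (C₀ • N)) := hC.smul_const N
  -- The rescaled expression is regrouped so that every factor converges; the denominator tends to σ
  -- dr(u) = 1.
  have lim : Tendsto (fun k =>
      levB ((t k)⁻¹ • (hes r (y k + t k • u) - hes r (y k))) (v k) (v k)
      + (2 * levB (hes r (y k)) (a k) (C k • N)
        + t k * levB (hes r (y k)) (C k • N) (C k • N))
      + m / (σ * ((t k)⁻¹ • (r (y k + t k • u) - r (y k)))) *
        ‖C k * delB (fderiv ℝ r (y k)) N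
          + delB ((t k)⁻¹ • (fderiv ℝ r (y k + t k • u) - fderiv ℝ r (y k))) (v k)‖ ^ 2) l
      (𝓝 (levB (third r y₀ u) a₀ a₀ + (2 * levB (hes r y₀) a₀ (C₀ • N)
        + 0 * levB (hes r y₀) (C₀ • N) (C₀ • N))
        + m / (σ * fderiv ℝ r y₀ u) * ‖C₀ * delB (fderiv ℝ r y₀) N
          + delB (hes r y₀ u) a₀‖ ^ 2)) := by
    refine ((tendsto_levB q2 hvlim hvlim).add (((tendsto_levB hhes ha hCN).const_mul 2).add
      (ht.mul (tendsto_levB hhes hCN hCN)))).add ((Tendsto.div tendsto_const_nhds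
        (q0.const_mul σ) ?_).mul (((hC.mul (tendsto_delB hd1 tendsto_const_nhds)).add
          (tendsto_delB q1 hvlim)).norm.pow 2))
    rw [hu, map_smul, hN'.1, smul_eq_mul]
    intro h0
    have : σ * σ = 0 := by linear_combination h0
    rw [hσ] at this
    exact one_ne_zero this
  have hval : levB (third r y₀ u) a₀ a₀ + (2 * levB (hes r y₀) a₀ (C₀ • N)
        + 0 * levB (hes r y₀) (C₀ • N) (C₀ • N))
        + m / (σ * fderiv ℝ r y₀ u) * ‖C₀ * delB (fderiv ℝ r y₀) N
          + delB (hes r y₀ u) a₀‖ ^ 2 = limitForm r y₀ σ m N a₀ C₀ := by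
    rw [limitForm, hu, map_smul, map_smul, map_smul, levB_smul_left, delB_smul_left, hN, hN'.1,
      smul_eq_mul, show σ * (σ / 2 * 2) = 1 by linear_combination hσ, div_one, mul_comm C₀]
    ring
  rw [hval] at lim
  refine lim.congr' ?_
  have hrev : ∀ᶠ k in l, ContDiffAt ℝ ∞ r (y k) := hy.eventually hr
  filter_upwards [htp, hry, hay, hrev] with k htk hrk hak hrk'
  have hsym := hes_symm hrk'
  have htne : t k ≠ 0 := htk.ne'
  have e1 : v k = a k + t k • (C k • N) := by simp only [hv, Complex.coe_smul]
  have e2 : levB (hes r (y k + t k • u)) (v k) (v k)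
      = levB (hes r (y k + t k • u) - hes r (y k)) (v k) (v k) + levB (hes r (y k)) (a k) (a k)
        + t k * (2 * levB (hes r (y k)) (a k) (C k • N)
        + t k * levB (hes r (y k)) (C k • N) (C k • N)) := by
    rw [levB_sub_left]
    have : levB (hes r (y k)) (v k) (v k) = levB (hes r (y k)) (a k) (a k)
        + t k * (2 * levB (hes r (y k)) (a k) (C k • N)
        + t k * levB (hes r (y k)) (C k • N) (C k • N)) := by
      rw [e1, levB_add_self hsym, levB_smul_right, levB_smul_right, levB_smul_apply]
      ring
    rw [this]; ring
  have e3 : delB (fderiv ℝ r (y k + t k • u)) (v k) = t k * (C k * delB (fderiv ℝ r (y k)) N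
          + delB ((t k)⁻¹ • (fderiv ℝ r (y k + t k • u) - fderiv ℝ r (y k))) (v k)) := by
    have h1 : delB (fderiv ℝ r (y k)) (v k) = t k * (C k * delB (fderiv ℝ r (y k)) N) := by
      rw [e1, delB_add, hak, delB_real_smul, delB_smul, zero_add]
    have htC : (t k : ℂ) ≠ 0 := by exact_mod_cast htne
    rw [delB_smul_left, delB_sub_left, h1]
    push_cast
    field_simp
    ring
  rw [powerForm, e2, e3, norm_mul, mul_pow, levB_smul_left, hrk, sub_zero, smul_eq_mul,
    Complex.norm_real, Real.norm_eq_abs, sq_abs]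
  have hrec : m / (σ * ((t k)⁻¹ * r (y k + t k • u))) = t k * (m / (σ * r (y k + t k • u))) := by
    rw [show σ * ((t k)⁻¹ * r (y k + t k • u)) = (σ * r (y k + t k • u)) / t k by
      field_simp, div_div_eq_mul_div]
    ring
  rw [hrec]
  field_simp
  ring

/-- Completing the square in the limit form. -/
lemma limitForm_eq (r : E → ℝ) (y : E) (σ m : ℝ) (N a : E) (C : ℂ) (z : ℂ)
    (hz : z = 2 * C + (σ / 2 : ℝ) * delB (hes r y N) a) :
    limitForm r y σ m N a C = -σ * leviDrop r y N a
      + (z.re * levB (hes r y) a N + z.im * levB (hes r y) a (Complex.I • N))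
      + m * (z.re ^ 2 + z.im ^ 2) := by
  have hre : z.re = 2 * C.re + σ / 2 * hes r y N a := by simp [hz, delB]
  have him : z.im = 2 * C.im - σ / 2 * hes r y N (Complex.I • a) := by
    simp [hz, delB]; ring
  rw [limitForm, ← hz, ← Complex.normSq_eq_norm_sq, Complex.normSq_apply, levB_complex_smul_right,
    leviDrop]
  have h1 : C.re = (z.re - σ / 2 * hes r y N a) / 2 := by rw [hre]; ring
  have h2 : C.im = (z.im + σ / 2 * hes r y N (Complex.I • a)) / 2 := by rw [him]; ring
  rw [h1, h2]
  ring

/-- In the variable z = 2C + … the form is quadratic with leading coefficient m; what is dropped is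
a sum of two squares over 4m. -/
lemma le_limitForm (r : E → ℝ) (y : E) {σ m : ℝ} (hm : 0 < m) (N a : E) (C : ℂ) :
    -σ * leviDrop r y N a - dAngeloSq r y N a / m ≤ limitForm r y σ m N a C := by
  rw [limitForm_eq r y σ m N a C _ rfl, dAngeloSq]
  set z := 2 * C + (σ / 2 : ℝ) * delB (hes r y N) a
  set p := levB (hes r y) a N
  set q := levB (hes r y) a (Complex.I • N)
  have h : z.re * p + z.im * q + m * (z.re ^ 2 + z.im ^ 2) + (p ^ 2 + q ^ 2) / 4 / m
      = ((2 * m * z.re + p) ^ 2 + (2 * m * z.im + q) ^ 2) / (4 * m) := by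
    field_simp; ring
  have h' : 0 ≤ ((2 * m * z.re + p) ^ 2 + (2 * m * z.im + q) ^ 2) / (4 * m) := by positivity
  linarith

lemma exists_limitForm_eq (r : E → ℝ) (y : E) {σ m : ℝ} (hm : 0 < m) (N a : E) :
    ∃ C, limitForm r y σ m N a C = -σ * leviDrop r y N a - dAngeloSq r y N a / m := by
  set p := levB (hes r y) a N with hp
  set q := levB (hes r y) a (Complex.I • N) with hq
  -- The vertex of the quadratic in z is -(p + iq)/(2m), and C is solved from z = 2C + (σ/2)·`delB
  -- (hes r y N) a`.
  refine ⟨(⟨-p / (2 * m), -q / (2 * m)⟩ - (σ / 2 : ℝ) * delB (hes r y N) a) / 2, ?_⟩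
  rw [limitForm_eq r y σ m N a _ ⟨-p / (2 * m), -q / (2 * m)⟩ (by ring), dAngeloSq, ← hp, ← hq]
  field_simp
  ring

/-- Along this line σr has derivative 1 at the boundary, so the line enters the side on which the
hypothesis speaks. -/
lemma eventually_powerForm_nonneg_line {r : E → ℝ} {y₀ : E}
    (hr : ∀ᶠ y in 𝓝 y₀, ContDiffAt ℝ ∞ r y) {σ m : ℝ} (hσ : σ * σ = 1)
    (hpsh : ∀ᶠ x in 𝓝 y₀, 0 < σ * r x → ∀ v, 0 ≤ powerForm r σ m x v) (hr0 : r y₀ = 0)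
    {N : E} (hN : delB (fderiv ℝ r y₀) N = 2) :
    ∀ᶠ t : ℝ in 𝓝[>] 0, ∀ v, 0 ≤ powerForm r σ m (y₀ + t • ((σ / 2) • N)) v := by
  have htl : Tendsto (fun t : ℝ => t) (𝓝[>] 0) (𝓝 0) := tendsto_id.mono_left inf_le_left
  have htp : ∀ᶠ t : ℝ in 𝓝[>] 0, 0 < t := eventually_mem_nhdsWithin
  have hx : Tendsto (fun t : ℝ => y₀ + t • ((σ / 2) • N)) (𝓝[>] 0) (𝓝 y₀) := by
    simpa using tendsto_const_nhds.add (htl.smul_const ((σ / 2) • N))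
  have hq := HasStrictFDerivAt.tendsto_quotient (hasStrictFDerivAt_of_smooth hr.self_of_nhds)
    (l := 𝓝[>] (0 : ℝ)) (y := fun _ => y₀) (t := fun t => t) tendsto_const_nhds htl htp
    ((σ / 2) • N)
  rw [map_smul, (delB_eq_two_iff.1 hN).1, hr0] at hq
  have hpos : ∀ᶠ t : ℝ in 𝓝[>] 0, 0 < σ * r (y₀ + t • ((σ / 2) • N)) := by
    have h1 := (hq.const_mul σ).eventually (lt_mem_nhds (a := 0) (by
      rw [smul_eq_mul, show σ * (σ / 2 * 2) = 1 by linear_combination hσ]; exact one_pos))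
    filter_upwards [h1, htp] with t h1 h2
    rw [smul_eq_mul, sub_zero] at h1
    have : t * (σ * (t⁻¹ * r (y₀ + t • ((σ / 2) • N)))) = σ * r (y₀ + t • ((σ / 2) • N)) := by
      field_simp
    rw [← this]
    exact mul_pos h2 h1
  filter_upwards [hx.eventually hpsh, hpos] with t h1 h2 using h1 h2

/-- Plurisubharmonicity of a power of `r` on one side forces pseudoconvexity. -/
lemma levB_nonneg_of_powerForm_nonneg {r : E → ℝ} {y₀ : E}
    (hr : ∀ᶠ y in 𝓝 y₀, ContDiffAt ℝ ∞ r y) {σ m : ℝ} (hσ : σ * σ = 1)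
    (hpsh : ∀ᶠ x in 𝓝 y₀, 0 < σ * r x → ∀ v, 0 ≤ powerForm r σ m x v) (hr0 : r y₀ = 0)
    {N : E} (hN : delB (fderiv ℝ r y₀) N = 2) {a : E} (ha : delB (fderiv ℝ r y₀) a = 0) :
    0 ≤ levB (hes r y₀) a a := by
  have htl : Tendsto (fun t : ℝ => t) (𝓝[>] 0) (𝓝 0) := tendsto_id.mono_left inf_le_left
  have htp : ∀ᶠ t : ℝ in 𝓝[>] 0, 0 < t := eventually_mem_nhdsWithin
  have h := expansion hr (m := m) hσ hN (l := 𝓝[>] (0 : ℝ)) (y := fun _ => y₀) (a := fun _ => a)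
    (t := fun t => t) (C := fun _ => 0) tendsto_const_nhds htl htp tendsto_const_nhds
    tendsto_const_nhds (Eventually.of_forall fun _ => hr0) (Eventually.of_forall fun _ => ha)
  have h1 := (htl.mul h).add_const (levB (hes r y₀) a a)
  rw [zero_mul, zero_add] at h1
  refine ge_of_tendsto h1 ?_
  filter_upwards [eventually_powerForm_nonneg_line hr hσ hpsh hr0 hN, htp] with t h2 h3
  rw [mul_inv_cancel_left₀ h3.ne', sub_add_cancel]
  exact h2 _

/-- Plurisubharmonicity of a power of `r` on one side forces the D'Angelo inequality at null
vectors. -/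
lemma dAngelo_ineq_of_powerForm_nonneg {r : E → ℝ} {y₀ : E}
    (hr : ∀ᶠ y in 𝓝 y₀, ContDiffAt ℝ ∞ r y) {σ m : ℝ} (hσ : σ * σ = 1) (hm : 0 < m)
    (hpsh : ∀ᶠ x in 𝓝 y₀, 0 < σ * r x → ∀ v, 0 ≤ powerForm r σ m x v)
    {N a : E} (hN : delB (fderiv ℝ r y₀) N = 2) (ha : IsNull r y₀ a) :
    0 ≤ -σ * dbarD r y₀ N a - (σ + 1 / m) * dAngeloSq r y₀ N a := by
  -- With the optimal C the necessary condition is sharp. Since a is null the term of order 0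
  -- vanishes, and dividing by t leaves the limit form.
  obtain ⟨C, hC⟩ := exists_limitForm_eq r y₀ (σ := σ) hm N a
  have hr0 := ha.zero
  have htl : Tendsto (fun t : ℝ => t) (𝓝[>] 0) (𝓝 0) := tendsto_id.mono_left inf_le_left
  have htp : ∀ᶠ t : ℝ in 𝓝[>] 0, 0 < t := eventually_mem_nhdsWithin
  have h := expansion hr (m := m) hσ hN (l := 𝓝[>] (0 : ℝ)) (y := fun _ => y₀) (a := fun _ => a)
    (t := fun t => t) (C := fun _ => C) tendsto_const_nhds htl htp tendsto_const_nhds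
    tendsto_const_nhds (Eventually.of_forall fun _ => ha.zero)
    (Eventually.of_forall fun _ => ha.tangent)
  have hline := eventually_powerForm_nonneg_line hr hσ hpsh hr0 hN
  have h0 : 0 ≤ limitForm r y₀ σ m N a C := by
    refine ge_of_tendsto h ?_
    filter_upwards [hline, htp] with t h1 h3
    rw [ha.null, sub_zero]
    exact mul_nonneg (inv_nonneg.2 h3.le) (h1 _)
  rw [hC] at h0
  have : -σ * leviDrop r y₀ N a - dAngeloSq r y₀ N a / m
      = -σ * dbarD r y₀ N a - (σ + 1 / m) * dAngeloSq r y₀ N a := by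
    rw [dbarD]; ring
  rwa [this] at h0

/-- Moving back along u decreases σr at a rate close to 1, so it changes sign within time 4σr(x) and
the intermediate value theorem applies. The bound on t makes the projection tend to y₀ along with x.
-/
lemma eventually_exists_zero {r : E → ℝ} {y₀ : E} (hr : ∀ᶠ y in 𝓝 y₀, ContDiffAt ℝ ∞ r y)
    (hr0 : r y₀ = 0) {σ : ℝ} {u : E} (hu : σ * fderiv ℝ r y₀ u = 1) :
    ∀ᶠ x in 𝓝 y₀, 0 < σ * r x → ∃ t, 0 < t ∧ t ≤ 4 * (σ * r x) ∧ r (x - t • u) = 0 := by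
  have hst := hasStrictFDerivAt_of_smooth hr.self_of_nhds
  have hun : 0 < ‖u‖ := by
    rw [norm_pos_iff]; rintro rfl; simp at hu
  have hσ : 0 < |σ| := by
    rw [abs_pos]; rintro rfl; simp at hu
  -- This constant makes the linearization error of σr over the length s at most s/2, so the value
  -- at the end is at most s/4 - s + s/2 < 0.
  have h1 := hst.isLittleO.def (c := 1 / (2 * |σ| * ‖u‖)) (by positivity)
  have h2 : ∀ᶠ y in 𝓝 y₀, ContinuousAt r y := hr.mono fun y hy => hy.continuousAt
  obtain ⟨δ, hδ, hball⟩ := Metric.eventually_nhds_iff_ball.1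
    ((h2.prod_inl_nhds y₀).and h1)
  have hc : Tendsto (fun x => 4 * (σ * r x) * ‖u‖) (𝓝 y₀) (𝓝 0) := by
    have : Tendsto (fun x => 4 * (σ * r x) * ‖u‖) (𝓝 y₀) (𝓝 (4 * (σ * r y₀) * ‖u‖)) :=
      ((hr.self_of_nhds.continuousAt.tendsto.const_mul σ).const_mul 4).mul_const _
    simpa [hr0] using this
  filter_upwards [Metric.ball_mem_nhds y₀ (half_pos hδ),
    hc.eventually (gt_mem_nhds (half_pos hδ))] with x hx1 hx2 hpos
  set s := 4 * (σ * r x) with hs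
  have hspos : 0 < s := by positivity
  have hx0 : ∀ t ∈ Set.Icc 0 s, x - t • u ∈ Metric.ball y₀ δ := fun t ht => by
    rw [Metric.mem_ball, dist_eq_norm] at hx1 ⊢
    calc ‖x - t • u - y₀‖ = ‖(x - y₀) - t • u‖ := by congr 1; abel
      _ ≤ ‖x - y₀‖ + ‖t • u‖ := norm_sub_le _ _
      _ = ‖x - y₀‖ + t * ‖u‖ := by rw [norm_smul, Real.norm_eq_abs, abs_of_nonneg ht.1]
      _ ≤ ‖x - y₀‖ + s * ‖u‖ := by gcongr; exact ht.2
      _ < δ := by linarith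
  have hpair : ∀ t ∈ Set.Icc 0 s, (x - t • u, x) ∈ Metric.ball (y₀, y₀) δ := fun t ht => by
    rw [← ball_prod_same]
    refine ⟨hx0 t ht, ?_⟩
    have := hx0 0 ⟨le_rfl, hspos.le⟩
    simpa using this
  have hcont : ContinuousOn (fun t => σ * r (x - t • u)) (Set.Icc 0 s) := fun t ht => by
    have h3 : ContinuousAt r (x - t • u) := (hball _ (hpair t ht)).1
    have h4 : ContinuousAt (fun t : ℝ => x - t • u) t := by fun_prop
    exact ((ContinuousAt.comp (f := fun t : ℝ => x - t • u) h3 h4).const_mul σ).continuousWithinAt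
  have hend : σ * r (x - s • u) ≤ 0 := by
    have h3 := (hball _ (hpair s ⟨hspos.le, le_rfl⟩)).2
    simp only [sub_sub_cancel_left, map_neg, map_smul, norm_neg, norm_smul, Real.norm_eq_abs,
      abs_of_pos hspos, smul_eq_mul] at h3
    have h4 : |σ * (r (x - s • u) - r x - -(s * fderiv ℝ r y₀ u))| ≤ s / 2 := by
      rw [abs_mul]
      calc |σ| * |r (x - s • u) - r x - -(s * fderiv ℝ r y₀ u)|
          ≤ |σ| * (1 / (2 * |σ| * ‖u‖) * (s * ‖u‖)) := by gcongr
        _ = s / 2 := by field_simp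
    have h5 : σ * (r (x - s • u) - r x - -(s * fderiv ℝ r y₀ u))
        = σ * r (x - s • u) - s / 4 + s := by
      rw [hs]; linear_combination (4 * (σ * r x)) * hu
    rw [h5] at h4
    have := (abs_le.1 h4).2
    linarith
  obtain ⟨t, ht, ht0⟩ := intermediate_value_Icc' hspos.le hcont
    (show (0 : ℝ) ∈ Set.Icc _ _ from ⟨hend, by simpa using hpos.le⟩)
  have hσ0 : σ ≠ 0 := abs_pos.1 hσ
  have ht0' : r (x - t • u) = 0 := (mul_eq_zero.1 ht0).resolve_left hσ0
  refine ⟨t, lt_of_le_of_ne ht.1 ?_, ht.2, ht0'⟩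
  rintro rfl
  simp only [zero_smul, sub_zero] at ht0'
  rw [ht0', mul_zero] at hpos
  exact lt_irrefl _ hpos

end Expansion

/-! ### Strict positivity near the boundary by a limiting argument -/

section StrictPositivity

variable {E : Type*} [NormedAddCommGroup E] [NormedSpace ℂ E]

lemma powerForm_smul (r : E → ℝ) (x : E) (σ m t : ℝ) (v : E) :
    powerForm r σ m x (t • v) = t ^ 2 * powerForm r σ m x v := by
  rw [powerForm, powerForm, levB_smul_right, levB_smul_apply, delB_real_smul, norm_mul, mul_pow,
    Complex.norm_real, Real.norm_eq_abs, sq_abs]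
  ring

lemma Tendsto.exists_abs_le {α : Type*} {l : Filter α} {f : α → ℝ} {x : ℝ}
    (h : Tendsto f l (𝓝 x)) : ∃ K, 0 ≤ K ∧ ∀ᶠ k in l, |f k| ≤ K :=
  ⟨|x| + 1, by positivity, (h.abs.eventually (gt_mem_nhds (lt_add_one _))).mono fun _ hk => hk.le⟩

/-- The elementary estimate bounding the normal component. -/
lemma bound_of_quadratic {m K₁ K₂ K₃ X A D R t : ℝ} (hm : 0 < m) (hK₁ : 0 ≤ K₁) (hK₂ : 0 ≤ K₂)
    (hK₃ : 0 ≤ K₃) (ht : 0 < t) (hR : 0 < R) (hRt : R ≤ 2 * t)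
    (hA : -(t * K₁) - t * X * K₂ ≤ A) (hD : t * X - t * K₃ ≤ D) (h : A + m / R * D ^ 2 ≤ 0) :
    X ≤ 2 * K₃ + 1 + 8 * (K₁ + K₂) / m := by
  -- For large X the bound on D gives D ≥ tX/2, so the square contributes at least t·mX²/8. The
  -- negative part of A is only of size t(K₁ + X K₂).
  by_contra! hc
  have h0 : 0 ≤ 8 * (K₁ + K₂) / m := by positivity
  have hX1 : 1 < X := by linarith
  have hD2 : t * X / 2 ≤ D := by nlinarith
  have hX2 : 8 * (K₁ + K₂) < m * X := by
    have : 8 * (K₁ + K₂) / m < X := by linarith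
    rwa [div_lt_iff₀ hm, mul_comm X] at this
  have h1 : m / (2 * t) * (t * X / 2) ^ 2 ≤ m / R * D ^ 2 := by
    have : 0 ≤ t * X / 2 := by positivity
    gcongr
  have h2 : m / (2 * t) * (t * X / 2) ^ 2 = t * (m * X * X / 8) := by field_simp; ring
  rw [h2] at h1
  have h3 : t * (m * X * X / 8) ≤ t * (K₁ + X * K₂) := by nlinarith
  have h4 := le_of_mul_le_mul_left h3 ht
  nlinarith

set_option maxHeartbeats 1000000 in
-- a long limiting argument with many auxiliary filters
lemma eventually_powerForm_pos_at {r : E → ℝ} {y₀ : E}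
    (hr : ∀ᶠ y in 𝓝 y₀, ContDiffAt ℝ ∞ r y) (hr0 : r y₀ = 0) {σ m : ℝ} (hσ : σ * σ = 1)
    (hm : 0 < m) (hlev : LeviNear r y₀) {N : E} (hN : delB (fderiv ℝ r y₀) N = 2)
    (hcond : ∀ a, IsNull r y₀ a → 0 < -σ * dbarD r y₀ N a - (σ + 1 / m) * dAngeloSq r y₀ N a)
    {a₀ : E} (ha₀ : a₀ ≠ 0) :
    ∀ᶠ p : E × E in 𝓝 (y₀, a₀), 0 < σ * r p.1 → 0 < powerForm r σ m p.1 p.2 := by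
  by_contra hnot
  rw [Filter.not_eventually] at hnot
  have hne : (𝓝 (y₀, a₀) ⊓ 𝓟 {p : E × E | 0 < σ * r p.1 ∧ powerForm r σ m p.1 p.2 ≤ 0}).NeBot := by
    rw [← Filter.frequently_mem_iff_neBot]
    refine hnot.mono fun p hp => ?_
    push Not at hp
    exact hp
  -- An ultrafilter concentrated on the counterexamples plays the role of a sequence: anything that
  -- stays in a compact set converges along it without extraction.
  set U : Ultrafilter (E × E) := @Ultrafilter.of _ _ hne with hU
  have hUle : (U : Filter (E × E)) ≤
      𝓝 (y₀, a₀) ⊓ 𝓟 {p | 0 < σ * r p.1 ∧ powerForm r σ m p.1 p.2 ≤ 0} :=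
    @Ultrafilter.of_le _ _ hne
  have hpb : ∀ᶠ p : E × E in U, 0 < σ * r p.1 ∧ powerForm r σ m p.1 p.2 ≤ 0 :=
    hUle.trans inf_le_right (mem_principal_self _)
  have hp := hpb.mono fun _ h => h.1
  have hbad := hpb.mono fun _ h => h.2
  have hpair : Tendsto (fun p : E × E => p) U (𝓝 (y₀, a₀)) := hUle.trans inf_le_left
  rw [nhds_prod_eq, tendsto_prod_iff'] at hpair
  obtain ⟨hx, hv⟩ := hpair
  have hr1 := hr.self_of_nhds
  set u : E := (σ / 2) • N with hu
  have hN' := delB_eq_two_iff.1 hN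
  have hσu : σ * fderiv ℝ r y₀ u = 1 := by
    rw [hu, map_smul, hN'.1, smul_eq_mul]; linear_combination hσ
  -- project to the zero set
  have hex : ∀ᶠ p : E × E in U, ∃ t, 0 < t ∧ t ≤ 4 * (σ * r p.1) ∧ r (p.1 - t • u) = 0 := by
    filter_upwards [hx.eventually (eventually_exists_zero hr hr0 hσu), hp] with p h1 h2
    exact h1 h2
  obtain ⟨t, ht⟩ : ∃ t : E × E → ℝ, ∀ᶠ p in U,
      0 < t p ∧ t p ≤ 4 * (σ * r p.1) ∧ r (p.1 - t p • u) = 0 := by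
    classical
    refine ⟨fun p => if h : ∃ t, 0 < t ∧ t ≤ 4 * (σ * r p.1) ∧ r (p.1 - t • u) = 0 then h.choose
      else 0, hex.mono fun p h => ?_⟩
    simp only [dif_pos h]
    exact h.choose_spec
  have htp : ∀ᶠ p in U, 0 < t p := ht.mono fun p h => h.1
  have hrx : Tendsto (fun p : E × E => 4 * (σ * r p.1)) U (𝓝 0) := by
    have := ((hr1.continuousAt.tendsto.comp hx).const_mul σ).const_mul 4
    simpa [hr0, Function.comp_def] using this
  have ht0 : Tendsto t U (𝓝 0) :=
    tendsto_of_tendsto_of_tendsto_of_le_of_le' tendsto_const_nhds hrx (htp.mono fun _ h => h.le)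
      (ht.mono fun _ h => h.2.1)
  set y : E × E → E := fun p => p.1 - t p • u with hy
  have hylim : Tendsto y U (𝓝 y₀) := by
    simpa [hy] using hx.sub (ht0.smul_const u)
  have hyx : ∀ p, y p + t p • u = p.1 := fun p => by simp [hy]
  have hB1 : HasStrictFDerivAt (fderiv ℝ r) (hes r y₀) y₀ :=
    hasStrictFDerivAt_of_smooth (contDiffAt_fderiv hr1)
  have hB2 : HasStrictFDerivAt (hes r) (third r y₀) y₀ :=
    hasStrictFDerivAt_of_smooth (contDiffAt_fderiv (contDiffAt_fderiv hr1))
  have q0 := HasStrictFDerivAt.tendsto_quotient (hasStrictFDerivAt_of_smooth hr1) hylim ht0 htp u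
  have q1 := HasStrictFDerivAt.tendsto_quotient hB1 hylim ht0 htp u
  have q2 := HasStrictFDerivAt.tendsto_quotient hB2 hylim ht0 htp u
  simp only [hyx] at q0 q1 q2
  have hhesx : Tendsto (fun p : E × E => hes r p.1) U (𝓝 (hes r y₀)) :=
    (hB2.hasFDerivAt.continuousAt.tendsto).comp hx
  have hd1x : Tendsto (fun p : E × E => fderiv ℝ r p.1) U (𝓝 (fderiv ℝ r y₀)) :=
    (hB1.hasFDerivAt.continuousAt.tendsto).comp hx
  have hhesy : Tendsto (fun p : E × E => hes r (y p)) U (𝓝 (hes r y₀)) :=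
    (hB2.hasFDerivAt.continuousAt.tendsto).comp hylim
  have hd1y : Tendsto (fun p : E × E => fderiv ℝ r (y p)) U (𝓝 (fderiv ℝ r y₀)) :=
    (hB1.hasFDerivAt.continuousAt.tendsto).comp hylim
  -- the limit vector is null
  have hlevx := tendsto_levB hhesx hv hv
  have hdelx := tendsto_delB hd1x hv
  have hle0 : levB (hes r y₀) a₀ a₀ ≤ 0 := by
    refine le_of_tendsto hlevx ?_
    filter_upwards [hbad, hp] with p h1 h2
    have : 0 ≤ m / (σ * r p.1) * ‖delB (fderiv ℝ r p.1) p.2‖ ^ 2 := by positivity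
    rw [powerForm] at h1
    linarith
  -- Multiplying the violated inequality by σr, which tends to 0, removes the singular factor and
  -- leaves only m|2∂r|² in the limit.
  have hdel0 : delB (fderiv ℝ r y₀) a₀ = 0 := by
    have h1 : Tendsto (fun p : E × E => m * ‖delB (fderiv ℝ r p.1) p.2‖ ^ 2
        + (4 * (σ * r p.1)) * (levB (hes r p.1) p.2 p.2) / 4) U
        (𝓝 (m * ‖delB (fderiv ℝ r y₀) a₀‖ ^ 2 + 0 * levB (hes r y₀) a₀ a₀ / 4)) :=
      ((hdelx.norm.pow 2).const_mul m).add ((hrx.mul hlevx).div_const 4)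
    have h2 : m * ‖delB (fderiv ℝ r y₀) a₀‖ ^ 2 + 0 * levB (hes r y₀) a₀ a₀ / 4 ≤ 0 := by
      refine le_of_tendsto h1 ?_
      filter_upwards [hbad, hp] with p h1 h2
      rw [powerForm] at h1
      have h3 : (σ * r p.1) * (levB (hes r p.1) p.2 p.2
        + m / (σ * r p.1) * ‖delB (fderiv ℝ r p.1) p.2‖ ^ 2) ≤ 0 :=
        mul_nonpos_of_nonneg_of_nonpos h2.le h1
      have h4 : (σ * r p.1) * (levB (hes r p.1) p.2 p.2
        + m / (σ * r p.1) * ‖delB (fderiv ℝ r p.1) p.2‖ ^ 2)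
        = (σ * r p.1) * levB (hes r p.1) p.2 p.2 + m * ‖delB (fderiv ℝ r p.1) p.2‖ ^ 2 := by
        rw [mul_add, ← mul_assoc, mul_div_cancel₀ _ h2.ne']
      linarith
    rw [zero_mul, zero_div, add_zero] at h2
    have h3 : ‖delB (fderiv ℝ r y₀) a₀‖ ^ 2 ≤ 0 := by
      by_contra! h
      have := mul_pos hm h
      linarith
    have h4 : ‖delB (fderiv ℝ r y₀) a₀‖ = 0 := by
      have := sq_nonneg ‖delB (fderiv ℝ r y₀) a₀‖
      exact pow_eq_zero_iff (two_ne_zero) |>.1 (le_antisymm h3 this)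
    exact norm_eq_zero.1 h4
  have hnull : IsNull r y₀ a₀ := ⟨hr0, hdel0, le_antisymm hle0 (hlev.self hr0 _ hdel0), ha₀⟩
  -- decompose the vectors
  set c : E × E → ℂ := fun p => delB (fderiv ℝ r (y p)) p.2 / delB (fderiv ℝ r (y p)) N with hc
  set a : E × E → E := fun p => p.2 - c p • N with ha
  -- The normal component c should be of the order of the distance t to the zero set; C is its
  -- rescaled value.
  set C : E × E → ℂ := fun p => c p / (t p : ℂ) with hC
  have hdN : Tendsto (fun p => delB (fderiv ℝ r (y p)) N) U (𝓝 2) := by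
    rw [← hN]; exact tendsto_delB hd1y tendsto_const_nhds
  have hc0 : Tendsto c U (𝓝 0) := by
    have := (tendsto_delB hd1y hv).div hdN two_ne_zero
    rwa [hdel0, zero_div] at this
  have halim : Tendsto a U (𝓝 a₀) := by
    simpa [ha] using hv.sub (hc0.smul_const N)
  have hdN1 : ∀ᶠ p in U, 1 ≤ ‖delB (fderiv ℝ r (y p)) N‖ := by
    have := hdN.norm.eventually (lt_mem_nhds (a := 1) (by norm_num))
    exact this.mono fun _ h => h.le
  have hay : ∀ᶠ p in U, delB (fderiv ℝ r (y p)) (a p) = 0 := by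
    filter_upwards [hdN1] with p h
    exact delB_sub_div_smul (fun h0 => by rw [h0, norm_zero] at h; linarith) _
  have hCt : ∀ᶠ p in U, (t p : ℂ) • (C p • N) = c p • N := by
    filter_upwards [htp] with p h
    have : (t p : ℂ) ≠ 0 := by exact_mod_cast h.ne'
    rw [smul_smul, hC, mul_div_cancel₀ _ this]
  have hlevy : ∀ᶠ p in U, 0 ≤ levB (hes r (y p)) (a p) (a p) := by
    filter_upwards [hylim.eventually hlev, ht, hay] with p h1 h2 h3
    exact h1 h2.2.2 _ h3
  -- bound the normal component
  obtain ⟨K₁, hK₁, hb1⟩ := Tendsto.exists_abs_le (tendsto_levB q2 hv hv)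
  obtain ⟨K₂, hK₂, hb2⟩ := Tendsto.exists_abs_le
    (((((tendsto_levB hhesy halim (tendsto_const_nhds (x := N))).abs).const_mul 2).add
      (((tendsto_levB hhesy halim (tendsto_const_nhds (x := Complex.I • N))).abs).const_mul 2)).add
      (hc0.norm.mul (tendsto_levB hhesy (tendsto_const_nhds (x := N))
        (tendsto_const_nhds (x := N))).abs))
  obtain ⟨K₃, hK₃, hb3⟩ := Tendsto.exists_abs_le (tendsto_delB q1 hv).norm
  have hCb : ∀ᶠ p in U, ‖C p‖ ≤ 2 * K₃ + 1 + 8 * (K₁ + K₂) / m := by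
    have hRt : ∀ᶠ p in U, σ * r p.1 ≤ 2 * t p := by
      have h1 := (q0.const_mul σ).eventually
        (gt_mem_nhds (show σ * fderiv ℝ r y₀ u < 2 by rw [hσu]; norm_num))
      filter_upwards [h1, ht] with p h1 h2
      rw [h2.2.2, sub_zero, smul_eq_mul] at h1
      have : σ * r p.1 = t p * (σ * ((t p)⁻¹ * r p.1)) := by
        have := h2.1.ne'
        field_simp
      rw [this]
      nlinarith [h2.1]
    have hrev : ∀ᶠ p in U, ContDiffAt ℝ ∞ r (y p) := hylim.eventually hr
    filter_upwards [hb1, hb2, hb3, hRt, hp, htp, hbad, hdN1, hlevy, hay, hrev]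
      with p h1 h2 h3 hRt hp htp hbad hdN1 hlevy hay hrev
    have hsym := hes_symm hrev
    have hcX : ‖c p‖ = t p * ‖C p‖ := by
      have : ‖C p‖ = ‖c p‖ / t p := by
        simp only [hC]
        rw [norm_div, Complex.norm_real, Real.norm_eq_abs, abs_of_pos htp]
      rw [this, mul_div_cancel₀ _ htp.ne']
    have hp2 : p.2 = a p + c p • N := by simp [ha]
    -- Here X = ‖C‖, so that tX = ‖c‖. The Levi form of the tangential part at y is nonnegative, so
    -- A can be negative only through the O(t) change of the Hessian and the terms carrying a factor
    -- c.
    refine bound_of_quadratic hm hK₁ hK₂ hK₃ htp hp hRt ?_ ?_ hbad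
    · have e1 : levB (hes r p.1) p.2 p.2 = t p * levB ((t p)⁻¹ • (hes r p.1 - hes r (y p))) p.2 p.2
          + levB (hes r (y p)) p.2 p.2 := by
        rw [levB_smul_left, levB_sub_left]
        have := htp.ne'
        field_simp
        ring
      have e2 : levB (hes r (y p)) p.2 p.2 = levB (hes r (y p)) (a p) (a p)
          + 2 * ((c p).re * levB (hes r (y p)) (a p) N
            + (c p).im * levB (hes r (y p)) (a p) (Complex.I • N))
          + ‖c p‖ ^ 2 * levB (hes r (y p)) N N := by
        rw [hp2, levB_add_self hsym, levB_complex_smul_self hsym, levB_complex_smul_right]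
      have b1 : -(t p * K₁) ≤ t p * levB ((t p)⁻¹ • (hes r p.1 - hes r (y p))) p.2 p.2 := by
        have := (abs_le.1 h1).1
        nlinarith
      have b2 := le_trans (le_abs_self _) h2
      have c1 : -(‖c p‖ * |levB (hes r (y p)) (a p) N|)
          ≤ (c p).re * levB (hes r (y p)) (a p) N := by
        rw [neg_le]
        refine (neg_le_abs _).trans ?_
        rw [abs_mul]
        gcongr
        exact Complex.abs_re_le_norm _
      have c2 : -(‖c p‖ * |levB (hes r (y p)) (a p) (Complex.I • N)|)
          ≤ (c p).im * levB (hes r (y p)) (a p) (Complex.I • N) := by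
        rw [neg_le]
        refine (neg_le_abs _).trans ?_
        rw [abs_mul]
        gcongr
        exact Complex.abs_im_le_norm _
      have c3 : -(‖c p‖ ^ 2 * |levB (hes r (y p)) N N|) ≤ ‖c p‖ ^ 2 * levB (hes r (y p)) N N := by
        have := neg_abs_le (levB (hes r (y p)) N N)
        nlinarith [sq_nonneg ‖c p‖]
      rw [e1, e2, ← hcX]
      nlinarith [norm_nonneg (c p)]
    · have e1 : delB (fderiv ℝ r p.1) p.2 = c p * delB (fderiv ℝ r (y p)) N
          + t p * delB ((t p)⁻¹ • (fderiv ℝ r p.1 - fderiv ℝ r (y p))) p.2 := by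
        have e2 : delB (fderiv ℝ r (y p)) p.2 = c p * delB (fderiv ℝ r (y p)) N := by
          conv_lhs => rw [hp2]
          rw [delB_add, hay, delB_smul, zero_add]
        have htC : (t p : ℂ) ≠ 0 := by exact_mod_cast htp.ne'
        rw [delB_smul_left, delB_sub_left, ← e2]
        push_cast
        field_simp
        ring
      rw [e1, ← hcX]
      have b3 := le_trans (le_abs_self _) h3
      have n1 : ‖(t p : ℂ) * delB ((t p)⁻¹ • (fderiv ℝ r p.1 - fderiv ℝ r (y p))) p.2‖
          ≤ t p * K₃ := by
        rw [norm_mul, Complex.norm_real, Real.norm_eq_abs, abs_of_pos htp]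
        gcongr
      have n2 : ‖c p‖ ≤ ‖c p * delB (fderiv ℝ r (y p)) N‖ := by
        rw [norm_mul]; nlinarith [norm_nonneg (c p)]
      have n3 := norm_sub_norm_le (c p * delB (fderiv ℝ r (y p)) N)
        (-((t p : ℂ) * delB ((t p)⁻¹ • (fderiv ℝ r p.1 - fderiv ℝ r (y p))) p.2))
      rw [norm_neg, sub_neg_eq_add] at n3
      linarith
  obtain ⟨C₀, -, hC₀⟩ :=
      (isCompact_closedBall (0 : ℂ) (2 * K₃ + 1 + 8 * (K₁ + K₂) / m)).ultrafilter_le_nhds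
    (U.map C) (by
      rw [le_principal_iff]
      exact hCb.mono fun p h => by simpa using h)
  have hClim : Tendsto C U (𝓝 C₀) := hC₀
  have hexp := expansion hr (m := m) hσ hN hylim ht0 htp halim hClim (ht.mono fun _ h => h.2.2) hay
  -- The power form is ≤ 0 on the counterexamples and the Levi form at the projected points is ≥ 0,
  -- so every quotient in the expansion is ≤ 0.
  have h0 : limitForm r y₀ σ m N a₀ C₀ ≤ 0 := by
    refine le_of_tendsto hexp ?_
    filter_upwards [hbad, htp, hlevy, hCt] with p h1 h2 h3 h4
    rw [← hu, hyx, h4]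
    have : a p + c p • N = p.2 := by simp [ha]
    rw [this]
    exact mul_nonpos_of_nonneg_of_nonpos (inv_nonneg.2 h2.le) (by linarith)
  have h1 := le_limitForm r y₀ (σ := σ) hm N a₀ C₀
  have h2 := hcond a₀ hnull
  have : -σ * leviDrop r y₀ N a₀ - dAngeloSq r y₀ N a₀ / m
      = -σ * dbarD r y₀ N a₀ - (σ + 1 / m) * dAngeloSq r y₀ N a₀ := by
    rw [dbarD]; ring
  linarith

/-- The strict D'Angelo inequality at the null vectors implies strict plurisubharmonicity. -/
lemma eventually_powerForm_pos [FiniteDimensional ℂ E] {r : E → ℝ} {y₀ : E}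
    (hr : ∀ᶠ y in 𝓝 y₀, ContDiffAt ℝ ∞ r y) (hr0 : r y₀ = 0) {σ m : ℝ} (hσ : σ * σ = 1)
    (hm : 0 < m) (hlev : LeviNear r y₀) {N : E} (hN : delB (fderiv ℝ r y₀) N = 2)
    (hcond : ∀ a, IsNull r y₀ a → 0 < -σ * dbarD r y₀ N a - (σ + 1 / m) * dAngeloSq r y₀ N a) :
    ∀ᶠ x in 𝓝 y₀, 0 < σ * r x → ∀ v, v ≠ 0 → 0 < powerForm r σ m x v := by
  have : ProperSpace E := FiniteDimensional.proper ℂ E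
  -- Compactness of the unit sphere yields one neighbourhood for all unit vectors; homogeneity of
  -- degree two then covers the rest.
  have h := (isCompact_sphere (0 : E) 1).eventually_forall_of_forall_eventually (x₀ := y₀)
    (P := fun x v => 0 < σ * r x → 0 < powerForm r σ m x v) fun a₀ ha₀ =>
      eventually_powerForm_pos_at hr hr0 hσ hm hlev hN hcond
        (fun h => by rw [h] at ha₀; simp at ha₀)
  filter_upwards [h] with x h1 hpos v hv
  have hn : 0 < ‖v‖ := norm_pos_iff.2 hv
  have h3 := h1 (‖v‖⁻¹ • v) (by simp [norm_smul, hn.ne']) hpos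
  rw [powerForm_smul] at h3
  exact (mul_pos_iff_of_pos_left (by positivity)).1 h3

end StrictPositivity

/-! ### Independence of the normal vector on null vectors -/

section NormalIndependence

variable {E : Type*} [NormedAddCommGroup E] [NormedSpace ℂ E]

lemma hasDerivAt_levB {B : ℝ → E →L[ℝ] E →L[ℝ] ℝ} {a b : ℝ → E} {B' : E →L[ℝ] E →L[ℝ] ℝ}
    {a' b' : E} {t : ℝ} (hB : HasDerivAt B B' t) (ha : HasDerivAt a a' t) (hb : HasDerivAt b b' t) :
    HasDerivAt (fun t => levB (B t) (a t) (b t))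
      (levB B' (a t) (b t) + levB (B t) a' (b t) + levB (B t) (a t) b') t := by
  have h := ((hB.clm_apply ha).clm_apply hb).add
    ((hB.clm_apply (ha.const_smul Complex.I)).clm_apply (hb.const_smul Complex.I))
  refine h.congr_deriv ?_
  simp only [levB, add_apply, Pi.smul_apply]
  ring

lemma hasDerivAt_delB {l : ℝ → E →L[ℝ] ℝ} {l' : E →L[ℝ] ℝ} {t : ℝ} (hl : HasDerivAt l l' t)
    (a : E) : HasDerivAt (fun t => delB (l t) a) (delB l' a) t := by
  have h1 := (hl.clm_apply (hasDerivAt_const t a)).ofReal_comp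
  have h2 := (hl.clm_apply (hasDerivAt_const t (Complex.I • a))).ofReal_comp
  refine (h1.sub (h2.const_mul Complex.I)).congr_deriv ?_
  simp [delB]

lemma hasDerivAt_line {G : Type*} [NormedAddCommGroup G] [NormedSpace ℝ G] {f : E → G}
    {f' : E →L[ℝ] G} {y : E} (hf : HasFDerivAt f f' y) (z : E) :
    HasDerivAt (fun t : ℝ => f (y + t • z)) (f' z) 0 := by
  have h1 : HasDerivAt (fun t : ℝ => y + t • z) z 0 := by
    simpa using ((hasDerivAt_id (0 : ℝ)).smul_const z).const_add y
  exact HasFDerivAt.comp_hasDerivAt (f := fun t : ℝ => y + t • z) 0 (by simpa using hf) h1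

lemma contDiffAt_delB {r : E → ℝ} {y : E} (hr : ContDiffAt ℝ ∞ r y) (a : E) :
    ContDiffAt ℝ ∞ (fun y => delB (fderiv ℝ r y) a) y := by
  have h := contDiffAt_fderiv hr
  have h1 : ∀ v, ContDiffAt ℝ ∞ (fun y => ((fderiv ℝ r y v : ℝ) : ℂ)) y := fun v =>
    Complex.ofRealCLM.contDiff.contDiffAt.comp y (h.clm_apply contDiffAt_const)
  exact (h1 a).sub (contDiffAt_const.mul (h1 _))

lemma contDiffAt_complex_smul {c : E → ℂ} {y : E} (hc : ContDiffAt ℝ ∞ c y) (N : E) :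
    ContDiffAt ℝ ∞ (fun y => c y • N) y :=
  (((ContinuousLinearMap.id ℂ ℂ).smulRight N).restrictScalars ℝ).contDiff.contDiffAt.comp y hc

/-- The function `G` whose derivative computes the third order term. -/
def adjusted (r : E → ℝ) (N a : E) (y : E) : E :=
  a - (delB (fderiv ℝ r y) a / delB (fderiv ℝ r y) N) • N

/-- The Levi form on the projections of a constant vector to the complex tangent spaces. -/
def leviAdjusted (r : E → ℝ) (N a : E) (y : E) : ℝ :=
  levB (hes r y) (adjusted r N a y) (adjusted r N a y)

lemma contDiffAt_leviAdjusted {r : E → ℝ} {y₀ N a : E} (hr : ContDiffAt ℝ ∞ r y₀)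
    (hN : delB (fderiv ℝ r y₀) N ≠ 0) : ContDiffAt ℝ ∞ (leviAdjusted r N a) y₀ := by
  have h0 : ContDiffAt ℝ ∞ (adjusted r N a) y₀ :=
    contDiffAt_const.sub (contDiffAt_complex_smul (by
      simp only [div_eq_mul_inv]; exact (contDiffAt_delB hr a).mul ((contDiffAt_delB hr N).inv hN))
          N)
  have h2 : ContDiffAt ℝ ∞ (fun y => Complex.I • adjusted r N a y) y₀ := h0.const_smul Complex.I
  have hB := contDiffAt_fderiv (contDiffAt_fderiv hr)
  exact ((hB.clm_apply h0).clm_apply h0).add ((hB.clm_apply h2).clm_apply h2)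

/-- As ∂r(a) vanishes at y₀, only the numerator of the projection coefficient has to be
differentiated there. Its derivative enters through both slots of the Levi form. -/
lemma fderiv_leviAdjusted {r : E → ℝ} {y₀ N a : E} (hr : ContDiffAt ℝ ∞ r y₀)
    (hN : delB (fderiv ℝ r y₀) N = 2) (ha : delB (fderiv ℝ r y₀) a = 0) (z : E) :
    fderiv ℝ (leviAdjusted r N a) y₀ z = levB (third r y₀ z) a a
      - levB (hes r y₀) a N * hes r y₀ z a
      + levB (hes r y₀) a (Complex.I • N) * hes r y₀ z (Complex.I • a) := by
  have hN0 : delB (fderiv ℝ r y₀) N ≠ 0 := by rw [hN]; exact two_ne_zero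
  have hsym := hes_symm hr
  have hB1 : HasFDerivAt (fderiv ℝ r) (hes r y₀) y₀ :=
    (hasStrictFDerivAt_of_smooth (contDiffAt_fderiv hr)).hasFDerivAt
  have hB2 : HasFDerivAt (hes r) (third r y₀) y₀ :=
    (hasStrictFDerivAt_of_smooth (contDiffAt_fderiv (contDiffAt_fderiv hr))).hasFDerivAt
  have hG := hasDerivAt_line
    (hasStrictFDerivAt_of_smooth (contDiffAt_leviAdjusted (a := a) hr hN0)).hasFDerivAt z
  have d1 := hasDerivAt_line hB1 z
  have hda := hasDerivAt_delB d1 a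
  have hdN := hasDerivAt_delB d1 N
  have hc := hda.div hdN (by simpa using hN0)
  have hA := (hc.smul_const N).const_sub a
  have hG' := hasDerivAt_levB (hasDerivAt_line hB2 z) hA hA
  have := hG.unique hG'
  rw [this]
  simp only [zero_smul, add_zero, ha, hN, zero_div, sub_zero, zero_mul, Pi.div_apply]
  set q := delB (hes r y₀ z) a with hq
  have e1 : (q * 2 / (2 : ℂ) ^ 2) = q / 2 := by ring
  have e2 : levB (hes r y₀) (-((q / 2) • N)) a = -((q / 2).re * levB (hes r y₀) a N
      + (q / 2).im * levB (hes r y₀) a (Complex.I • N)) := by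
    rw [levB_symm hsym, ← neg_smul, levB_complex_smul_right]
    simp
    ring
  have e3 : levB (hes r y₀) a (-((q / 2) • N)) = -((q / 2).re * levB (hes r y₀) a N
      + (q / 2).im * levB (hes r y₀) a (Complex.I • N)) := by
    rw [← neg_smul, levB_complex_smul_right]
    simp
    ring
  have e4 : (q / 2).re = hes r y₀ z a / 2 := by simp [hq, delB]
  have e5 : (q / 2).im = -(hes r y₀ z (Complex.I • a)) / 2 := by simp [hq, delB]
  rw [e1, e2, e3, e4, e5]
  ring

lemma leviDrop_eq_fderiv {r : E → ℝ} {y₀ N a : E} (hr : ContDiffAt ℝ ∞ r y₀)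
    (hN : delB (fderiv ℝ r y₀) N = 2) (ha : delB (fderiv ℝ r y₀) a = 0) :
    leviDrop r y₀ N a = -(fderiv ℝ (leviAdjusted r N a) y₀ N) / 2 := by
  rw [fderiv_leviAdjusted hr hN ha, leviDrop]; ring

/-- On null vectors, `leviDrop` does not depend on the normal vector. -/
lemma leviDrop_congr [FiniteDimensional ℂ E] {r : E → ℝ} {y₀ N N' a : E}
    (hr : ContDiffAt ℝ ∞ r y₀) (hlev : LeviNear r y₀)
    (hN : delB (fderiv ℝ r y₀) N = 2) (hN' : delB (fderiv ℝ r y₀) N' = 2) (ha : IsNull r y₀ a) :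
    leviDrop r y₀ N a = leviDrop r y₀ N' a := by
  have : CompleteSpace E := FiniteDimensional.complete ℂ E
  have hN0 : delB (fderiv ℝ r y₀) N ≠ 0 := by rw [hN]; exact two_ne_zero
  have hG := hasStrictFDerivAt_of_smooth (contDiffAt_leviAdjusted (a := a) hr hN0)
  -- On {r = 0} pseudoconvexity makes this function nonnegative, and it vanishes at y₀ because a is
  -- null. A constrained minimum has derivative proportional to dr, so the derivative sees a normal
  -- vector only through dr(N) = 2.
  have hmin : IsLocalExtrOn (leviAdjusted r N a) {x | r x = r y₀} y₀ := by
    left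
    have hne : ∀ᶠ y in 𝓝 y₀, delB (fderiv ℝ r y) N ≠ 0 :=
      (contDiffAt_delB hr N).continuousAt.eventually_ne hN0
    have h0 : leviAdjusted r N a y₀ = 0 := by
      rw [leviAdjusted, adjusted, ha.tangent]; simpa using ha.null
    have : ∀ᶠ y in 𝓝[{x | r x = r y₀}] y₀, r y = 0 := by
      filter_upwards [self_mem_nhdsWithin] with y hy
      have hy' : r y = r y₀ := hy
      rw [hy', ha.zero]
    filter_upwards [this, hne.filter_mono inf_le_left, hlev.filter_mono inf_le_left] with y h1 h2 h3
    rw [h0]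
    exact h3 h1 _ (delB_sub_div_smul h2 a)
  obtain ⟨α, β, hne, heq⟩ :=
    hmin.exists_multipliers_of_hasStrictFDerivAt_1d (hasStrictFDerivAt_of_smooth hr) hG
  have happ : ∀ z, α * fderiv ℝ r y₀ z + β * fderiv ℝ (leviAdjusted r N a) y₀ z = 0 := fun z => by
    have := congrArg (fun f => f z) heq
    simpa using this
  have hβ : β ≠ 0 := by
    rintro rfl
    have := happ N
    rw [(delB_eq_two_iff.1 hN).1] at this
    have hα : α = 0 := by linarith
    exact hne (by rw [hα]; rfl)
  have hz : fderiv ℝ (leviAdjusted r N a) y₀ (N' - N) = 0 := by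
    have := happ (N' - N)
    rw [map_sub, (delB_eq_two_iff.1 hN).1, (delB_eq_two_iff.1 hN').1, sub_self, mul_zero,
      zero_add] at this
    exact (mul_eq_zero.1 this).resolve_left hβ
  have hN'G : fderiv ℝ (leviAdjusted r N a) y₀ N' = fderiv ℝ (leviAdjusted r N a) y₀ N := by
    rw [map_sub] at hz; linarith
  have hT : delB (fderiv ℝ r y₀) (N' - N) = 0 := by rw [delB_sub, hN, hN', sub_self]
  have hpos := hlev.self ha.zero
  have l1 : levB (hes r y₀) a N' = levB (hes r y₀) a N := by
    have := levB_eq_zero_of_null (hes_symm hr) hpos ha.tangent ha.null hT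
    have h2 : N' = N + (N' - N) := by abel
    rw [h2, levB_add_right, this, add_zero]
  have l2 : levB (hes r y₀) a (Complex.I • N') = levB (hes r y₀) a (Complex.I • N) := by
    have hT' : delB (fderiv ℝ r y₀) (Complex.I • (N' - N)) = 0 := by
      rw [delB_apply_I, hT, mul_zero]
    have := levB_eq_zero_of_null (hes_symm hr) hpos ha.tangent ha.null hT'
    have h2 : Complex.I • N' = Complex.I • N + Complex.I • (N' - N) := by rw [smul_sub]; abel
    rw [h2, levB_add_right, this, add_zero]
  have hq := fderiv_leviAdjusted hr hN ha.tangent N'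
  rw [hN'G] at hq
  rw [leviDrop_eq_fderiv hr hN ha.tangent, hq, leviDrop, l1, l2]
  ring

/-- Two normal vectors differ by a complex tangent vector, and a null vector pairs to zero with all
of those. -/
lemma dAngeloSq_congr {r : E → ℝ} {y₀ N N' a : E}
    (hr : ContDiffAt ℝ ∞ r y₀) (hlev : LeviNear r y₀)
    (hN : delB (fderiv ℝ r y₀) N = 2) (hN' : delB (fderiv ℝ r y₀) N' = 2) (ha : IsNull r y₀ a) :
    dAngeloSq r y₀ N a = dAngeloSq r y₀ N' a := by
  have hT : delB (fderiv ℝ r y₀) (N' - N) = 0 := by rw [delB_sub, hN, hN', sub_self]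
  have hpos := hlev.self ha.zero
  have l1 : levB (hes r y₀) a N' = levB (hes r y₀) a N := by
    have := levB_eq_zero_of_null (hes_symm hr) hpos ha.tangent ha.null hT
    have h2 : N' = N + (N' - N) := by abel
    rw [h2, levB_add_right, this, add_zero]
  have l2 : levB (hes r y₀) a (Complex.I • N') = levB (hes r y₀) a (Complex.I • N) := by
    have hT' : delB (fderiv ℝ r y₀) (Complex.I • (N' - N)) = 0 := by
      rw [delB_apply_I, hT, mul_zero]
    have := levB_eq_zero_of_null (hes_symm hr) hpos ha.tangent ha.null hT'
    have h2 : Complex.I • N' = Complex.I • N + Complex.I • (N' - N) := by rw [smul_sub]; abel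
    rw [h2, levB_add_right, this, add_zero]
  rw [dAngeloSq, dAngeloSq, l1, l2]

lemma dbarD_congr [FiniteDimensional ℂ E] {r : E → ℝ} {y₀ N N' a : E}
    (hr : ContDiffAt ℝ ∞ r y₀) (hlev : LeviNear r y₀)
    (hN : delB (fderiv ℝ r y₀) N = 2) (hN' : delB (fderiv ℝ r y₀) N' = 2) (ha : IsNull r y₀ a) :
    dbarD r y₀ N a = dbarD r y₀ N' a := by
  rw [dbarD, dbarD, leviDrop_congr hr hlev hN hN' ha, dAngeloSq_congr hr hlev hN hN' ha]

end NormalIndependence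

/-! ### Homogeneity and local uniformity of strict inequalities -/

section Scaling

variable {E : Type*} [NormedAddCommGroup E] [NormedSpace ℂ E]

lemma dAngeloSq_smul (r : E → ℝ) (y N a : E) (t : ℝ) :
    dAngeloSq r y N (t • a) = t ^ 2 * dAngeloSq r y N a := by
  simp only [dAngeloSq, levB_smul_apply]; ring

lemma dbarD_smul (r : E → ℝ) (y N a : E) (t : ℝ) :
    dbarD r y N (t • a) = t ^ 2 * dbarD r y N a := by
  rw [dbarD, dbarD, dAngeloSq_smul]
  simp only [leviDrop, levB_smul_apply, levB_smul_right, I_smul_real, map_smul, smul_eq_mul]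
  ring

lemma IsNull.smul {r : E → ℝ} {y a : E} (h : IsNull r y a) {t : ℝ} (ht : t ≠ 0) :
    IsNull r y (t • a) :=
  ⟨h.zero, by rw [delB_real_smul, h.tangent, mul_zero],
    by rw [levB_smul_right, levB_smul_apply, h.null]; ring, smul_ne_zero ht h.ne⟩

/-- A strict inequality between the D'Angelo quantities at one point is uniform nearby. -/
lemma exists_uniform_gap [FiniteDimensional ℂ E] {r : E → ℝ} {y₀ N₀ : E}
    (hr : ∀ᶠ y in 𝓝 y₀, ContDiffAt ℝ ∞ r y) (hlev : LeviNear r y₀)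
    (hN₀ : delB (fderiv ℝ r y₀) N₀ = 2) {τ c : ℝ}
    (hcond : ∀ a, IsNull r y₀ a → 0 < τ * dbarD r y₀ N₀ a - c * dAngeloSq r y₀ N₀ a) :
    ∃ ε > 0, ∀ᶠ y in 𝓝 y₀, ∀ a, IsNull r y a → ∀ N, delB (fderiv ℝ r y) N = 2 →
      0 < τ * dbarD r y N a - (c + ε) * dAngeloSq r y N a := by
  have : ProperSpace E := FiniteDimensional.proper ℂ E
  have hr1 := hr.self_of_nhds
  have hB1 : ContinuousAt (fderiv ℝ r) y₀ := (contDiffAt_fderiv hr1).continuousAt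
  have hB2 : ContinuousAt (hes r) y₀ := (contDiffAt_fderiv (contDiffAt_fderiv hr1)).continuousAt
  have hB3 : ContinuousAt (third r) y₀ :=
    (contDiffAt_fderiv (contDiffAt_fderiv (contDiffAt_fderiv hr1))).continuousAt
  -- A normal vector varying continuously with the base point; by independence it may stand for
  -- every other choice.
  set M : E → E := fun y => (2 / delB (fderiv ℝ r y) N₀) • N₀ with hM
  have hdN : Tendsto (fun y => delB (fderiv ℝ r y) N₀) (𝓝 y₀) (𝓝 2) := by
    rw [← hN₀]; exact tendsto_delB hB1 tendsto_const_nhds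
  have hMlim : Tendsto M (𝓝 y₀) (𝓝 N₀) := by
    have := (tendsto_const_nhds (x := (2 : ℂ))).div hdN two_ne_zero
    simpa [hM] using this.smul_const N₀
  have hMdel : ∀ᶠ y in 𝓝 y₀, delB (fderiv ℝ r y) (M y) = 2 := by
    filter_upwards [hdN.eventually_ne two_ne_zero] with y hy
    simp only [hM]
    rw [delB_smul, div_mul_cancel₀ _ hy]
  -- The gap ε is treated as one more variable near 0. Near a limit that is not null the claim is
  -- vacuous, since null vectors form a closed condition on the sphere; near a null limit the strict
  -- inequality persists by continuity.
  have key := (isCompact_sphere (0 : E) 1).eventually_forall_of_forall_eventually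
    (x₀ := ((0 : ℝ), y₀)) (P := fun (p : ℝ × E) a => IsNull r p.2 a →
      0 < τ * dbarD r p.2 (M p.2) a - (c + p.1) * dAngeloSq r p.2 (M p.2) a) (by
    intro a₀ ha₀
    have ha₀0 : a₀ ≠ 0 := fun h => by rw [h] at ha₀; simp at ha₀
    have hid : Tendsto (fun q : (ℝ × E) × E => q) (𝓝 ((0, y₀), a₀)) (𝓝 ((0, y₀), a₀)) := tendsto_id
    have te : Tendsto (fun q : (ℝ × E) × E => q.1.1) (𝓝 ((0, y₀), a₀)) (𝓝 0) :=
      (continuous_fst.comp continuous_fst).tendsto' _ _ rfl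
    have ty : Tendsto (fun q : (ℝ × E) × E => q.1.2) (𝓝 ((0, y₀), a₀)) (𝓝 y₀) :=
      (continuous_snd.comp continuous_fst).tendsto' _ _ rfl
    have ta : Tendsto (fun q : (ℝ × E) × E => q.2) (𝓝 ((0, y₀), a₀)) (𝓝 a₀) :=
      continuous_snd.tendsto' _ _ rfl
    have tM := hMlim.comp ty
    have tIM := tM.const_smul Complex.I
    have t1 : Tendsto (fun q : (ℝ × E) × E => fderiv ℝ r q.1.2) _ _ := hB1.tendsto.comp ty
    have t2 : Tendsto (fun q : (ℝ × E) × E => hes r q.1.2) _ _ := hB2.tendsto.comp ty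
    have t3 : Tendsto (fun q : (ℝ × E) × E => third r q.1.2) _ _ := hB3.tendsto.comp ty
    have tdel := tendsto_delB t1 ta
    have tlev := tendsto_levB t2 ta ta
    by_cases hd : delB (fderiv ℝ r y₀) a₀ = 0
    swap
    · filter_upwards [tdel.eventually_ne hd] with q h1 h2
      exact absurd h2.tangent h1
    by_cases hl : levB (hes r y₀) a₀ a₀ = 0
    swap
    · filter_upwards [tlev.eventually_ne hl] with q h1 h2
      exact absurd h2.null h1
    by_cases h0 : r y₀ = 0
    swap
    · filter_upwards [(hr1.continuousAt.tendsto.comp ty).eventually_ne h0] with q h1 h2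
      exact absurd h2.zero h1
    have hpos := hcond a₀ ⟨h0, hd, hl, ha₀0⟩
    have tp := tendsto_levB t2 ta tM
    have tq := tendsto_levB t2 ta tIM
    have tk := tendsto_levB (tendsto_clm_apply t3 tM) ta ta
    have tm := tendsto_clm_apply (tendsto_clm_apply t2 tM) ta
    have tn := tendsto_clm_apply (tendsto_clm_apply t2 tM) (ta.const_smul Complex.I)
    have tw := ((tp.pow 2).add (tq.pow 2)).div_const 4
    have td := ((((tk.neg).add (tp.mul tm)).sub (tq.mul tn)).div_const 2).sub tw
    have tot := (td.const_mul τ).sub ((te.const_add c).mul tw)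
    rw [add_zero] at tot
    filter_upwards [tot.eventually (lt_mem_nhds hpos)] with q h1 h2 using h1)
  rw [nhds_prod_eq] at key
  obtain ⟨ε, hε, hε0⟩ :=
      ((key.curry.filter_mono (nhdsWithin_le_nhds (a := (0 : ℝ)) (s := Set.Ioi 0))).and
    (eventually_mem_nhdsWithin (a := (0 : ℝ)) (s := Set.Ioi 0))).exists
  refine ⟨ε, hε0, ?_⟩
  filter_upwards [hε, hMdel, hr, hlev.eventually_nhds] with y h1 h2 h3 h4 a ha N hN
  rw [dbarD_congr h3 h4 hN h2 ha, dAngeloSq_congr h3 h4 hN h2 ha]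
  have hn : 0 < ‖a‖ := norm_pos_iff.2 ha.ne
  have h5 := h1 (‖a‖⁻¹ • a) (by simp [norm_smul, hn.ne']) (ha.smul (inv_ne_zero hn.ne'))
  rw [dbarD_smul, dAngeloSq_smul] at h5
  have h6 : τ * (‖a‖⁻¹ ^ 2 * dbarD r y (M y) a) - (c + ε) * (‖a‖⁻¹ ^ 2 * dAngeloSq r y (M y) a)
      = ‖a‖⁻¹ ^ 2 * (τ * dbarD r y (M y) a - (c + ε) * dAngeloSq r y (M y) a) := by ring
  rw [h6] at h5
  exact (mul_pos_iff_of_pos_left (by positivity)).1 h5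

end Scaling

/-! ### Multiplying a defining function by a positive factor -/

section Transform

variable {E : Type*} [NormedAddCommGroup E] [NormedSpace ℂ E] {r g : E → ℝ} {y₀ : E}

lemma fderiv_exp_mul (hr : ContDiffAt ℝ ∞ r y₀) (hg : ContDiffAt ℝ ∞ g y₀) :
    fderiv ℝ (fun y => Real.exp (g y) * r y) y₀
      = Real.exp (g y₀) • (fderiv ℝ r y₀ + r y₀ • fderiv ℝ g y₀) := by
  have h := ((hasStrictFDerivAt_of_smooth hg).hasFDerivAt.exp).mul
    (hasStrictFDerivAt_of_smooth hr).hasFDerivAt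
  refine (HasFDerivAt.fderiv (f := fun y => Real.exp (g y) * r y) h).trans ?_
  ext v
  simp
  ring

lemma hes_exp_mul (hr : ∀ᶠ y in 𝓝 y₀, ContDiffAt ℝ ∞ r y) (hg : ∀ᶠ y in 𝓝 y₀, ContDiffAt ℝ ∞ g y)
    (u v : E) :
    hes (fun y => Real.exp (g y) * r y) y₀ u v = Real.exp (g y₀) * (hes r y₀ u v
      + fderiv ℝ r y₀ u * fderiv ℝ g y₀ v + r y₀ * hes g y₀ u v
      + fderiv ℝ g y₀ u * (fderiv ℝ r y₀ v + r y₀ * fderiv ℝ g y₀ v)) := by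
  have hev : fderiv ℝ (fun y => Real.exp (g y) * r y) =ᶠ[𝓝 y₀]
      fun y => Real.exp (g y) • (fderiv ℝ r y + r y • fderiv ℝ g y) := by
    filter_upwards [hr, hg] with y h1 h2 using fderiv_exp_mul h1 h2
  have hr0 := hr.self_of_nhds
  have hg0 := hg.self_of_nhds
  have d0 := (hasStrictFDerivAt_of_smooth hr0).hasFDerivAt
  have e0 := (hasStrictFDerivAt_of_smooth hg0).hasFDerivAt
  have d1 := (hasStrictFDerivAt_of_smooth (contDiffAt_fderiv hr0)).hasFDerivAt
  have e1 := (hasStrictFDerivAt_of_smooth (contDiffAt_fderiv hg0)).hasFDerivAt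
  have h := e0.exp.smul (d1.add (d0.smul e1))
  rw [hes, hev.fderiv_eq, HasFDerivAt.fderiv
    (f := fun y => Real.exp (g y) • (fderiv ℝ r y + r y • fderiv ℝ g y)) h]
  simp
  ring

/-- Only the entries (N,u,u) are needed, so it is enough to differentiate the diagonal value of the
Hessian along N. The terms carrying r or dr(u) drop out at y₀. -/
lemma third_exp_mul (hr : ∀ᶠ y in 𝓝 y₀, ContDiffAt ℝ ∞ r y)
    (hg : ∀ᶠ y in 𝓝 y₀, ContDiffAt ℝ ∞ g y) (h0 : r y₀ = 0) (N u : E)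
    (hu : fderiv ℝ r y₀ u = 0) :
    third (fun y => Real.exp (g y) * r y) y₀ N u u = Real.exp (g y₀) * (third r y₀ N u u
      + 2 * (fderiv ℝ g y₀ u * hes r y₀ N u)
      + fderiv ℝ r y₀ N * (hes g y₀ u u + fderiv ℝ g y₀ u ^ 2)
      + fderiv ℝ g y₀ N * hes r y₀ u u) := by
  have hr0 := hr.self_of_nhds
  have hg0 := hg.self_of_nhds
  have hs : ContDiffAt ℝ ∞ (fun y => Real.exp (g y) * r y) y₀ := hg0.exp.mul hr0
  have t1 := (hasDerivAt_line (hasStrictFDerivAt_of_smooth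
    (contDiffAt_fderiv (contDiffAt_fderiv hs))).hasFDerivAt N)
  have t2 := (t1.clm_apply (hasDerivAt_const (0 : ℝ) u)).clm_apply (hasDerivAt_const (0 : ℝ) u)
  have hline : Tendsto (fun t : ℝ => y₀ + t • N) (𝓝 0) (𝓝 y₀) := by
    have : Continuous fun t : ℝ => y₀ + t • N := by fun_prop
    exact this.tendsto' _ _ (by simp)
  have hev : (fun t : ℝ => hes (fun y => Real.exp (g y) * r y) (y₀ + t • N) u u) =ᶠ[𝓝 0]
      fun t => Real.exp (g (y₀ + t • N)) * (hes r (y₀ + t • N) u u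
      + fderiv ℝ r (y₀ + t • N) u * fderiv ℝ g (y₀ + t • N) u
      + r (y₀ + t • N) * hes g (y₀ + t • N) u u
      + fderiv ℝ g (y₀ + t • N) u * (fderiv ℝ r (y₀ + t • N) u
        + r (y₀ + t • N) * fderiv ℝ g (y₀ + t • N) u)) := by
    filter_upwards [hline.eventually hr.eventually_nhds, hline.eventually hg.eventually_nhds]
      with t h1 h2 using hes_exp_mul h1 h2 u u
  have cu := hasDerivAt_const (0 : ℝ) u
  have a0 := hasDerivAt_line (hasStrictFDerivAt_of_smooth hr0).hasFDerivAt N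
  have b0 := hasDerivAt_line (hasStrictFDerivAt_of_smooth hg0).hasFDerivAt N
  have a1 := (hasDerivAt_line
    (hasStrictFDerivAt_of_smooth (contDiffAt_fderiv hr0)).hasFDerivAt N).clm_apply cu
  have b1 := (hasDerivAt_line
    (hasStrictFDerivAt_of_smooth (contDiffAt_fderiv hg0)).hasFDerivAt N).clm_apply cu
  have a2 := ((hasDerivAt_line (hasStrictFDerivAt_of_smooth
    (contDiffAt_fderiv (contDiffAt_fderiv hr0))).hasFDerivAt N).clm_apply cu).clm_apply cu
  have b2 := ((hasDerivAt_line (hasStrictFDerivAt_of_smooth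
    (contDiffAt_fderiv (contDiffAt_fderiv hg0))).hasFDerivAt N).clm_apply cu).clm_apply cu
  have tot := b0.exp.mul (((a2.add (a1.mul b1)).add (a0.mul b2)).add (b1.mul (a1.add (a0.mul b1))))
  have huniq := t2.unique (tot.congr_of_eventuallyEq hev)
  simp only [zero_smul, add_zero, map_zero, h0, hu, zero_mul, mul_zero, zero_add,
    Pi.add_apply, Pi.mul_apply] at huniq
  rw [huniq]
  ring

lemma delB_exp_mul (hr : ContDiffAt ℝ ∞ r y₀) (hg : ContDiffAt ℝ ∞ g y₀) (h0 : r y₀ = 0) (v : E) :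
    delB (fderiv ℝ (fun y => Real.exp (g y) * r y) y₀) v
      = Real.exp (g y₀) * delB (fderiv ℝ r y₀) v := by
  rw [fderiv_exp_mul hr hg, h0, zero_smul, add_zero, delB_smul_left]

/-- Change of the Levi form under multiplication of the defining function by `e^g`. -/
lemma levB_exp_mul_self (hr : ∀ᶠ y in 𝓝 y₀, ContDiffAt ℝ ∞ r y)
    (hg : ∀ᶠ y in 𝓝 y₀, ContDiffAt ℝ ∞ g y) (h0 : r y₀ = 0) {a : E}
    (ha : delB (fderiv ℝ r y₀) a = 0) :
    levB (hes (fun y => Real.exp (g y) * r y) y₀) a a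
      = Real.exp (g y₀) * levB (hes r y₀) a a := by
  obtain ⟨h1, h2⟩ := delB_eq_zero_iff.1 ha
  rw [levB, hes_exp_mul hr hg, hes_exp_mul hr hg, h0, h1, h2, levB]
  ring

/-- On the zero set both ∂r and the Levi form on its kernel are merely multiplied by e^g. -/
lemma isNull_exp_mul (hr : ∀ᶠ y in 𝓝 y₀, ContDiffAt ℝ ∞ r y)
    (hg : ∀ᶠ y in 𝓝 y₀, ContDiffAt ℝ ∞ g y) {a : E} :
    IsNull (fun y => Real.exp (g y) * r y) y₀ a ↔ IsNull r y₀ a := by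
  have he := Real.exp_ne_zero (g y₀)
  have heC : (Real.exp (g y₀) : ℂ) ≠ 0 := by exact_mod_cast he
  constructor
  · intro h
    have h0 : r y₀ = 0 := (mul_eq_zero.1 h.zero).resolve_left he
    have hd := h.tangent
    rw [delB_exp_mul hr.self_of_nhds hg.self_of_nhds h0] at hd
    have hd' := (mul_eq_zero.1 hd).resolve_left heC
    have hl := h.null
    rw [levB_exp_mul_self hr hg h0 hd'] at hl
    exact ⟨h0, hd', (mul_eq_zero.1 hl).resolve_left he, h.ne⟩
  · intro h
    refine ⟨?_, ?_, ?_, h.ne⟩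
    · simp [h.zero]
    · rw [delB_exp_mul hr.self_of_nhds hg.self_of_nhds h.zero, h.tangent, mul_zero]
    · rw [levB_exp_mul_self hr hg h.zero h.tangent, h.null, mul_zero]

lemma delB_exp_mul_normal (hr : ContDiffAt ℝ ∞ r y₀) (hg : ContDiffAt ℝ ∞ g y₀) (h0 : r y₀ = 0)
    {N : E} (hN : delB (fderiv ℝ r y₀) N = 2) :
    delB (fderiv ℝ (fun y => Real.exp (g y) * r y) y₀) (Real.exp (-g y₀) • N) = 2 := by
  rw [delB_exp_mul hr hg h0, delB_real_smul, hN, ← mul_assoc, ← Complex.ofReal_mul, ← Real.exp_add]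
  simp

/-- The vector e^{-g}N is normalized for the new function. The two added terms are the real and
imaginary contributions of 2∂g(a) to ω(a). -/
lemma levB_exp_mul_normal (hr : ∀ᶠ y in 𝓝 y₀, ContDiffAt ℝ ∞ r y)
    (hg : ∀ᶠ y in 𝓝 y₀, ContDiffAt ℝ ∞ g y) {N a : E} (hN : delB (fderiv ℝ r y₀) N = 2)
    (ha : IsNull r y₀ a) :
    levB (hes (fun y => Real.exp (g y) * r y) y₀) a (Real.exp (-g y₀) • N)
      = levB (hes r y₀) a N + 2 * fderiv ℝ g y₀ a ∧
    levB (hes (fun y => Real.exp (g y) * r y) y₀) a (Complex.I • (Real.exp (-g y₀) • N))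
      = levB (hes r y₀) a (Complex.I • N) - 2 * fderiv ℝ g y₀ (Complex.I • a) := by
  obtain ⟨h1, h2⟩ := delB_eq_zero_iff.1 ha.tangent
  obtain ⟨n1, n2⟩ := delB_eq_two_iff.1 hN
  have he : Real.exp (-g y₀) * Real.exp (g y₀) = 1 := by rw [← Real.exp_add]; simp
  rw [I_smul_real, levB_smul_right, levB_smul_right]
  constructor
  · rw [levB, hes_exp_mul hr hg, hes_exp_mul hr hg, ha.zero, h1, h2, n1, n2, levB]
    linear_combination (hes r y₀ a N + hes r y₀ (Complex.I • a) (Complex.I • N)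
      + 2 * fderiv ℝ g y₀ a) * he
  · rw [levB, hes_exp_mul hr hg, hes_exp_mul hr hg, ha.zero, h1, h2, levB, I_smul_I_smul, map_neg,
      map_neg, map_neg, map_neg, n1, n2]
    linear_combination (hes r y₀ a (Complex.I • N) - hes r y₀ (Complex.I • a) N
      - 2 * fderiv ℝ g y₀ (Complex.I • a)) * he

/-- The terms quadratic in dg and the mixed ones cancel between `leviDrop` and `dAngeloSq`, and
dg(N) is multiplied by the Levi form, which is zero at a. The change that remains is linear in g,
and interpolation rests on this. -/
lemma dbarD_exp_mul (hr : ∀ᶠ y in 𝓝 y₀, ContDiffAt ℝ ∞ r y)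
    (hg : ∀ᶠ y in 𝓝 y₀, ContDiffAt ℝ ∞ g y) {N a : E} (hN : delB (fderiv ℝ r y₀) N = 2)
    (ha : IsNull r y₀ a) :
    dbarD (fun y => Real.exp (g y) * r y) y₀ (Real.exp (-g y₀) • N) a
      = dbarD r y₀ N a - levB (hes g y₀) a a := by
  obtain ⟨h1, h2⟩ := delB_eq_zero_iff.1 ha.tangent
  obtain ⟨n1, n2⟩ := delB_eq_two_iff.1 hN
  have he : Real.exp (-g y₀) * Real.exp (g y₀) = 1 := by rw [← Real.exp_add]; simp
  have hl := ha.null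
  rw [levB] at hl
  obtain ⟨l1, l2⟩ := levB_exp_mul_normal hr hg hN ha
  have b1 : ∀ v, fderiv ℝ r y₀ v = 0 → hes (fun y => Real.exp (g y) * r y) y₀
      (Real.exp (-g y₀) • N) v = hes r y₀ N v + 2 * fderiv ℝ g y₀ v := fun v hv => by
    rw [map_smul, smul_apply, smul_eq_mul, hes_exp_mul hr hg, ha.zero, hv, n1]
    linear_combination (hes r y₀ N v + 2 * fderiv ℝ g y₀ v) * he
  rw [dbarD, dAngeloSq, leviDrop, l1, l2, b1 a h1, b1 _ h2, map_smul, levB_smul_left, levB,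
    third_exp_mul hr hg ha.zero N a h1, third_exp_mul hr hg ha.zero N _ h2, n1, dbarD, dAngeloSq,
    leviDrop]
  have hk : Real.exp (-g y₀) * (Real.exp (g y₀) * (third r y₀ N a a
      + 2 * (fderiv ℝ g y₀ a * hes r y₀ N a) + 2 * (hes g y₀ a a + fderiv ℝ g y₀ a ^ 2)
      + fderiv ℝ g y₀ N * hes r y₀ a a)
      + Real.exp (g y₀) * (third r y₀ N (Complex.I • a) (Complex.I • a)
      + 2 * (fderiv ℝ g y₀ (Complex.I • a) * hes r y₀ N (Complex.I • a))
      + 2 * (hes g y₀ (Complex.I • a) (Complex.I • a) + fderiv ℝ g y₀ (Complex.I • a) ^ 2)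
      + fderiv ℝ g y₀ N * hes r y₀ (Complex.I • a) (Complex.I • a)))
      = levB (third r y₀ N) a a + 2 * (fderiv ℝ g y₀ a * hes r y₀ N a)
      + 2 * (fderiv ℝ g y₀ (Complex.I • a) * hes r y₀ N (Complex.I • a))
      + 2 * levB (hes g y₀) a a + 2 * fderiv ℝ g y₀ a ^ 2
      + 2 * fderiv ℝ g y₀ (Complex.I • a) ^ 2 := by
    rw [levB, levB]
    linear_combination (third r y₀ N a a
      + 2 * (fderiv ℝ g y₀ a * hes r y₀ N a) + 2 * (hes g y₀ a a + fderiv ℝ g y₀ a ^ 2)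
      + fderiv ℝ g y₀ N * hes r y₀ a a + (third r y₀ N (Complex.I • a) (Complex.I • a)
      + 2 * (fderiv ℝ g y₀ (Complex.I • a) * hes r y₀ N (Complex.I • a))
      + 2 * (hes g y₀ (Complex.I • a) (Complex.I • a) + fderiv ℝ g y₀ (Complex.I • a) ^ 2)
      + fderiv ℝ g y₀ N * hes r y₀ (Complex.I • a) (Complex.I • a))) * he
      + fderiv ℝ g y₀ N * hl
  rw [hk]
  ring

lemma LeviNear.exp_mul (hr : ∀ᶠ y in 𝓝 y₀, ContDiffAt ℝ ∞ r y)
    (hg : ∀ᶠ y in 𝓝 y₀, ContDiffAt ℝ ∞ g y) (h : LeviNear r y₀) :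
    LeviNear (fun y => Real.exp (g y) * r y) y₀ := by
  filter_upwards [h, hr.eventually_nhds, hg.eventually_nhds] with y h1 h2 h3 h0 a ha
  have h0' : r y = 0 := (mul_eq_zero.1 h0).resolve_left (Real.exp_ne_zero _)
  rw [delB_exp_mul h2.self_of_nhds h3.self_of_nhds h0'] at ha
  have heC : (Real.exp (g y) : ℂ) ≠ 0 := by exact_mod_cast Real.exp_ne_zero _
  have ha' := (mul_eq_zero.1 ha).resolve_left heC
  rw [levB_exp_mul_self h2 h3 h0' ha']
  exact mul_nonneg (Real.exp_pos _).le (h1 h0' a ha')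

end Transform

/-! ### An interpolation inequality -/

section Interpolation

/-- Index 1 refers to a weak solution and index 0 to a strict one. The room κ - κ' absorbs the cross
term in the square; the remaining loss is of order s² while the gain s D₀ is of order s. -/
lemma exists_interpolation_bound {κ κ' K : ℝ} (hκ' : 0 ≤ κ') (hκ : κ' < κ) (hK : 0 < K) :
    ∃ s : ℝ, 0 < s ∧ s < 1 ∧ ∀ D₁ D₀ p₁ q₁ p₀ q₀ : ℝ,
      0 ≤ D₁ - κ * ((p₁ ^ 2 + q₁ ^ 2) / 4) → 0 < D₀ → (p₀ ^ 2 + q₀ ^ 2) / 4 ≤ K * D₀ →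
      0 < (1 - s) * D₁ + s * D₀ - κ' * ((((1 - s) * p₁ + s * p₀) ^ 2
        + ((1 - s) * q₁ + s * q₀) ^ 2) / 4) := by
  -- The coefficient left on the square of the index 0 component by the weighted Cauchy–Schwarz
  -- inequality.
  set C := κ' + κ' ^ 2 / (κ - κ') with hC
  have hκκ : 0 < κ - κ' := sub_pos.2 hκ
  have hC0 : 0 ≤ C := by positivity
  -- Small enough for s·CK < 1, which makes the second order loss smaller than s D₀; also s ≤ 1/2.
  set s := 1 / (2 * (1 + C * K)) with hs
  have hCK : 0 ≤ C * K := by positivity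
  have hs0 : 0 < s := by positivity
  have hs1 : s ≤ 1 / 2 := by
    rw [hs, div_le_div_iff₀ (by positivity) two_pos]; linarith
  have hsC : s * (C * K) < 1 := by
    rw [hs, div_mul_eq_mul_div, one_mul, div_lt_one (by positivity)]; linarith
  refine ⟨s, hs0, by linarith, fun D₁ D₀ p₁ q₁ p₀ q₀ h₁ h₀ hw => ?_⟩
  have key : ∀ x y : ℝ, κ' * ((1 - s) * x + s * y) ^ 2
      ≤ (1 - s) * κ * x ^ 2 + s ^ 2 * C * y ^ 2 := fun x y => by
    have e : (1 - s) * κ * x ^ 2 + s ^ 2 * C * y ^ 2 - κ' * ((1 - s) * x + s * y) ^ 2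
        = (1 - s) * s * κ * x ^ 2 + ((1 - s) ^ 2 * ((κ - κ') * x - κ' * (s / (1 - s)) * y) ^ 2
          / (κ - κ')) := by
      have : 1 - s ≠ 0 := by linarith
      rw [hC]
      field_simp
      ring
    have h2 : 0 ≤ (1 - s) * s * κ * x ^ 2 := by
      have : 0 ≤ 1 - s := by linarith
      have : 0 ≤ κ := by linarith
      positivity
    have h3 : 0 ≤ (1 - s) ^ 2 * ((κ - κ') * x - κ' * (s / (1 - s)) * y) ^ 2 / (κ - κ') := by
      positivity
    linarith
  have k1 := key p₁ p₀
  have k2 := key q₁ q₀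
  have h4 : 0 ≤ (1 - s) * (D₁ - κ * ((p₁ ^ 2 + q₁ ^ 2) / 4)) := mul_nonneg (by linarith) h₁
  have h5 : s ^ 2 * C * ((p₀ ^ 2 + q₀ ^ 2) / 4) ≤ s ^ 2 * C * (K * D₀) :=
    mul_le_mul_of_nonneg_left hw (by positivity)
  have h6 : s ^ 2 * C * (K * D₀) < s * D₀ := by
    have : s * D₀ * (s * (C * K)) < s * D₀ * 1 := mul_lt_mul_of_pos_left hsC (by positivity)
    linarith
  linarith

end Interpolation

/-! ### Real and imaginary parts in ℂ ⊗ V -/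

section Complexification

variable {V W : Type*} [AddCommGroup V] [Module ℝ V] [AddCommGroup W] [Module ℝ W]

lemma rePart_tmul (z : ℂ) (v : V) : rePart (z ⊗ₜ[ℝ] v) = z.re • v := by
  simp [rePart]

lemma imPart_tmul (z : ℂ) (v : V) : imPart (z ⊗ₜ[ℝ] v) = z.im • v := by
  simp [imPart]

@[simp] lemma rePart_mkC (v w : V) : rePart (mkC v w) = v := by
  simp [mkC, rePart_tmul]

@[simp] lemma imPart_mkC (v w : V) : imPart (mkC v w) = w := by
  simp [mkC, imPart_tmul]

lemma mkC_add (v w v' w' : V) : mkC (v + v') (w + w') = mkC v w + mkC v' w' := by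
  simp only [mkC, TensorProduct.tmul_add]; abel

@[simp] lemma mkC_rePart_imPart (Z : ℂ ⊗[ℝ] V) : mkC (rePart Z) (imPart Z) = Z := by
  induction Z using TensorProduct.induction_on with
  | zero => simp [mkC]
  | tmul z v =>
    rw [rePart_tmul, imPart_tmul, mkC, ← TensorProduct.smul_tmul, ← TensorProduct.smul_tmul,
      ← TensorProduct.add_tmul]
    congr 1
    simpa [mul_comm] using Complex.re_add_im z
  | add Z W hZ hW => rw [map_add, map_add, mkC_add, hZ, hW]

lemma complexified_ext {Z W : ℂ ⊗[ℝ] V} (h₁ : rePart Z = rePart W) (h₂ : imPart Z = imPart W) :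
    Z = W := by
  rw [← mkC_rePart_imPart Z, ← mkC_rePart_imPart W, h₁, h₂]

lemma rePart_smul (z : ℂ) (Z : ℂ ⊗[ℝ] V) :
    rePart (z • Z) = z.re • rePart Z - z.im • imPart Z := by
  induction Z using TensorProduct.induction_on with
  | zero => simp
  | tmul w v =>
    rw [TensorProduct.smul_tmul', rePart_tmul, rePart_tmul, imPart_tmul]
    simp [sub_smul, mul_smul]
  | add Z W hZ hW => rw [smul_add, map_add, hZ, hW, map_add, map_add, smul_add, smul_add]; abel

lemma imPart_smul (z : ℂ) (Z : ℂ ⊗[ℝ] V) :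
    imPart (z • Z) = z.re • imPart Z + z.im • rePart Z := by
  induction Z using TensorProduct.induction_on with
  | zero => simp
  | tmul w v =>
    rw [TensorProduct.smul_tmul', imPart_tmul, rePart_tmul, imPart_tmul]
    simp [add_smul, mul_smul]
  | add Z W hZ hW => rw [smul_add, map_add, hZ, hW, map_add, map_add, smul_add, smul_add]; abel

lemma rePart_baseChange (f : V →ₗ[ℝ] W) (Z : ℂ ⊗[ℝ] V) :
    rePart (f.baseChange ℂ Z) = f (rePart Z) := by
  induction Z using TensorProduct.induction_on with
  | zero => simp
  | tmul w v => rw [LinearMap.baseChange_tmul, rePart_tmul, rePart_tmul, map_smul]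
  | add Z W hZ hW => rw [map_add, map_add, hZ, hW, map_add, map_add]

lemma imPart_baseChange (f : V →ₗ[ℝ] W) (Z : ℂ ⊗[ℝ] V) :
    imPart (f.baseChange ℂ Z) = f (imPart Z) := by
  induction Z using TensorProduct.induction_on with
  | zero => simp
  | tmul w v => rw [LinearMap.baseChange_tmul, imPart_tmul, imPart_tmul, map_smul]
  | add Z W hZ hW => rw [map_add, map_add, hZ, hW, map_add, map_add]

@[simp] lemma rePart_conjC (Z : ℂ ⊗[ℝ] V) : rePart (conjC Z) = rePart Z := rePart_mkC _ _

@[simp] lemma imPart_conjC (Z : ℂ ⊗[ℝ] V) : imPart (conjC Z) = -imPart Z := imPart_mkC _ _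

/-- Separation of real and imaginary parts. For a complex structure either equation implies the
other, but here J is an arbitrary real endomorphism. -/
lemma mem_eigenspace_baseChange_I {J : V →ₗ[ℝ] V} {Z : ℂ ⊗[ℝ] V} :
    Z ∈ Module.End.eigenspace (J.baseChange ℂ) Complex.I ↔
      J (rePart Z) = -imPart Z ∧ J (imPart Z) = rePart Z := by
  rw [Module.End.mem_eigenspace_iff]
  constructor
  · intro h
    have h1 := congrArg rePart h
    have h2 := congrArg imPart h
    rw [rePart_baseChange, rePart_smul] at h1
    rw [imPart_baseChange, imPart_smul] at h2
    simpa using And.intro h1 h2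
  · rintro ⟨h1, h2⟩
    refine complexified_ext ?_ ?_
    · rw [rePart_baseChange, rePart_smul, h1]; simp
    · rw [imPart_baseChange, imPart_smul, h2]; simp

end Complexification

/-! ### Holomorphic changes of coordinates and powers -/

section HolomorphicChange

variable {E : Type*} [NormedAddCommGroup E] [NormedSpace ℂ E]

lemma restrictScalars_contDiffAt {τ : E → E} {y : E} (hτ : ContDiffAt ℂ ω τ y) :
    ContDiffAt ℝ ∞ τ y := (hτ.restrict_scalars ℝ).of_le (by exact_mod_cast le_top)

lemma fderiv_real_apply_I {τ : E → E} {y : E} (hτ : ContDiffAt ℂ ω τ y) (v : E) :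
    fderiv ℝ τ y (Complex.I • v) = Complex.I • fderiv ℝ τ y v := by
  have h := (hτ.differentiableAt (by simp)).fderiv_restrictScalars ℝ
  rw [h]
  simp

lemma second_deriv_comp {τ : E → E} {f : E → ℝ} {y : E} (hτ : ∀ᶠ z in 𝓝 y, ContDiffAt ℝ ∞ τ z)
    (hf : ∀ᶠ z in 𝓝 (τ y), ContDiffAt ℝ ∞ f z) (u w : E) :
    hes (f ∘ τ) y u w = hes f (τ y) (fderiv ℝ τ y u) (fderiv ℝ τ y w)
      + fderiv ℝ f (τ y) (fderiv ℝ (fderiv ℝ τ) y u w) := by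
  have hτ0 := hτ.self_of_nhds
  have hf0 := hf.self_of_nhds
  have hev : ∀ᶠ z in 𝓝 y, fderiv ℝ (f ∘ τ) z w = fderiv ℝ f (τ z) (fderiv ℝ τ z w) := by
    filter_upwards [hτ, hτ0.continuousAt.eventually hf] with z h1 h2
    rw [fderiv_comp z (h2.differentiableAt (by simp)) (h1.differentiableAt (by simp))]
    rfl
  have hline : Tendsto (fun t : ℝ => y + t • u) (𝓝 0) (𝓝 y) := by
    have : Continuous fun t : ℝ => y + t • u := by fun_prop
    exact this.tendsto' _ _ (by simp)
  have t1 := (hasDerivAt_line (hasStrictFDerivAt_of_smooth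
    (contDiffAt_fderiv (hf0.comp y hτ0))).hasFDerivAt u).clm_apply (hasDerivAt_const (0 : ℝ) w)
  have d1 : HasFDerivAt (fun z => fderiv ℝ f (τ z)) ((hes f (τ y)).comp (fderiv ℝ τ y)) y :=
    (hasStrictFDerivAt_of_smooth (contDiffAt_fderiv hf0)).hasFDerivAt.comp y
      (hτ0.differentiableAt (by simp)).hasFDerivAt
  have hτ1 : DifferentiableAt ℝ (fderiv ℝ τ) y :=
    (hτ0.fderiv_right (m := ∞) (by simp)).differentiableAt (by simp)
  have t2 := (hasDerivAt_line d1 u).clm_apply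
    ((hasDerivAt_line hτ1.hasFDerivAt u).clm_apply (hasDerivAt_const (0 : ℝ) w))
  have := t1.unique (t2.congr_of_eventuallyEq (hline.eventually hev))
  simpa using this

/-- The complex Hessian is invariant under holomorphic changes of coordinates. -/
lemma levB_hes_comp {τ : E → E} {f : E → ℝ} {y : E} (hτ : ∀ᶠ z in 𝓝 y, ContDiffAt ℂ ω τ z)
    (hf : ∀ᶠ z in 𝓝 (τ y), ContDiffAt ℝ ∞ f z) (v : E) :
    levB (hes (f ∘ τ) y) v v = levB (hes f (τ y)) (fderiv ℝ τ y v) (fderiv ℝ τ y v) := by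
  have hτr : ∀ᶠ z in 𝓝 y, ContDiffAt ℝ ∞ τ z := hτ.mono fun z h => restrictScalars_contDiffAt h
  have hτ0 := hτr.self_of_nhds
  -- The second derivative of a holomorphic map is complex bilinear, so its values at (v,v) and
  -- (iv,iv) are opposite and the terms with df cancel.
  have hI : ∀ u w, fderiv ℝ (fderiv ℝ τ) y u (Complex.I • w)
      = Complex.I • fderiv ℝ (fderiv ℝ τ) y u w := fun u w => by
    have hline : Tendsto (fun t : ℝ => y + t • u) (𝓝 0) (𝓝 y) := by
      have : Continuous fun t : ℝ => y + t • u := by fun_prop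
      exact this.tendsto' _ _ (by simp)
    have hτ1 : DifferentiableAt ℝ (fderiv ℝ τ) y :=
      (hτ0.fderiv_right (m := ∞) (by simp)).differentiableAt (by simp)
    have t1 := (hasDerivAt_line hτ1.hasFDerivAt u).clm_apply
      (hasDerivAt_const (0 : ℝ) (Complex.I • w))
    have t2 := ((hasDerivAt_line hτ1.hasFDerivAt u).clm_apply
      (hasDerivAt_const (0 : ℝ) w)).const_smul Complex.I
    have hev : (fun t : ℝ => fderiv ℝ τ (y + t • u) (Complex.I • w)) =ᶠ[𝓝 0]
        fun t => Complex.I • fderiv ℝ τ (y + t • u) w := by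
      filter_upwards [hline.eventually hτ] with t h using fderiv_real_apply_I h w
    have := t1.unique (t2.congr_of_eventuallyEq hev)
    simpa using this
  have hsym : ∀ u w, fderiv ℝ (fderiv ℝ τ) y u w = fderiv ℝ (fderiv ℝ τ) y w u := fun u w =>
    hτ0.isSymmSndFDerivAt (by
      simp only [minSmoothness_of_isRCLikeNormedField]; exact WithTop.coe_le_coe.mpr le_top) u w
  rw [levB, second_deriv_comp hτr hf, second_deriv_comp hτr hf, hI (Complex.I • v) v,
      hsym (Complex.I • v) v, hI, I_smul_I_smul,
    map_neg, fderiv_real_apply_I hτ.self_of_nhds, levB]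
  ring

lemma norm_delB_sq (l : E →L[ℝ] ℝ) (v : E) : ‖delB l v‖ ^ 2 = l v ^ 2 + l (Complex.I • v) ^ 2 := by
  rw [Complex.sq_norm, Complex.normSq_apply]
  simp [delB]
  ring

/-- The complex Hessian of the signed power `σ (σ r)^γ`. -/
lemma levB_hes_power {r : E → ℝ} {x : E} (hr : ∀ᶠ y in 𝓝 x, ContDiffAt ℝ ∞ r y) {σ : ℝ}
    (hσ : σ * σ = 1) (h0 : 0 < σ * r x) (γ : ℝ) (v : E) :
    levB (hes (fun y => σ * (σ * r y) ^ γ) x) v v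
      = γ * (σ * r x) ^ (γ - 1) * powerForm r σ (σ * (γ - 1)) x v := by
  have hr0 := hr.self_of_nhds
  have hpos : ∀ᶠ y in 𝓝 x, 0 < σ * r y :=
    (continuousAt_const.mul hr0.continuousAt).eventually (lt_mem_nhds h0)
  have hd1 : ∀ᶠ y in 𝓝 x, fderiv ℝ (fun y => σ * (σ * r y) ^ γ) y
      = (γ * (σ * r y) ^ (γ - 1)) • fderiv ℝ r y := by
    filter_upwards [hr, hpos] with y h1 h2
    have h := (((hasStrictFDerivAt_of_smooth h1).hasFDerivAt.const_mul σ).rpow_const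
      (p := γ) (Or.inl h2.ne')).const_mul σ
    refine h.fderiv.trans ?_
    rw [smul_smul, smul_smul]
    congr 1
    linear_combination (γ * (σ * r y) ^ (γ - 1)) * hσ
  have hh : ∀ u w, hes (fun y => σ * (σ * r y) ^ γ) x u w
      = γ * (σ * r x) ^ (γ - 1) * (hes r x u w
        + σ * (γ - 1) / (σ * r x) * (fderiv ℝ r x u * fderiv ℝ r x w)) := fun u w => by
    have d1 := ((hasStrictFDerivAt_of_smooth hr0).hasFDerivAt.const_mul σ).rpow_const
      (p := γ - 1) (Or.inl h0.ne')
    have d2 := (d1.const_mul γ).smul (hasStrictFDerivAt_of_smooth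
        (contDiffAt_fderiv hr0)).hasFDerivAt
    have he : fderiv ℝ (fun y => σ * (σ * r y) ^ γ) =ᶠ[𝓝 x]
      fun y => (γ * (σ * r y) ^ (γ - 1)) • fderiv ℝ r y := hd1
    rw [hes, he.fderiv_eq, HasFDerivAt.fderiv
      (f := fun y => (γ * (σ * r y) ^ (γ - 1)) • fderiv ℝ r y) d2]
    have hp : (σ * r x) ^ (γ - 1 - 1) = (σ * r x) ^ (γ - 1) / (σ * r x) := by
      rw [Real.rpow_sub_one h0.ne']
    simp [hp]
    field_simp
  rw [powerForm, norm_delB_sq, levB, hh, hh, levB]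
  ring

end HolomorphicChange

/-! ### Functions on a complex manifold read in charts -/

section ComplexManifold

variable {E : Type*} [NormedAddCommGroup E] [NormedSpace ℂ E]
  {X : Type*} [TopologicalSpace X] [ChartedSpace E X]

variable (E X) in
/-- The smooth manifold underlying a complex manifold. -/
lemma isManifold_real [IsManifold 𝓘(ℂ, E) ω X] : IsManifold 𝓘(ℝ, E) ∞ X := by
  refine isManifold_of_contDiffOn _ _ _ fun e e' he he' => ?_
  have h := (contDiffGroupoid ω 𝓘(ℂ, E)).compatible he he'
  rw [contDiffGroupoid, mem_groupoid_of_pregroupoid] at h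
  have h1 : ContDiffOn ℂ ω (e.symm ≫ₕ e') (e.symm ≫ₕ e').source := by
    simpa [contDiffPregroupoid] using h.1
  have h2 := (h1.restrict_scalars ℝ).of_le (m := ∞) (by exact_mod_cast le_top)
  simpa using h2

/-- A function in the preferred chart at `x₀`. -/
def inChart (x₀ : X) (u : X → ℝ) : E → ℝ := u ∘ (chartAt E x₀).symm

lemma contDiffAt_transition [IsManifold 𝓘(ℂ, E) ω X] {x₀ x : X} {z : E}
    (hz : z ∈ (chartAt E x).target) (hx : (chartAt E x).symm z ∈ (chartAt E x₀).source) :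
    ContDiffAt ℂ ω (chartAt E x₀ ∘ (chartAt E x).symm) z := by
  have h := contDiffWithinAt_ext_coord_change (I := 𝓘(ℂ, E)) (n := ω) x₀ x (y := z)
    (by simpa using ⟨hz, hx⟩)
  rw [← contDiffWithinAt_univ]
  simpa using h

lemma eventually_contDiffAt_transition [IsManifold 𝓘(ℂ, E) ω X] {x₀ x : X}
    (hx : x ∈ (chartAt E x₀).source) : ∀ᶠ z in 𝓝 (chartAt E x x),
    ContDiffAt ℂ ω (chartAt E x₀ ∘ (chartAt E x).symm) z := by
  have ho := ((chartAt E x).symm.trans (chartAt E x₀)).open_source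
  have hm : chartAt E x x ∈ ((chartAt E x).symm.trans (chartAt E x₀)).source := by
    simpa using hx
  filter_upwards [ho.mem_nhds hm] with z hz
  rw [OpenPartialHomeomorph.trans_source] at hz
  exact contDiffAt_transition hz.1 hz.2

lemma inChart_eventuallyEq [IsManifold 𝓘(ℂ, E) ω X] {x₀ x : X} (u : X → ℝ)
    (hx : x ∈ (chartAt E x₀).source) :
    inChart x u =ᶠ[𝓝 (chartAt E x x)]
      (inChart x₀ u : E → ℝ) ∘ (chartAt E x₀ ∘ (chartAt E x).symm) := by
  have ho := ((chartAt E x).symm.trans (chartAt E x₀)).open_source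
  have hm : chartAt E x x ∈ ((chartAt E x).symm.trans (chartAt E x₀)).source := by
    simpa using hx
  filter_upwards [ho.mem_nhds hm] with z hz
  rw [OpenPartialHomeomorph.trans_source] at hz
  simp only [inChart, Function.comp]
  rw [(chartAt E x₀).left_inv hz.2]

/-- The derivative of the preferred chart at `x₀`. -/
def chartDeriv (x₀ x : X) : TangentSpace 𝓘(ℝ, E) x →L[ℝ] E :=
  mfderiv 𝓘(ℝ, E) 𝓘(ℝ, E) (chartAt E x₀) x

lemma chartDeriv_eq [IsManifold 𝓘(ℂ, E) ω X] {x₀ x : X} (hx : x ∈ (chartAt E x₀).source) :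
    chartDeriv x₀ x = fderiv ℝ (chartAt E x₀ ∘ (chartAt E x).symm) (chartAt E x x) := by
  have := isManifold_real E X
  have h : MDifferentiableAt 𝓘(ℝ, E) 𝓘(ℝ, E) (chartAt E x₀) x :=
    mdifferentiableAt_atlas (chart_mem_atlas E x₀) hx
  rw [chartDeriv, h.mfderiv]
  simp only [writtenInExtChartAt, extChartAt_self_eq, modelWithCornersSelf_coe, Set.range_id,
    fderivWithin_univ]
  rfl

lemma chartDeriv_complexStructure [IsManifold 𝓘(ℂ, E) ω X] {x₀ x : X}
    (hx : x ∈ (chartAt E x₀).source) (v : TangentSpace 𝓘(ℝ, E) x) :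
    chartDeriv x₀ x (complexStructure x v) = Complex.I • chartDeriv x₀ x v := by
  rw [chartDeriv_eq hx]
  exact fderiv_real_apply_I (eventually_contDiffAt_transition hx).self_of_nhds v

lemma chartDeriv_bijective [IsManifold 𝓘(ℂ, E) ω X] {x₀ x : X} (hx : x ∈ (chartAt E x₀).source) :
    Function.Bijective (chartDeriv x₀ x : E → E) := by
  have := isManifold_real E X
  exact (mdifferentiable_chart (I := 𝓘(ℝ, E)) x₀).mfderiv_bijective hx

lemma contDiffAt_inChart [IsManifold 𝓘(ℂ, E) ω X] {u : X → ℝ} {x₀ : X} {y : E}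
    (hy : y ∈ (chartAt E x₀).target)
    (hu : ContMDiffAt 𝓘(ℝ, E) 𝓘(ℝ, ℝ) ∞ u ((chartAt E x₀).symm y)) :
    ContDiffAt ℝ ∞ (inChart x₀ u) y := by
  have := isManifold_real E X
  rw [← contMDiffAt_iff_contDiffAt]
  exact hu.comp y ((contMDiffOn_chart_symm (I := 𝓘(ℝ, E)) (x := x₀)).contMDiffAt
    ((chartAt E x₀).open_target.mem_nhds hy))

lemma eventually_contDiffAt_inChart [IsManifold 𝓘(ℂ, E) ω X] {u : X → ℝ} {x₀ x : X}
    (hx : x ∈ (chartAt E x₀).source)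
    (hu : ∀ᶠ z in 𝓝 x, ContMDiffAt 𝓘(ℝ, E) 𝓘(ℝ, ℝ) ∞ u z) :
    ∀ᶠ y in 𝓝 (chartAt E x₀ x), ContDiffAt ℝ ∞ (inChart x₀ u) y := by
  have hc := (chartAt E x₀).continuousAt_symm ((chartAt E x₀).map_source hx)
  rw [ContinuousAt, (chartAt E x₀).left_inv hx] at hc
  filter_upwards [(chartAt E x₀).open_target.mem_nhds ((chartAt E x₀).map_source hx),
    hc.eventually hu] with y h1 h2 using contDiffAt_inChart h1 h2

/-- The complex Hessian computed in any preferred chart. -/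
lemma complexHessian_eq [IsManifold 𝓘(ℂ, E) ω X] {u : X → ℝ} {x₀ x : X}
    (hx : x ∈ (chartAt E x₀).source)
    (hu : ∀ᶠ z in 𝓝 x, ContMDiffAt 𝓘(ℝ, E) 𝓘(ℝ, ℝ) ∞ u z) (v : E) :
    complexHessian u x v = levB (hes (inChart x₀ u) (chartAt E x₀ x))
      (chartDeriv x₀ x v) (chartDeriv x₀ x v) / 4 := by
  have h1 : complexHessian u x v = levB (hes (inChart x u) (chartAt E x x)) v v / 4 := rfl
  have h3 : chartAt E x₀ ((chartAt E x).symm (chartAt E x x)) = chartAt E x₀ x := by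
    rw [(chartAt E x).left_inv (mem_chart_source E x)]
  have h2 := levB_hes_comp (f := inChart x₀ u) (eventually_contDiffAt_transition hx)
    (by rw [Function.comp, h3]; exact eventually_contDiffAt_inChart hx hu) v
  rw [h1, chartDeriv_eq hx, hes, (inChart_eventuallyEq u hx).fderiv.fderiv_eq, h2, Function.comp,
    h3]
  rfl

lemma mfderiv_eq_inChart [IsManifold 𝓘(ℂ, E) ω X] {u : X → ℝ} {x₀ x : X}
    (hx : x ∈ (chartAt E x₀).source) (hu : MDifferentiableAt 𝓘(ℝ, E) 𝓘(ℝ, ℝ) u x) (v : E) :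
    (mfderiv 𝓘(ℝ, E) 𝓘(ℝ, ℝ) u x : E →L[ℝ] ℝ) v
      = fderiv ℝ (inChart x₀ u) (chartAt E x₀ x) (chartDeriv x₀ x v) := by
  have := isManifold_real E X
  have hc : MDifferentiableAt 𝓘(ℝ, E) 𝓘(ℝ, E) (chartAt E x₀) x :=
    mdifferentiableAt_atlas (chart_mem_atlas E x₀) hx
  have hs : MDifferentiableAt 𝓘(ℝ, E) 𝓘(ℝ, E) (chartAt E x₀).symm (chartAt E x₀ x) :=
    mdifferentiableAt_atlas_symm (chart_mem_atlas E x₀) ((chartAt E x₀).map_source hx)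
  have hu' : MDifferentiableAt 𝓘(ℝ, E) 𝓘(ℝ, ℝ) (inChart x₀ u : E → ℝ) (chartAt E x₀ x) :=
    MDifferentiableAt.comp (I' := 𝓘(ℝ, E)) _ (by rwa [(chartAt E x₀).left_inv hx]) hs
  have hev : u =ᶠ[𝓝 x] (inChart x₀ u : E → ℝ) ∘ (chartAt E x₀) := by
    filter_upwards [(chartAt E x₀).open_source.mem_nhds hx] with z hz
    simp [inChart, (chartAt E x₀).left_inv hz]
  rw [hev.mfderiv_eq, mfderiv_comp x hu' hc, mfderiv_eq_fderiv]
  rfl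

end ComplexManifold

/-! ### Lie brackets seen through vector valued maps -/

section Along

variable {F : Type*} [NormedAddCommGroup F] [NormedSpace ℝ F]
  {M : Type*} [TopologicalSpace M] [ChartedSpace F M]
  {G : Type*} [NormedAddCommGroup G] [NormedSpace ℝ G]

/-- The straight path through `p` in the preferred chart. -/
def path (p : M) (w : F) (t : ℝ) : M := (chartAt F p).symm (chartAt F p p + t • w)

lemma tendsto_path (p : M) (w : F) : Tendsto (path p w) (𝓝 0) (𝓝 p) := by
  have h1 : Tendsto (fun t : ℝ => chartAt F p p + t • w) (𝓝 0) (𝓝 (chartAt F p p)) := by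
    have : Continuous fun t : ℝ => chartAt F p p + t • w := by fun_prop
    exact this.tendsto' _ _ (by simp)
  have h2 := (chartAt F p).continuousAt_symm ((chartAt F p).map_source (mem_chart_source F p))
  rw [ContinuousAt, (chartAt F p).left_inv (mem_chart_source F p)] at h2
  exact h2.comp h1

lemma path_zero (p : M) (w : F) : path p w 0 = p := by
  simp [path, (chartAt F p).left_inv (mem_chart_source F p)]

variable (F) in
/-- The derivative of a vector valued function, as a linear map on the model space. -/
def dM (f : M → G) (p : M) : F →L[ℝ] G := mfderiv 𝓘(ℝ, F) 𝓘(ℝ, G) f p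

lemma hasFDerivAt_comp_chart_symm {f : M → G} {p : M} (hf : MDifferentiableAt 𝓘(ℝ, F) 𝓘(ℝ, G) f p) :
    HasFDerivAt (f ∘ (chartAt F p).symm) (dM F f p) (chartAt F p p) := by
  have h : HasFDerivWithinAt (f ∘ (chartAt F p).symm) (dM F f p) (Set.range id) (chartAt F p p) :=
    hf.hasMFDerivAt.2
  rwa [Set.range_id, hasFDerivWithinAt_univ] at h

lemma hasDerivAt_path {f : M → G} {p : M} (hf : MDifferentiableAt 𝓘(ℝ, F) 𝓘(ℝ, G) f p) (w : F) :
    HasDerivAt (fun t => f (path p w t)) (dM F f p w) 0 := by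
  have h := hasFDerivAt_comp_chart_symm hf
  have h1 : HasDerivAt (fun t : ℝ => chartAt F p p + t • w) w 0 := by
    simpa using ((hasDerivAt_id (0 : ℝ)).smul_const w).const_add (chartAt F p p)
  exact HasFDerivAt.comp_hasDerivAt (f := fun t : ℝ => chartAt F p p + t • w) 0
    (by simpa using h) h1

/-- The image of a vector field under the derivative of a vector valued function. -/
def along (k : M → G) (A : M → F) (q : M) : G := dM F k q (A q)

/-- The field `A` in the preferred chart at `p`. -/
def fieldInChart (p : M) (A : M → F) : F → F :=
  VectorField.mpullbackWithin 𝓘(ℝ, F) 𝓘(ℝ, F) (extChartAt 𝓘(ℝ, F) p).symm A (Set.range 𝓘(ℝ, F))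

/-- The derivative of the inverse of the preferred chart at `p`. -/
def chartSymmDeriv (p : M) (y : F) : F →L[ℝ] F :=
  mfderivWithin 𝓘(ℝ, F) 𝓘(ℝ, F) (extChartAt 𝓘(ℝ, F) p).symm (Set.range 𝓘(ℝ, F)) y

lemma fieldInChart_apply (p : M) (A : M → F) (y : F) : fieldInChart p A y =
    (chartSymmDeriv p y).inverse (A ((chartAt F p).symm y)) := rfl

variable [IsManifold 𝓘(ℝ, F) ∞ M]

lemma contMDiffAt_along {k : M → G} {A : M → F} {p : M}
    (hk : ∀ᶠ q in 𝓝 p, ContMDiffAt 𝓘(ℝ, F) 𝓘(ℝ, G) ∞ k q)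
    (hA : ContMDiffAt 𝓘(ℝ, F) 𝓘(ℝ, F).tangent ∞ (fun q => (⟨q, A q⟩ : TangentBundle 𝓘(ℝ, F) M)) p) :
    ContMDiffAt 𝓘(ℝ, F) 𝓘(ℝ, G) ∞ (along k A) p := by
  obtain ⟨U, hU, hUo, hpU⟩ := eventually_nhds_iff.1 hk
  have h1 : ContMDiffOn 𝓘(ℝ, F) 𝓘(ℝ, G) ∞ k U := fun q hq => (hU q hq).contMDiffWithinAt
  have h2 := h1.contMDiffOn_tangentMapWithin (m := ∞) (by simp) hUo.uniqueMDiffOn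
  have h3 : ContMDiffWithinAt 𝓘(ℝ, F) 𝓘(ℝ, G).tangent ∞
      (fun q => tangentMapWithin 𝓘(ℝ, F) 𝓘(ℝ, G) k U ⟨q, A q⟩) U p :=
    (h2 ⟨p, A p⟩ hpU).comp p hA.contMDiffWithinAt (fun q hq => hq)
  have h4 := ((contMDiff_snd_tangentBundle_modelSpace G 𝓘(ℝ, G)).contMDiffAt.comp_contMDiffWithinAt
    p h3).contMDiffAt (hUo.mem_nhds hpU)
  refine h4.congr_of_eventuallyEq ?_
  filter_upwards [hUo.mem_nhds hpU] with q hq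
  simp only [along, Function.comp, tangentMapWithin]
  rw [mfderivWithin_of_isOpen hUo hq]
  rfl

lemma fieldInChart_self (p : M) (A : M → F) : fieldInChart p A (chartAt F p p) = A p := by
  have h3 : (chartAt F p).symm (chartAt F p p) = p := extChartAt_to_inv (I := 𝓘(ℝ, F)) p
  rw [fieldInChart_apply, h3]
  exact mfderivWithin_extChartAt_symm_inverse_apply (I := 𝓘(ℝ, F)) (x := p) (A p)

/-- The preferred chart at p has identity derivative at p, so the bracket on M is the bracket of the
fields read in that chart. -/
lemma mlieBracket_eq_lieBracket (A B : M → F) (p : M) :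
    (VectorField.mlieBracket 𝓘(ℝ, F) A B p : F)
      = fderiv ℝ (fieldInChart p B) (chartAt F p p) (A p)
        - fderiv ℝ (fieldInChart p A) (chartAt F p p) (B p) := by
  have e : ∀ D : F →L[ℝ] F, D = mfderiv 𝓘(ℝ, F) 𝓘(ℝ, F) (extChartAt 𝓘(ℝ, F) p) p →
      (VectorField.mlieBracket 𝓘(ℝ, F) A B p : F) = D.inverse
        (VectorField.lieBracketWithin (E := F) ℝ (fieldInChart p A) (fieldInChart p B)
          ((extChartAt 𝓘(ℝ, F) p).symm ⁻¹' Set.univ ∩ Set.range (id : F → F)) (chartAt F p p)) := by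
    rintro _ rfl; rfl
  refine (e (ContinuousLinearMap.id ℝ F) (mfderiv_extChartAt_self (I := 𝓘(ℝ, F))
    (x := p)).symm).trans ?_
  rw [ContinuousLinearMap.inverse_id, Set.preimage_univ, Set.range_id, Set.inter_self,
    VectorField.lieBracketWithin_univ, VectorField.lieBracket_eq]
  simp only [fieldInChart_self]
  rfl

lemma differentiableAt_fieldInChart [FiniteDimensional ℝ F] {p : M}
    {A : M → F}
    (hA : ContMDiffAt 𝓘(ℝ, F) 𝓘(ℝ, F).tangent ∞ (fun q => (⟨q, A q⟩ : TangentBundle 𝓘(ℝ, F) M)) p) :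
    DifferentiableAt ℝ (fieldInChart p A) (chartAt F p p) := by
  have : CompleteSpace F := FiniteDimensional.complete ℝ F
  have : IsManifold 𝓘(ℝ, F) 2 M := IsManifold.of_le (n := ∞) (WithTop.coe_le_coe.mpr le_top)
  have h := (hA.mdifferentiableAt (by simp)).mdifferentiableWithinAt
    (s := Set.univ) |>.differentiableWithinAt_mpullbackWithin_vectorField
  rw [Set.preimage_univ, Set.univ_inter] at h
  have h2 : DifferentiableWithinAt ℝ (fieldInChart p A) (Set.range (id : F → F)) (chartAt F p p) :=
      h
  rwa [Set.range_id, differentiableWithinAt_univ] at h2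

lemma along_comp_chart_symm {k : M → G} {p : M} (A : M → F)
    (hk : ∀ᶠ q in 𝓝 p, ContMDiffAt 𝓘(ℝ, F) 𝓘(ℝ, G) ∞ k q) :
    ∀ᶠ y in 𝓝 (chartAt F p p), along k A ((chartAt F p).symm y)
      = fderiv ℝ (k ∘ (chartAt F p).symm) y (fieldInChart p A y) := by
  have : IsManifold 𝓘(ℝ, F) 1 M := IsManifold.of_le (n := ∞) (WithTop.coe_le_coe.mpr le_top)
  have hc := (chartAt F p).continuousAt_symm ((chartAt F p).map_source (mem_chart_source F p))
  rw [ContinuousAt, (chartAt F p).left_inv (mem_chart_source F p)] at hc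
  filter_upwards [hc.eventually hk, (chartAt F p).open_target.mem_nhds (mem_chart_target F p)]
    with y h1 h2
  have hy : y ∈ (extChartAt 𝓘(ℝ, F) p).target := by simpa using h2
  have hinv : (chartSymmDeriv p y).IsInvertible := isInvertible_mfderivWithin_extChartAt_symm hy
  have he : chartSymmDeriv p y = mfderiv 𝓘(ℝ, F) 𝓘(ℝ, F) (chartAt F p).symm y := by
    have h2 : (Set.range 𝓘(ℝ, F)) = Set.univ := by simp
    rw [chartSymmDeriv, h2, mfderivWithin_univ]
    rfl
  have hs : MDifferentiableAt 𝓘(ℝ, F) 𝓘(ℝ, F) (chartAt F p).symm y :=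
    mdifferentiableAt_atlas_symm (chart_mem_atlas F p) h2
  have hcomp : fderiv ℝ (k ∘ (chartAt F p).symm) y
      = (dM F k ((chartAt F p).symm y)).comp (chartSymmDeriv p y) := by
    rw [← mfderiv_eq_fderiv, he]
    exact mfderiv_comp y (h1.mdifferentiableAt (by simp)) hs
  rw [hcomp, fieldInChart_apply, ContinuousLinearMap.comp_apply, hinv.self_apply_inverse]
  rfl

/-- The derivative of a map sends the Lie bracket of two fields to the antisymmetrized derivative
of the images of the fields. -/
lemma mfderiv_mlieBracket [FiniteDimensional ℝ F] {k : M → G} {p : M}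
    {A B : M → F}
    (hk : ∀ᶠ q in 𝓝 p, ContMDiffAt 𝓘(ℝ, F) 𝓘(ℝ, G) ∞ k q)
    (hA : ContMDiffAt 𝓘(ℝ, F) 𝓘(ℝ, F).tangent ∞ (fun q => (⟨q, A q⟩ : TangentBundle 𝓘(ℝ, F) M)) p)
    (hB : ContMDiffAt 𝓘(ℝ, F) 𝓘(ℝ, F).tangent ∞ (fun q => (⟨q, B q⟩ : TangentBundle 𝓘(ℝ, F) M)) p) :
    dM F k p (VectorField.mlieBracket 𝓘(ℝ, F) A B p)
      = dM F (along k B) p (A p)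
        - dM F (along k A) p (B p) := by
  set y₀ := chartAt F p p with hy₀
  have hk0 := hk.self_of_nhds
  have hks : ContDiffAt ℝ ∞ (k ∘ (chartAt F p).symm) y₀ := by
    rw [← contMDiffAt_iff_contDiffAt]
    refine ContMDiffAt.comp (I' := 𝓘(ℝ, F)) y₀ ?_
      ((contMDiffOn_chart_symm (I := 𝓘(ℝ, F)) (x := p)).contMDiffAt
      ((chartAt F p).open_target.mem_nhds (mem_chart_target F p)))
    rwa [hy₀, (chartAt F p).left_inv (mem_chart_source F p)]
  have hd2 : DifferentiableAt ℝ (fderiv ℝ (k ∘ (chartAt F p).symm)) y₀ :=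
    (hks.fderiv_right (m := ∞) (by simp)).differentiableAt (by simp)
  -- The derivative of dk(C) is a second derivative of k plus dk of the derivative of C.
  -- Antisymmetrization removes the first part.
  have key : ∀ {C : M → F}, ContMDiffAt 𝓘(ℝ, F) 𝓘(ℝ, F).tangent ∞
      (fun q => (⟨q, C q⟩ : TangentBundle 𝓘(ℝ, F) M)) p → ∀ w : F,
      dM F (along k C) p w
        = fderiv ℝ (fderiv ℝ (k ∘ (chartAt F p).symm)) y₀ w (C p)
          + fderiv ℝ (k ∘ (chartAt F p).symm) y₀ (fderiv ℝ (fieldInChart p C) y₀ w) := by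
    intro C hC w
    have h1 := hasFDerivAt_comp_chart_symm ((contMDiffAt_along hk hC).mdifferentiableAt (by simp))
    have h2 := hd2.hasFDerivAt.clm_apply (differentiableAt_fieldInChart hC).hasFDerivAt
    have h3 := h1.unique (h2.congr_of_eventuallyEq (along_comp_chart_symm C hk))
    rw [h3, hy₀, fieldInChart_self]
    rw [add_comm]
    rfl
  have hsym := hks.isSymmSndFDerivAt (by
    simp only [minSmoothness_of_isRCLikeNormedField]; exact WithTop.coe_le_coe.mpr le_top)
  have h0 := (hasFDerivAt_comp_chart_symm (hk0.mdifferentiableAt (by simp))).fderiv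
  rw [key hA, key hB, mlieBracket_eq_lieBracket, ← h0, hsym.eq (A p) (B p),
    map_sub]
  abel

end Along

/-! ### Local models of a CR hypersurface -/

section LocalFormulas

variable {E : Type*} [NormedAddCommGroup E] [NormedSpace ℂ E]
  {F : Type*} [NormedAddCommGroup F] [NormedSpace ℝ F]
  {M : Type*} [TopologicalSpace M] [ChartedSpace F M]

/-- The real part of a complex field, with values in the model space. -/
def reF (Z : CVectorField F M) (q : M) : F := rePart (Z q)

/-- The imaginary part of a complex field, with values in the model space. -/
def imF (Z : CVectorField F M) (q : M) : F := imPart (Z q)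

/-- The Lie bracket of real vector fields, with values in the model space. -/
def bracketF (A B : M → F) (p : M) : F := VectorField.mlieBracket 𝓘(ℝ, F) A B p

lemma dM_bracketF [FiniteDimensional ℝ F] [IsManifold 𝓘(ℝ, F) ∞ M] {k : M → E} {p : M}
    {A B : M → F} (hk : ∀ᶠ q in 𝓝 p, ContMDiffAt 𝓘(ℝ, F) 𝓘(ℝ, E) ∞ k q)
    (hA : ContMDiffAt 𝓘(ℝ, F) 𝓘(ℝ, F).tangent ∞ (fun q => (⟨q, A q⟩ : TangentBundle 𝓘(ℝ, F) M)) p)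
    (hB : ContMDiffAt 𝓘(ℝ, F) 𝓘(ℝ, F).tangent ∞ (fun q => (⟨q, B q⟩ : TangentBundle 𝓘(ℝ, F) M)) p) :
    dM F k p (bracketF A B p) = dM F (along k B) p (A p) - dM F (along k A) p (B p) :=
  mfderiv_mlieBracket hk hA hB

lemma reF_bracket (Z W : CVectorField F M) (p : M) :
    reF (bracket Z W) p = bracketF (reF Z) (reF W) p - bracketF (imF Z) (imF W) p := rePart_mkC _ _

lemma imF_bracket (Z W : CVectorField F M) (p : M) :
    imF (bracket Z W) p = bracketF (reF Z) (imF W) p + bracketF (imF Z) (reF W) p := imPart_mkC _ _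

lemma reF_conjField (Z : CVectorField F M) : reF (conjField Z) = reF Z :=
  funext fun _ => rePart_conjC _

lemma imF_conjField (Z : CVectorField F M) (q : M) : imF (conjField Z) q = -imF Z q :=
  imPart_conjC _

/-- In the coordinates given by `k`, the hypersurface `M` is defined by `r = 0`, its CR structure
is induced by the complex structure of `E`, and the form `η` is `σ (∂r - ∂̄r)/2`. -/
structure LocalModel (T10 : CRBundle F M) (η : CForm F M) (k : M → E) (r : E → ℝ) (σ : ℝ) (p : M) :
    Prop where
  smooth_map : ∀ᶠ q in 𝓝 p, ContMDiffAt 𝓘(ℝ, F) 𝓘(ℝ, E) ∞ k q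
  smooth_fun : ∀ᶠ y in 𝓝 (k p), ContDiffAt ℝ ∞ r y
  zero : ∀ᶠ q in 𝓝 p, r (k q) = 0
  retract : ∃ Λ : E → M, (∀ᶠ y in 𝓝 (k p), ContMDiffAt 𝓘(ℝ, E) 𝓘(ℝ, F) ∞ Λ y) ∧
    ∀ᶠ q in 𝓝 p, Λ (k q) = q
  injective : ∀ᶠ q in 𝓝 p, Function.Injective (dM F k q)
  regular : ∀ᶠ q in 𝓝 p, fderiv ℝ r (k q) ≠ 0
  range : ∀ᶠ q in 𝓝 p, ∀ e, fderiv ℝ r (k q) e = 0 → ∃ v, dM F k q v = e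
  mem_iff : ∀ᶠ q in 𝓝 p, ∀ Z : ℂ ⊗[ℝ] TangentSpace 𝓘(ℝ, F) q,
    Z ∈ T10 q ↔ dM F k q (imPart Z) = -(Complex.I • dM F k q (rePart Z))
  form_eq : ∀ᶠ q in 𝓝 p, ∀ v : F,
    η q v = (σ : ℂ) * (-(Complex.I / 2) * (fderiv ℝ r (k q) (Complex.I • dM F k q v) : ℂ))
  sign : σ * σ = 1

namespace LocalModel

variable {T10 : CRBundle F M} {η : CForm F M} {k : M → E} {r : E → ℝ} {σ : ℝ} {p : M}

/-- All clauses but the sign are statements near p, so they persist at nearby points. This lets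
pointwise formulas be differentiated. -/
lemma eventually (h : LocalModel T10 η k r σ p) : ∀ᶠ q in 𝓝 p, LocalModel T10 η k r σ q := by
  obtain ⟨Λ, hΛ, hΛk⟩ := h.retract
  have hc := h.smooth_map.self_of_nhds.continuousAt
  filter_upwards [h.smooth_map.eventually_nhds, hc.eventually h.smooth_fun.eventually_nhds,
    h.zero.eventually_nhds, h.injective.eventually_nhds, h.range.eventually_nhds,
    h.mem_iff.eventually_nhds, h.form_eq.eventually_nhds, hc.eventually hΛ.eventually_nhds,
    hΛk.eventually_nhds, h.regular.eventually_nhds] with q h1 h2 h3 h4 h5 h6 h7 h8 h9 h10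
  exact ⟨h1, h2, h3, ⟨Λ, h8, h9⟩, h4, h10, h5, h6, h7, h.sign⟩

lemma mdifferentiableAt_map (h : LocalModel T10 η k r σ p) :
    MDifferentiableAt 𝓘(ℝ, F) 𝓘(ℝ, E) k p :=
  h.smooth_map.self_of_nhds.mdifferentiableAt (by simp)

lemma hasDerivAt_jet {G : Type*} [NormedAddCommGroup G] [NormedSpace ℝ G] {B : E → G}
    (h : LocalModel T10 η k r σ p) (hB : ContDiffAt ℝ ∞ B (k p)) (w : F) :
    HasDerivAt (fun t => B (k (path p w t))) (fderiv ℝ B (k p) (dM F k p w)) 0 := by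
  have h1 := (hasStrictFDerivAt_of_smooth hB).hasFDerivAt
  have h2 := hasDerivAt_path h.mdifferentiableAt_map w
  exact HasFDerivAt.comp_hasDerivAt (f := fun t => k (path p w t)) 0
    (by simpa [path_zero] using h1) h2

/-- Differentiation of a linear constraint satisfied by a function on `M`. -/
lemma constraint (h : LocalModel T10 η k r σ p) {f : M → E}
    (hf : MDifferentiableAt 𝓘(ℝ, F) 𝓘(ℝ, E) f p) {c : ℝ}
    (hc : ∀ᶠ q in 𝓝 p, fderiv ℝ r (k q) (f q) = c) (w : F) :
    hes r (k p) (dM F k p w) (f p) + fderiv ℝ r (k p) (dM F f p w) = 0 := by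
  have h1 := h.hasDerivAt_jet (contDiffAt_fderiv h.smooth_fun.self_of_nhds) w
  have h2 := h1.clm_apply (hasDerivAt_path hf w)
  have h3 : (fun t => fderiv ℝ r (k (path p w t)) (f (path p w t))) =ᶠ[𝓝 0] fun _ => c :=
    (tendsto_path p w).eventually hc
  have h4 := h2.unique ((hasDerivAt_const (0 : ℝ) c).congr_of_eventuallyEq h3)
  simpa [path_zero] using h4

lemma tangent (h : LocalModel T10 η k r σ p) (w : F) : fderiv ℝ r (k p) (dM F k p w) = 0 := by
  have h1 := h.hasDerivAt_jet h.smooth_fun.self_of_nhds w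
  have h3 : (fun t => r (k (path p w t))) =ᶠ[𝓝 0] fun _ => 0 := (tendsto_path p w).eventually h.zero
  exact h1.unique ((hasDerivAt_const (0 : ℝ) (0 : ℝ)).congr_of_eventuallyEq h3)

end LocalModel

lemma dM_I_smul {f : M → E} {p : M} (hf : MDifferentiableAt 𝓘(ℝ, F) 𝓘(ℝ, E) f p) (w : F) :
    dM F (fun q => Complex.I • f q) p w = Complex.I • dM F f p w := by
  have h1 := (hasDerivAt_path hf w).const_smul Complex.I
  have hd : MDifferentiableAt 𝓘(ℝ, F) 𝓘(ℝ, E) (fun q => Complex.I • f q) p :=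
    MDifferentiableAt.comp (I' := 𝓘(ℝ, E)) p (mdifferentiableAt_iff_differentiableAt.2
      (differentiableAt_id.const_smul Complex.I)) hf
  exact (hasDerivAt_path hd w).unique h1

lemma dM_neg {f : M → E} {p : M} (hf : MDifferentiableAt 𝓘(ℝ, F) 𝓘(ℝ, E) f p) (w : F) :
    dM F (fun q => -f q) p w = -dM F f p w :=
  (hasDerivAt_path hf.neg w).unique (hasDerivAt_path hf w).neg

lemma dM_congr {G : Type*} [NormedAddCommGroup G] [NormedSpace ℝ G] {f g : M → G} {p : M}
    (h : f =ᶠ[𝓝 p] g) : dM F f p = dM F g p := h.mfderiv_eq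

end LocalFormulas

/-! ### The Levi form and the D'Angelo form in coordinates -/

section SectionFormulas

variable {E : Type*} [NormedAddCommGroup E] [NormedSpace ℂ E]
  {F : Type*} [NormedAddCommGroup F] [NormedSpace ℝ F] [FiniteDimensional ℝ F]
  {M : Type*} [TopologicalSpace M] [ChartedSpace F M] [IsManifold 𝓘(ℝ, F) ∞ M]
  {T10 : CRBundle F M} {η : CForm F M} {k : M → E} {r : E → ℝ} {σ : ℝ} {p : M}

omit [FiniteDimensional ℝ F] in
lemma smoothField_conjField {L : CVectorField F M} (hL : SmoothField L) :
    SmoothField (conjField L) := by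
  constructor
  · simpa only [conjField, rePart_conjC] using hL.1
  · simp only [conjField, imPart_conjC]
    exact hL.2.neg_section

namespace LocalModel

omit [FiniteDimensional ℝ F] in
lemma smooth_re (h : LocalModel T10 η k r σ p) {L : CVectorField F M} (hL : SmoothField L) :
    ContMDiffAt 𝓘(ℝ, F) 𝓘(ℝ, E) ∞ (along k (reF L)) p :=
  contMDiffAt_along h.smooth_map (hL.1 p)

omit [FiniteDimensional ℝ F] in
lemma smooth_im (h : LocalModel T10 η k r σ p) {L : CVectorField F M} (hL : SmoothField L) :
    ContMDiffAt 𝓘(ℝ, F) 𝓘(ℝ, E) ∞ (along k (imF L)) p :=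
  contMDiffAt_along h.smooth_map (hL.2 p)

omit [FiniteDimensional ℝ F] [IsManifold 𝓘(ℝ, F) ∞ M] in
lemma along_im (h : LocalModel T10 η k r σ p) {L : CVectorField F M} (hL : ∀ q, L q ∈ T10 q) :
    ∀ᶠ q in 𝓝 p, along k (imF L) q = -(Complex.I • along k (reF L) q) := by
  filter_upwards [h.mem_iff] with q hq using (hq (L q)).1 (hL q)

omit [FiniteDimensional ℝ F] [IsManifold 𝓘(ℝ, F) ∞ M] in
lemma tangent_re (h : LocalModel T10 η k r σ p) {L : CVectorField F M} (hL : ∀ q, L q ∈ T10 q) :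
    ∀ᶠ q in 𝓝 p, fderiv ℝ r (k q) (along k (reF L) q) = 0 ∧
      fderiv ℝ r (k q) (Complex.I • along k (reF L) q) = 0 := by
  filter_upwards [h.along_im hL, h.eventually] with q h1 h2
  refine ⟨h2.tangent _, ?_⟩
  have := h2.tangent (imF L q)
  have h3 : dM F k q (imF L q) = -(Complex.I • along k (reF L) q) := h1
  rw [h3, map_neg, neg_eq_zero] at this
  exact this

omit [FiniteDimensional ℝ F] in
-- Differentiating ∂r(a) = 0 along M expresses the normal component of the derivative of a by the
-- Hessian of r.
lemma constraints (h : LocalModel T10 η k r σ p) {L : CVectorField F M} (hL : IsSection T10 L)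
    (w : F) :
    hes r (k p) (dM F k p w) (along k (reF L) p)
        + fderiv ℝ r (k p) (dM F (along k (reF L)) p w) = 0 ∧
    hes r (k p) (dM F k p w) (Complex.I • along k (reF L) p)
        + fderiv ℝ r (k p) (Complex.I • dM F (along k (reF L)) p w) = 0 := by
  have hd := (h.smooth_re hL.1).mdifferentiableAt (by simp)
  have hdI : MDifferentiableAt 𝓘(ℝ, F) 𝓘(ℝ, E) (fun q => Complex.I • along k (reF L) q) p :=
    MDifferentiableAt.comp (I' := 𝓘(ℝ, E)) p (mdifferentiableAt_iff_differentiableAt.2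
      (differentiableAt_id.const_smul Complex.I)) hd
  refine ⟨h.constraint hd ((h.tangent_re hL.2).mono fun q hq => hq.1) w, ?_⟩
  have := h.constraint hdI ((h.tangent_re hL.2).mono fun q hq => hq.2) w
  rwa [dM_I_smul hd] at this

lemma re_bracket (h : LocalModel T10 η k r σ p) {Z W : CVectorField F M} (hZ : SmoothField Z)
    (hW : SmoothField W) : dM F k p (reF (bracket Z W) p)
      = dM F (along k (reF W)) p (reF Z p) - dM F (along k (reF Z)) p (reF W p)
        - (dM F (along k (imF W)) p (imF Z p) - dM F (along k (imF Z)) p (imF W p)) := by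
  rw [reF_bracket, map_sub, dM_bracketF (A := reF Z) (B := reF W) h.smooth_map (hZ.1 p) (hW.1 p),
    dM_bracketF (A := imF Z) (B := imF W) h.smooth_map (hZ.2 p) (hW.2 p)]

lemma im_bracket (h : LocalModel T10 η k r σ p) {Z W : CVectorField F M} (hZ : SmoothField Z)
    (hW : SmoothField W) : dM F k p (imF (bracket Z W) p)
      = dM F (along k (imF W)) p (reF Z p) - dM F (along k (reF Z)) p (imF W p)
        + (dM F (along k (reF W)) p (imF Z p) - dM F (along k (imF Z)) p (reF W p)) := by
  rw [imF_bracket, map_add, dM_bracketF (A := reF Z) (B := imF W) h.smooth_map (hZ.1 p) (hW.2 p),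
    dM_bracketF (A := imF Z) (B := reF W) h.smooth_map (hZ.2 p) (hW.1 p)]

omit [FiniteDimensional ℝ F] [IsManifold 𝓘(ℝ, F) ∞ M] in
lemma evalC_eq (h : LocalModel T10 η k r σ p) (Z : CVectorField F M) :
    evalC η p (Z p) = (σ : ℂ) * (-(Complex.I / 2)) *
      (fderiv ℝ r (k p) (Complex.I • dM F k p (reF Z p))
        + Complex.I * fderiv ℝ r (k p) (Complex.I • dM F k p (imF Z p))) := by
  have h1 : evalC η p (Z p) = η p (reF (F := F) Z p)
    + Complex.I * η p (imF (F := F) Z p) := rfl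
  rw [h1, h.form_eq.self_of_nhds, h.form_eq.self_of_nhds]
  ring

omit [FiniteDimensional ℝ F] in
lemma dM_along_im (h : LocalModel T10 η k r σ p) {L : CVectorField F M} (hL : IsSection T10 L)
    (w : F) : dM F (along k (imF L)) p w = -(Complex.I • dM F (along k (reF L)) p w) := by
  have hd := (h.smooth_re hL.1).mdifferentiableAt (by simp)
  have hdI : MDifferentiableAt 𝓘(ℝ, F) 𝓘(ℝ, E) (fun q => Complex.I • along k (reF L) q) p :=
    MDifferentiableAt.comp (I' := 𝓘(ℝ, E)) p (mdifferentiableAt_iff_differentiableAt.2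
      (differentiableAt_id.const_smul Complex.I)) hd
  rw [dM_congr (h.along_im hL.2), dM_neg hdI, dM_I_smul hd]

omit [FiniteDimensional ℝ F] in
lemma dM_along_conj_im (h : LocalModel T10 η k r σ p) {L : CVectorField F M} (hL : IsSection T10 L)
    (w : F) :
    dM F (along k (imF (conjField L))) p w = Complex.I • dM F (along k (reF L)) p w := by
  have hd := (h.smooth_re hL.1).mdifferentiableAt (by simp)
  have : along k (imF (conjField L)) =ᶠ[𝓝 p] fun q => Complex.I • along k (reF L) q := by
    filter_upwards [h.along_im hL.2] with q hq
    have h2 : along k (imF (conjField L)) q = -along k (imF L) q := by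
      rw [along, imF_conjField, map_neg, along]
    rw [h2, hq, neg_neg]
  rw [dM_congr this, dM_I_smul hd]

/-- The images in `E` of the real and imaginary parts of `[L, conj L']`. -/
lemma bracket_conj (h : LocalModel T10 η k r σ p) {L L' : CVectorField F M}
    (hL : IsSection T10 L) (hL' : IsSection T10 L') :
    dM F k p (reF (bracket L (conjField L')) p)
      = dM F (along k (reF L')) p (reF L p) - Complex.I • dM F (along k (reF L')) p (imF L p)
        - (dM F (along k (reF L)) p (reF L' p)
          - Complex.I • dM F (along k (reF L)) p (imF L' p)) ∧
    dM F k p (imF (bracket L (conjField L')) p)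
      = Complex.I • (dM F (along k (reF L')) p (reF L p)
          - Complex.I • dM F (along k (reF L')) p (imF L p)
        + (dM F (along k (reF L)) p (reF L' p)
          - Complex.I • dM F (along k (reF L)) p (imF L' p))) := by
  have hc := smoothField_conjField hL'.1
  constructor
  · rw [h.re_bracket hL.1 hc, reF_conjField, h.dM_along_conj_im hL', imF_conjField, map_neg,
      h.dM_along_im hL]
    abel
  · rw [h.im_bracket hL.1 hc, reF_conjField, h.dM_along_conj_im hL', imF_conjField, map_neg,
      h.dM_along_im hL]
    simp only [smul_add, smul_sub, I_smul_I_smul]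
    abel

omit [FiniteDimensional ℝ F] [IsManifold 𝓘(ℝ, F) ∞ M] in
lemma dM_im_apply (h : LocalModel T10 η k r σ p) {L : CVectorField F M} (hL : ∀ q, L q ∈ T10 q) :
    dM F k p (imF L p) = -(Complex.I • along k (reF L) p) := (h.along_im hL).self_of_nhds

/-- The Levi form of `M` in terms of the Hessian of the defining function. -/
lemma levi_eq (h : LocalModel T10 η k r σ p) {L L' : CVectorField F M}
    (hL : IsSection T10 L) (hL' : IsSection T10 L') :
    levi η L L' p = (σ : ℂ) * (levB (hes r (k p)) (along k (reF L) p) (along k (reF L') p)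
      + Complex.I * levB (hes r (k p)) (along k (reF L) p)
        (Complex.I • along k (reF L') p)) := by
  obtain ⟨b1, b2⟩ := h.bracket_conj hL hL'
  have hsym := hes_symm h.smooth_fun.self_of_nhds
  rw [levi, h.evalC_eq, b1, b2]
  -- The form η sees the bracket only through dr of derivatives of the two fields, and the
  -- constraints replace these by Hessian values.
  obtain ⟨c1, c2⟩ := h.constraints hL' (reF L p)
  obtain ⟨c3, c4⟩ := h.constraints hL' (imF L p)
  obtain ⟨c5, c6⟩ := h.constraints hL (reF L' p)
  obtain ⟨c7, c8⟩ := h.constraints hL (imF L' p)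
  rw [h.dM_im_apply hL.2] at c3 c4
  rw [h.dM_im_apply hL'.2] at c7 c8
  have e1 : dM F k p (reF L p) = along k (reF L) p := rfl
  have e2 : dM F k p (reF L' p) = along k (reF L') p := rfl
  rw [e1] at c1 c2
  rw [e2] at c5 c6
  simp only [levB, smul_add, smul_sub, I_smul_I_smul, map_add, map_sub, map_neg, neg_apply,
    smul_neg, hsym (along k (reF L') p), hsym (Complex.I • along k (reF L') p)] at *
  rw [mul_assoc]
  congr 1
  apply Complex.ext
  · simp
    linarith
  · simp
    linarith

/-- The vector field normal to the hypersurface that corresponds to a transversal field. -/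
def normalField (σ : ℝ) (k : M → E) (T : CVectorField F M) (q : M) : E :=
  Complex.I • (σ • along k (imF T) q)

omit [FiniteDimensional ℝ F] [IsManifold 𝓘(ℝ, F) ∞ M] in
lemma along_transversal (h : LocalModel T10 η k r σ p) (T : CVectorField F M) (q : M) :
    along k (imF T) q = -(Complex.I • (σ • normalField σ k T q)) := by
  rw [normalField, I_smul_real, I_smul_real, I_smul_real, I_smul_I_smul, smul_neg, smul_neg,
      neg_neg,
    smul_smul, h.sign, one_smul]

omit [FiniteDimensional ℝ F] in
lemma transversal_normalized (h : LocalModel T10 η k r σ p) {T : CVectorField F M}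
    (hT : IsTransversal η T) : fderiv ℝ r (k p) (Complex.I • along k (imF T) p) = 2 * σ := by
  have h1 := hT.normalized p
  have h2 : dM F k p (reF T p) = 0 := by
    have : reF T p = 0 := hT.imaginary p
    rw [this, map_zero]
  rw [h.evalC_eq, h2, smul_zero, map_zero] at h1
  have h3 : dM F k p (imF T p) = along k (imF T) p := rfl
  rw [h3] at h1
  have h4 := congrArg Complex.re h1
  simp at h4
  have h5 : σ * fderiv ℝ r (k p) (Complex.I • along k (imF T) p) = 2 := by linarith
  linear_combination σ * h5 - fderiv ℝ r (k p) (Complex.I • along k (imF T) p) * h.sign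

omit [FiniteDimensional ℝ F] in
-- The normalization η(T) = 1 becomes dr(N) = 2, and tangency of T to M becomes dr(iN) = 0. The sign
-- σ is absorbed in the definition of N.
lemma delB_normalField (h : LocalModel T10 η k r σ p) {T : CVectorField F M}
    (hT : IsTransversal η T) : delB (fderiv ℝ r (k p)) (normalField σ k T p) = 2 := by
  rw [delB_eq_two_iff, normalField, I_smul_I_smul, I_smul_real, map_smul,
    h.transversal_normalized hT, map_neg, map_smul, smul_eq_mul]
  refine ⟨by linear_combination 2 * h.sign, ?_⟩
  have : fderiv ℝ r (k p) (along k (imF T) p) = 0 := h.tangent _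
  rw [this, smul_zero, neg_zero]

/-- The D'Angelo form of `M` in terms of the Hessian of the defining function. -/
lemma dAngelo_eq (h : LocalModel T10 η k r σ p) {T L : CVectorField F M}
    (hT : IsTransversal η T) (hL : IsSection T10 L) :
    evalC η p (bracket T L p)
      = dAngelo (hes r (k p)) (normalField σ k T p) (along k (reF L) p) := by
  have hsym := hes_symm h.smooth_fun.self_of_nhds
  have h0 : ∀ q, reF T q = 0 := hT.imaginary
  have hz : along k (reF T) = fun _ => 0 := funext fun q => by rw [along, h0, map_zero]
  have hz' : ∀ w, dM F (along k (reF T)) p w = 0 := fun w => by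
    rw [hz]
    exact (hasDerivAt_path (mdifferentiableAt_const (c := (0 : E))) w).unique (hasDerivAt_const _ _)
  have hd := (h.smooth_im hT.smooth).mdifferentiableAt (by simp)
  have hdI : MDifferentiableAt 𝓘(ℝ, F) 𝓘(ℝ, E) (fun q => Complex.I • along k (imF T) q) p :=
    MDifferentiableAt.comp (I' := 𝓘(ℝ, E)) p (mdifferentiableAt_iff_differentiableAt.2
      (differentiableAt_id.const_smul Complex.I)) hd
  -- The normalization of T is constant along M. Its derivative, with the constraints on L,
  -- eliminates all derivatives of the two fields.
  have hcT := h.constraint hdI (h.eventually.mono fun q hq => hq.transversal_normalized hT)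
  simp only [dM_I_smul hd] at hcT
  obtain ⟨c1, c2⟩ := h.constraints hL (imF T p)
  have c3 := hcT (reF L p)
  have c4 := hcT (imF L p)
  rw [h.dM_im_apply hL.2] at c4
  have e1 : dM F k p (reF L p) = along k (reF L) p := rfl
  have e2 : dM F k p (imF T p) = along k (imF T) p := rfl
  rw [e1] at c3
  rw [e2] at c1 c2
  have hσC : (σ : ℂ) * σ = 1 := by exact_mod_cast h.sign
  have hN : ∀ v, (levB (hes r (k p)) v (normalField σ k T p) : ℝ)
      = σ * levB (hes r (k p)) v (Complex.I • along k (imF T) p) := fun v => by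
    rw [normalField, I_smul_real, levB_smul_right]
  have hN' : ∀ v, (levB (hes r (k p)) v (Complex.I • normalField σ k T p) : ℝ)
      = -(σ * levB (hes r (k p)) v (along k (imF T) p)) := fun v => by
    rw [normalField, I_smul_real, I_smul_real, I_smul_I_smul, levB_smul_right, ← neg_one_smul ℝ,
      levB_smul_right]
    ring
  rw [h.evalC_eq, h.re_bracket hT.smooth hL.1, h.im_bracket hT.smooth hL.1, h0, map_zero, hz',
    hz', map_zero, h.dM_along_im hL, dAngelo, hN, hN']
  simp only [levB, smul_add, smul_sub, I_smul_I_smul, map_add, map_sub, map_neg, neg_apply,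
    smul_neg, hsym (along k (imF T) p), smul_zero, map_zero] at *
  apply Complex.ext
  · simp
    linear_combination (σ / 2) * c2 - (σ / 2) * c3
  · simp
    linear_combination (σ / 2) * c4 - (σ / 2) * c1

end LocalModel

end SectionFormulas

/-! ### The form ∂̄_b ω in coordinates -/

section DbarFormula

variable {E : Type*} [NormedAddCommGroup E] [NormedSpace ℂ E]
  {F : Type*} [NormedAddCommGroup F] [NormedSpace ℝ F] [FiniteDimensional ℝ F]
  {M : Type*} [TopologicalSpace M] [ChartedSpace F M] [IsManifold 𝓘(ℝ, F) ∞ M]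
  {T10 : CRBundle F M} {η : CForm F M} {k : M → E} {r : E → ℝ} {σ : ℝ} {p : M}

/-- Evaluation of `levB` against a vector, for a vector `a` in the kernel of the Levi form. -/
lemma levB_of_null {B : E →L[ℝ] E →L[ℝ] ℝ} {l : E →L[ℝ] ℝ} {a N : E} (hB : ∀ u v, B u v = B v u)
    (hpos : ∀ a, delB l a = 0 → 0 ≤ levB B a a) (ha : delB l a = 0) (haa : levB B a a = 0)
    (hN : delB l N = 2) (v : E) :
    levB B a v = l v / 2 * levB B a N - l (Complex.I • v) / 2 * levB B a (Complex.I • N) := by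
  have h1 : delB l (v - (delB l v / delB l N) • N) = 0 :=
    delB_sub_div_smul (by rw [hN]; exact two_ne_zero) v
  have h2 := levB_eq_zero_of_null hB hpos ha haa h1
  have h3 : v = (v - (delB l v / delB l N) • N) + (delB l v / delB l N) • N := by abel
  have h4 : levB B a v = levB B a ((delB l v / delB l N) • N) := by
    conv_lhs => rw [h3]
    rw [levB_add_right, h2, zero_add]
  rw [h4, levB_complex_smul_right, hN]
  have e1 : (delB l v / 2).re = l v / 2 := by simp [delB]
  have e2 : (delB l v / 2).im = -(l (Complex.I • v)) / 2 := by simp [delB]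
  rw [e1, e2]
  ring

lemma third_symm_left {r : E → ℝ} {y : E} (hr : ContDiffAt ℝ ∞ r y) (u v w : E) :
    third r y u v w = third r y v u w := by
  have h := ((contDiffAt_fderiv hr).isSymmSndFDerivAt (by
    simp only [minSmoothness_of_isRCLikeNormedField]; exact WithTop.coe_le_coe.mpr le_top)).eq u v
  exact congrArg (fun f => f w) h

lemma third_symm_right {r : E → ℝ} {y : E} (hr : ∀ᶠ z in 𝓝 y, ContDiffAt ℝ ∞ r z) (u v w : E) :
    third r y u v w = third r y u w v := by
  have d := hasDerivAt_line (hasStrictFDerivAt_of_smooth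
    (contDiffAt_fderiv (contDiffAt_fderiv hr.self_of_nhds))).hasFDerivAt u
  have d1 := (d.clm_apply (hasDerivAt_const (0 : ℝ) v)).clm_apply (hasDerivAt_const (0 : ℝ) w)
  have d2 := (d.clm_apply (hasDerivAt_const (0 : ℝ) w)).clm_apply (hasDerivAt_const (0 : ℝ) v)
  have hline : Tendsto (fun t : ℝ => y + t • u) (𝓝 0) (𝓝 y) := by
    have : Continuous fun t : ℝ => y + t • u := by fun_prop
    exact this.tendsto' _ _ (by simp)
  have hev : (fun t : ℝ => hes r (y + t • u) v w) =ᶠ[𝓝 0] fun t => hes r (y + t • u) w v := by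
    filter_upwards [hline.eventually hr] with t ht using hes_symm ht v w
  have := d1.unique (d2.congr_of_eventuallyEq hev)
  simpa using this

namespace LocalModel

/-- The formula is stated on a neighbourhood because ∂̄_b differentiates it. -/
lemma dAngelo_form_eq (h : LocalModel T10 η k r σ p) {T L : CVectorField F M}
    {θ : (p : M) → (ℂ ⊗[ℝ] TangentSpace 𝓘(ℝ, F) p) →ₗ[ℂ] ℂ}
    (hT : IsTransversal η T)
    (hθ : ∀ L, IsSection T10 L → ∀ p, θ p (L p) = evalC η p (bracket T L p))
    (hL : IsSection T10 L) : ∀ᶠ q in 𝓝 p, θ q (L q)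
      = dAngelo (hes r (k q)) (normalField σ k T q) (along k (reF L) q) := by
  filter_upwards [h.eventually] with q hq
  rw [hθ L hL, hq.dAngelo_eq hT hL]

omit [FiniteDimensional ℝ F] in
lemma smooth_normalField (h : LocalModel T10 η k r σ p) {T : CVectorField F M}
    (hT : SmoothField T) : ContMDiffAt 𝓘(ℝ, F) 𝓘(ℝ, E) ∞ (normalField σ k T) p := by
  have h1 : ContDiff ℝ ∞ (fun e : E => Complex.I • (σ • e)) :=
    (contDiff_id.const_smul σ).const_smul Complex.I
  exact h1.contMDiff.contMDiffAt.comp p (h.smooth_im hT)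

omit [FiniteDimensional ℝ F] [IsManifold 𝓘(ℝ, F) ∞ M] in
lemma mdifferentiableAt_levB (h : LocalModel T10 η k r σ p) {a b : M → E}
    (ha : ContMDiffAt 𝓘(ℝ, F) 𝓘(ℝ, E) ∞ a p) (hb : ContMDiffAt 𝓘(ℝ, F) 𝓘(ℝ, E) ∞ b p) :
    MDifferentiableAt 𝓘(ℝ, F) 𝓘(ℝ, ℝ) (fun q => levB (hes r (k q)) (a q) (b q)) p := by
  have hB : ContMDiffAt 𝓘(ℝ, F) 𝓘(ℝ, E →L[ℝ] E →L[ℝ] ℝ) ∞ (fun q => hes r (k q)) p :=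
    (contDiffAt_fderiv (contDiffAt_fderiv h.smooth_fun.self_of_nhds)).contMDiffAt.comp p
      h.smooth_map.self_of_nhds
  have hI : ContMDiff 𝓘(ℝ, E) 𝓘(ℝ, E) ∞ (fun e : E => Complex.I • e) :=
    (contDiff_id.const_smul Complex.I).contMDiff
  have h1 := (hB.clm_apply ha).clm_apply hb
  have h2 := (hB.clm_apply (hI.contMDiffAt.comp p ha)).clm_apply (hI.contMDiffAt.comp p hb)
  exact (h1.add h2).mdifferentiableAt (by simp)

omit [FiniteDimensional ℝ F] [IsManifold 𝓘(ℝ, F) ∞ M] in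
/-- The derivative of `q ↦ levB (hes r (k q)) (a q) (b q)`. -/
lemma dM_levB (h : LocalModel T10 η k r σ p) {a b : M → E}
    (ha : ContMDiffAt 𝓘(ℝ, F) 𝓘(ℝ, E) ∞ a p) (hb : ContMDiffAt 𝓘(ℝ, F) 𝓘(ℝ, E) ∞ b p) (w : F) :
    dM F (fun q => levB (hes r (k q)) (a q) (b q)) p w
      = levB (third r (k p) (dM F k p w)) (a p) (b p) + levB (hes r (k p)) (dM F a p w) (b p)
        + levB (hes r (k p)) (a p) (dM F b p w) := by
  have h1 := h.hasDerivAt_jet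
    (contDiffAt_fderiv (contDiffAt_fderiv h.smooth_fun.self_of_nhds)) w
  have h2 := hasDerivAt_levB h1 (hasDerivAt_path (ha.mdifferentiableAt (by simp)) w)
    (hasDerivAt_path (hb.mdifferentiableAt (by simp)) w)
  have h3 := hasDerivAt_path (h.mdifferentiableAt_levB ha hb) w
  have := h3.unique h2
  simpa [path_zero] using this

omit [FiniteDimensional ℝ F] [IsManifold 𝓘(ℝ, F) ∞ M] in
/-- The derivative of `q ↦ dAngelo (hes r (k q)) (N q) (a q)`. -/
lemma dM_dAngelo (h : LocalModel T10 η k r σ p) {a N : M → E}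
    (ha : ContMDiffAt 𝓘(ℝ, F) 𝓘(ℝ, E) ∞ a p) (hN : ContMDiffAt 𝓘(ℝ, F) 𝓘(ℝ, E) ∞ N p) (w : F) :
    dM F (fun q => dAngelo (hes r (k q)) (N q) (a q)) p w
      = 1 / 2 * ((dM F (fun q => levB (hes r (k q)) (a q) (N q)) p w : ℝ)
        + Complex.I * (dM F (fun q => levB (hes r (k q)) (a q) (Complex.I • N q)) p w : ℝ)) := by
  have hI : ContMDiff 𝓘(ℝ, E) 𝓘(ℝ, E) ∞ (fun e : E => Complex.I • e) :=
    (contDiff_id.const_smul Complex.I).contMDiff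
  have m1 := h.mdifferentiableAt_levB ha hN
  have m2 := h.mdifferentiableAt_levB ha (hI.contMDiffAt.comp p hN)
  have h1 := (hasDerivAt_path m1 w).ofReal_comp
  have h2 := (hasDerivAt_path m2 w).ofReal_comp
  have h3 := (h1.add (h2.const_mul Complex.I)).const_mul (1 / 2 : ℂ)
  have c : ∀ {f g : M → ℝ}, MDifferentiableAt 𝓘(ℝ, F) 𝓘(ℝ, ℝ) f p →
      MDifferentiableAt 𝓘(ℝ, F) 𝓘(ℝ, ℝ) g p → MDifferentiableAt 𝓘(ℝ, F) 𝓘(ℝ, ℂ)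
      (fun q => 1 / 2 * ((f q : ℂ) + Complex.I * (g q : ℂ))) p := fun {f g} hf hg => by
    have hl : ContDiff ℝ ∞ (fun x : ℝ × ℝ => (1 / 2 : ℂ) * ((x.1 : ℂ) + Complex.I * (x.2 : ℂ))) :=
      contDiff_const.mul (((Complex.ofRealCLM.contDiff).comp contDiff_fst).add
        (contDiff_const.mul ((Complex.ofRealCLM.contDiff).comp contDiff_snd)))
    exact MDifferentiableAt.comp (I' := 𝓘(ℝ, ℝ × ℝ)) (f := fun q => (f q, g q)) p
      (hl.contMDiff.contMDiffAt.mdifferentiableAt (by simp)) (hf.prodMk_space hg)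
  exact (hasDerivAt_path (c m1 m2) w).unique h3

omit [FiniteDimensional ℝ F] [IsManifold 𝓘(ℝ, F) ∞ M] in
lemma exists_complexified (p : M) (v w : F) : ∃ S : ℂ ⊗[ℝ] TangentSpace 𝓘(ℝ, F) p,
    (rePart S : F) = v ∧ (imPart S : F) = w :=
  ⟨mkC (V := TangentSpace 𝓘(ℝ, F) p) v w, rePart_mkC _ _, imPart_mkC _ _⟩

/-- `[L, conj L]` is minus twice the imaginary part of a vector of `T^{1,0}`, at null vectors. -/
lemma exists_bracket_self (h : LocalModel T10 η k r σ p) {L : CVectorField F M}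
    (hL : IsSection T10 L) (hnull : IsNull r (k p) (along k (reF L) p)) :
    ∃ S ∈ T10 p, bracket L (conjField L) p = conjC S - S ∧
      dM F k p (rePart S) = dM F (along k (reF L)) p (reF L p)
        - Complex.I • dM F (along k (reF L)) p (imF L p) := by
  obtain ⟨b1, b2⟩ := h.bracket_conj hL hL
  rw [sub_self] at b1
  set s := dM F (along k (reF L)) p (reF L p)
    - Complex.I • dM F (along k (reF L)) p (imF L p) with hs
  have hinj := h.injective.self_of_nhds
  obtain ⟨c1, c2⟩ := h.constraints hL (reF L p)
  obtain ⟨c3, c4⟩ := h.constraints hL (imF L p)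
  rw [h.dM_im_apply hL.2] at c3 c4
  have e1 : dM F k p (reF L p) = along k (reF L) p := rfl
  rw [e1] at c1 c2
  have hl := hnull.null
  simp only [levB] at hl
  -- The value is minus the Levi form at (a,a). Nullity thus makes s tangent to M and puts the
  -- bracket into T^{1,0} ⊕ T^{0,1}.
  have hls : fderiv ℝ r (k p) s = 0 := by
    rw [hs, map_sub]
    simp only [map_neg, neg_apply] at c4
    linarith
  obtain ⟨v, hv⟩ := h.range.self_of_nhds s hls
  have hre : reF (bracket L (conjField L)) p = 0 := hinj (by rw [b1, map_zero])
  set w := imF (bracket L (conjField L)) p with hw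
  obtain ⟨S, hS1, hS2⟩ := exists_complexified p v (-((1 / 2 : ℝ) • w))
  refine ⟨S, ?_, ?_, ?_⟩
  · rw [h.mem_iff.self_of_nhds]
    have : dM F k p (-((1 / 2 : ℝ) • w)) = -(Complex.I • dM F k p v) := by
      rw [map_neg, map_smul, b2, hv, ← two_smul ℝ s, I_smul_real, smul_smul]
      norm_num
    rw [← hS1, ← hS2] at this
    exact this
  · refine complexified_ext ?_ ?_
    · rw [map_sub, rePart_conjC, sub_self]
      exact hre
    · rw [map_sub, imPart_conjC]
      have e : ∀ x : F, x = -((1 / 2 : ℝ) • w) → w = -x - x := by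
        rintro _ rfl
        rw [neg_neg, sub_neg_eq_add, ← add_smul]; norm_num
      exact e _ hS2
  · rw [← hv, ← hS1]

/-- The form `∂̄_b ω` of `M` at null vectors, in terms of the defining function. -/
lemma dbarForm_eq (h : LocalModel T10 η k r σ p) (hlev : LeviNear r (k p)) {T L : CVectorField F M}
    {θ : (p : M) → (ℂ ⊗[ℝ] TangentSpace 𝓘(ℝ, F) p) →ₗ[ℂ] ℂ}
    (hT : IsTransversal η T)
    (hθ : ∀ L, IsSection T10 L → ∀ p, θ p (L p) = evalC η p (bracket T L p))
    (hθ' : ∀ p, ∀ Z ∈ T10 p, θ p (conjC Z) = 0)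
    (hext : ∀ Z ∈ T10 p, ∃ L, IsSection T10 L ∧ L p = Z)
    (hL : IsSection T10 L) (hnull : IsNull r (k p) (along k (reF L) p)) :
    (dbarForm θ L L p).re
      = dbarD r (k p) (normalField σ k T p) (along k (reF L) p) := by
  have hsm := h.smooth_fun
  have hsym := hes_symm hsm.self_of_nhds
  obtain ⟨S, hS, hbr, hSs⟩ := h.exists_bracket_self hL hnull
  -- The values of θ on T^{1,0} are prescribed only along sections, so the single vector S must be
  -- extended to one.
  obtain ⟨L', hL', hL'S⟩ := hext S hS
  have hθS : θ p S = dAngelo (hes r (k p)) (normalField σ k T p)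
      (dM F (along k (reF L)) p (reF L p)
        - Complex.I • dM F (along k (reF L)) p (imF L p)) := by
    rw [← hL'S, hθ L' hL', h.dAngelo_eq hT hL', ← hSs, ← hL'S]
    rfl
  have ha := h.smooth_re hL.1
  have hN := h.smooth_normalField hT.smooth
  have hI : ContMDiff 𝓘(ℝ, E) 𝓘(ℝ, E) ∞ (fun e : E => Complex.I • e) :=
    (contDiff_id.const_smul Complex.I).contMDiff
  have hIN : ContMDiffAt 𝓘(ℝ, F) 𝓘(ℝ, E) ∞ (fun q => Complex.I • normalField σ k T q) p :=
    hI.contMDiffAt.comp p hN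
  have hdN := hN.mdifferentiableAt (show (∞ : WithTop ℕ∞) ≠ 0 by simp)
  have hdIN := hIN.mdifferentiableAt (show (∞ : WithTop ℕ∞) ≠ 0 by simp)
  have hform : dbarForm θ L L p = -(dM F (fun q => θ q (L q)) p (reF L p)
      + Complex.I * dM F (fun q => θ q (L q)) p (-imF L p)) - θ p (conjC S - S) := by
    rw [← hbr]
    have e1 : reF (conjField L) p = reF L p := by rw [reF_conjField]
    rw [← imF_conjField, ← e1]
    rfl
  have hdel : ∀ w, hes r (k p) (dM F k p w) (normalField σ k T p)
      + fderiv ℝ r (k p) (dM F (normalField σ k T) p w) = 0 := fun w =>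
    h.constraint hdN (c := 2)
      (h.eventually.mono fun q hq => (delB_eq_two_iff.1 (hq.delB_normalField hT)).1) w
  have hdel' : ∀ w, hes r (k p) (dM F k p w) (Complex.I • normalField σ k T p)
      + fderiv ℝ r (k p) (Complex.I • dM F (normalField σ k T) p w) = 0 := fun w => by
    have := h.constraint hdIN (c := 0)
      (h.eventually.mono fun q hq => (delB_eq_two_iff.1 (hq.delB_normalField hT)).2) w
    rwa [dM_I_smul hdN] at this
  have hN2 := h.delB_normalField hT
  -- Against a null vector the Levi form detects only the normal component of the other argument.
  -- The derivatives of N thus enter only through dr, where differentiating dr(N) = 2 and dr(iN) = 0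
  -- determines them.
  have key := levB_of_null hsym (hlev.self hnull.zero) hnull.tangent hnull.null hN2
  have hA := hdel (reF L p)
  have hA' := hdel' (reF L p)
  have hB := hdel (-imF L p)
  have hB' := hdel' (-imF L p)
  have e1 : dM F k p (reF L p) = along k (reF L) p := rfl
  have e2 : dM F k p (-imF L p) = Complex.I • along k (reF L) p := by
    rw [map_neg, h.dM_im_apply hL.2, neg_neg]
  rw [e1] at hA hA'
  rw [e2] at hB hB'
  have hre : ∀ w, (dM F (fun q => θ q (L q)) p w).re
      = 1 / 2 * dM F (fun q => levB (hes r (k q)) (along k (reF L) q) (normalField σ k T q)) p w ∧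
      (dM F (fun q => θ q (L q)) p w).im
      = 1 / 2 * dM F (fun q => levB (hes r (k q)) (along k (reF L) q)
        (Complex.I • normalField σ k T q)) p w := fun w => by
    rw [dM_congr (h.dAngelo_form_eq hT hθ hL), h.dM_dAngelo ha hN]
    constructor <;> simp
  have hθ0 : θ p (conjC S) = 0 := hθ' p S hS
  have htot : (dbarForm θ L L p).re = -(dM F (fun q => θ q (L q)) p (reF L p)).re
      + (dM F (fun q => θ q (L q)) p (-imF L p)).im + (θ p S).re := by
    rw [hform, map_sub, hθ0]
    simp [-map_neg]
    ring
  have hθre : (θ p S).re = 1 / 2 * levB (hes r (k p)) (dM F (along k (reF L)) p (reF L p)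
        - Complex.I • dM F (along k (reF L)) p (imF L p)) (normalField σ k T p) := by
    rw [hθS, dAngelo]
    simp
  rw [htot, (hre _).1, (hre _).2, hθre, h.dM_levB ha hN, h.dM_levB ha hIN, e1, e2, dM_I_smul hdN,
    key (dM F (normalField σ k T) p (reF L p)),
    key (Complex.I • dM F (normalField σ k T) p (-imF L p)), I_smul_I_smul,
        (fderiv ℝ r (k p)).map_neg, dbarD,
    leviDrop, dAngeloSq]
  set N := normalField σ k T p
  set a := along k (reF L) p
  -- By symmetry of the third derivative the two mixed entries cancel and the remaining ones form
  -- the derivative of the Levi form in the direction N.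
  have t1 : levB (third r (k p) a) a N - levB (third r (k p) (Complex.I • a)) a (Complex.I • N)
      = levB (third r (k p) N) a a := by
    simp only [levB, I_smul_I_smul, map_neg]
    rw [third_symm_right hsm a a N, third_symm_left hsm.self_of_nhds a N a,
      third_symm_right hsm a (Complex.I • a) (Complex.I • N),
      third_symm_left hsm.self_of_nhds a (Complex.I • N) (Complex.I • a),
      third_symm_right hsm (Complex.I • N) a (Complex.I • a),
      third_symm_right hsm (Complex.I • a) a (Complex.I • N),
      third_symm_left hsm.self_of_nhds (Complex.I • a) (Complex.I • N) a,
      third_symm_right hsm (Complex.I • a) (Complex.I • a) N,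
      third_symm_left hsm.self_of_nhds (Complex.I • a) N (Complex.I • a)]
    ring
  have t2 : levB (hes r (k p)) (dM F (along k (reF L)) p (reF L p)
        - Complex.I • dM F (along k (reF L)) p (imF L p)) N
      = levB (hes r (k p)) (dM F (along k (reF L)) p (reF L p)) N
        + levB (hes r (k p)) (dM F (along k (reF L)) p (imF L p)) (Complex.I • N) := by
    rw [sub_eq_add_neg, levB_add_apply, ← neg_one_smul ℝ, levB_smul_apply, levB_I_left]
    ring
  have t3 : levB (hes r (k p)) (dM F (along k (reF L)) p (-imF L p)) (Complex.I • N)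
      = -levB (hes r (k p)) (dM F (along k (reF L)) p (imF L p)) (Complex.I • N) := by
    rw [map_neg, ← neg_one_smul ℝ, levB_smul_apply]
    ring
  have p1 : levB (hes r (k p)) a N = hes r (k p) a N + hes r (k p) (Complex.I • a)
      (Complex.I • N) :=
    rfl
  have p2 : levB (hes r (k p)) a (Complex.I • N)
      = hes r (k p) a (Complex.I • N) - hes r (k p) (Complex.I • a) N := by
    rw [levB, I_smul_I_smul, map_neg]; ring
  rw [t2, t3, hsym N a, hsym N (Complex.I • a), ← t1]
  rw [eq_neg_of_add_eq_zero_right hA, eq_neg_of_add_eq_zero_right hA',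
    eq_neg_of_add_eq_zero_right hB, eq_neg_of_add_eq_zero_right hB', p1, p2]
  ring

end LocalModel

end DbarFormula

/-! ### Smooth left inverses of immersions -/

section LeftInverse

variable {F : Type*} [NormedAddCommGroup F] [NormedSpace ℝ F]
  {M : Type*} [TopologicalSpace M] [ChartedSpace F M]
  {G : Type*} [NormedAddCommGroup G] [NormedSpace ℝ G]

/-- An immersion has local smooth left inverses. -/
lemma exists_local_left_inverse {X : Type*} [TopologicalSpace X] [ChartedSpace G X]
    {ι : M → X} {p : M}
    (h : Manifold.IsImmersionAt 𝓘(ℝ, F) 𝓘(ℝ, G) ∞ ι p) :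
    ∃ Λ : X → M, (∀ᶠ x in 𝓝 (ι p), ContMDiffAt 𝓘(ℝ, G) 𝓘(ℝ, F) ∞ Λ x) ∧
      ∀ᶠ q in 𝓝 p, Λ (ι q) = q := by
  have hval : ∀ q ∈ h.domChart.source, h.codChart (ι q) = h.equiv (h.domChart q, 0) := by
    intro q hq
    have h0 : h.domChart q ∈ (h.domChart.extend 𝓘(ℝ, F)).target := by
      simpa using h.domChart.map_source hq
    have h1 := h.writtenInCharts h0
    simpa [h.domChart.left_inv hq] using h1
  refine ⟨fun x => h.domChart.symm (h.equiv.symm (h.codChart x)).1, ?_, ?_⟩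
  · have hcont : ContinuousOn (fun x => (h.equiv.symm (h.codChart x)).1) h.codChart.source :=
      (continuous_fst.comp h.equiv.symm.continuous).comp_continuousOn h.codChart.continuousOn
    have hopen := hcont.isOpen_inter_preimage h.codChart.open_source h.domChart.open_target
    have hmem : ι p ∈ h.codChart.source ∩
        (fun x => (h.equiv.symm (h.codChart x)).1) ⁻¹' h.domChart.target := by
      refine ⟨h.mem_codChart_source, ?_⟩
      simp only [Set.mem_preimage]
      rw [hval p h.mem_domChart_source, ContinuousLinearEquiv.symm_apply_apply]
      exact h.domChart.map_source h.mem_domChart_source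
    filter_upwards [hopen.mem_nhds hmem] with x hx
    have h1 := (contMDiffOn_of_mem_maximalAtlas h.codChart_mem_maximalAtlas).contMDiffAt
      (h.codChart.open_source.mem_nhds hx.1)
    have h2 := (contMDiffOn_symm_of_mem_maximalAtlas h.domChart_mem_maximalAtlas).contMDiffAt
      (h.domChart.open_target.mem_nhds hx.2)
    obtain ⟨g, hg⟩ : ∃ g : G → F, g = fun y => (h.equiv.symm y).1 := ⟨_, rfl⟩
    have h3 : ContMDiffAt 𝓘(ℝ, G) 𝓘(ℝ, F) ∞ g (h.codChart x) := by
      rw [contMDiffAt_iff_contDiffAt, hg]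
      exact (contDiff_fst.comp h.equiv.symm.contDiff).contDiffAt
    have h4 := ContMDiffAt.comp (I' := 𝓘(ℝ, G)) x h3 h1
    have h5 : ContMDiffAt 𝓘(ℝ, F) 𝓘(ℝ, F) ∞ h.domChart.symm ((g ∘ h.codChart) x) := by
      rw [hg]; exact h2
    subst hg
    exact ContMDiffAt.comp (I' := 𝓘(ℝ, F)) x h5 h4
  · filter_upwards [h.domChart.open_source.mem_nhds h.mem_domChart_source] with q hq
    simp only [hval q hq, ContinuousLinearEquiv.symm_apply_apply, h.domChart.left_inv hq]

lemma contMDiffAt_tangent_modelSpace {k a : M → G} {p : M}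
    (hk : ContMDiffAt 𝓘(ℝ, F) 𝓘(ℝ, G) ∞ k p) (ha : ContMDiffAt 𝓘(ℝ, F) 𝓘(ℝ, G) ∞ a p) :
    ContMDiffAt 𝓘(ℝ, F) 𝓘(ℝ, G).tangent ∞
      (fun q => (⟨k q, a q⟩ : TangentBundle 𝓘(ℝ, G) G)) p := by
  rw [Bundle.contMDiffAt_totalSpace]
  refine ⟨hk, ?_⟩
  convert! ha with q
  simp

variable (F) in
/-- The derivative of a map between manifolds, as a linear map of the model spaces. -/
def dMap {X : Type*} [TopologicalSpace X] [ChartedSpace G X] (Λ : X → M) (x : X) : G →L[ℝ] F :=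
  mfderiv 𝓘(ℝ, G) 𝓘(ℝ, F) Λ x

lemma dMap_dM {k : M → G} {Λ : G → M} {p : M}
    (hΛ : ∀ᶠ y in 𝓝 (k p), ContMDiffAt 𝓘(ℝ, G) 𝓘(ℝ, F) ∞ Λ y) (hinv : ∀ᶠ q in 𝓝 p, Λ (k q) = q)
    (hk : ∀ᶠ q in 𝓝 p, ContMDiffAt 𝓘(ℝ, F) 𝓘(ℝ, G) ∞ k q) :
    ∀ᶠ q in 𝓝 p, ∀ v : F, dMap F Λ (k q) (dM F k q v) = v := by
  filter_upwards [hk, hinv.eventually_nhds,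
    hk.self_of_nhds.continuousAt.eventually hΛ] with q h1 h2 h3 v
  have h4 : (Λ ∘ k) =ᶠ[𝓝 q] id := h2
  have h5 := mfderiv_comp (I := 𝓘(ℝ, F)) (I' := 𝓘(ℝ, G)) (I'' := 𝓘(ℝ, F)) q
    (h3.mdifferentiableAt (by simp)) (h1.mdifferentiableAt (by simp))
  have h6 : mfderiv 𝓘(ℝ, F) 𝓘(ℝ, F) (Λ ∘ k) q = ContinuousLinearMap.id ℝ F := by
    rw [h4.mfderiv_eq, mfderiv_id]; rfl
  have h7 := h5.symm.trans h6
  exact congrArg (fun D : F →L[ℝ] F => D v) h7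

variable [IsManifold 𝓘(ℝ, F) ∞ M]

/-- Since A is the image of dk(A) under dΛ, its smoothness can be tested on dk(A), a map into a
vector space. -/
lemma contMDiffAt_lift {k : M → G} {Λ : G → M} {p : M}
    (hΛ : ∀ᶠ y in 𝓝 (k p), ContMDiffAt 𝓘(ℝ, G) 𝓘(ℝ, F) ∞ Λ y) (hinv : ∀ᶠ q in 𝓝 p, Λ (k q) = q)
    (hk : ∀ᶠ q in 𝓝 p, ContMDiffAt 𝓘(ℝ, F) 𝓘(ℝ, G) ∞ k q) {A : M → F}
    (ha : ContMDiffAt 𝓘(ℝ, F) 𝓘(ℝ, G) ∞ (along k A) p) :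
    ContMDiffAt 𝓘(ℝ, F) 𝓘(ℝ, F).tangent ∞ (fun q => (⟨q, A q⟩ : TangentBundle 𝓘(ℝ, F) M)) p := by
  obtain ⟨a, ha'⟩ : ∃ a : M → G, a = along k A := ⟨_, rfl⟩
  rw [← ha'] at ha
  obtain ⟨U, hU, hUo, hpU⟩ := eventually_nhds_iff.1 hΛ
  have h1 : ContMDiffOn 𝓘(ℝ, G) 𝓘(ℝ, F) ∞ Λ U := fun q hq => (hU q hq).contMDiffWithinAt
  have h2 := h1.contMDiffOn_tangentMapWithin (m := ∞) (by simp) hUo.uniqueMDiffOn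
  have hkc := hk.self_of_nhds.continuousAt
  have h3 : ContMDiffWithinAt 𝓘(ℝ, F) 𝓘(ℝ, F).tangent ∞
      (fun q => tangentMapWithin 𝓘(ℝ, G) 𝓘(ℝ, F) Λ U ⟨k q, a q⟩) (k ⁻¹' U) p :=
    (h2 ⟨k p, a p⟩ hpU).comp p
      (contMDiffAt_tangent_modelSpace hk.self_of_nhds ha).contMDiffWithinAt (fun q hq => hq)
  refine (h3.contMDiffAt (hkc.preimage_mem_nhds (hUo.mem_nhds hpU))).congr_of_eventuallyEq ?_
  have key : ∀ (q q' : M) (v v' : F), q' = q → v' = v →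
      (⟨q, v⟩ : TangentBundle 𝓘(ℝ, F) M) = ⟨q', v'⟩ := by
    rintro _ _ _ _ rfl rfl; rfl
  filter_upwards [hkc.preimage_mem_nhds (hUo.mem_nhds hpU), hinv, dMap_dM hΛ hinv hk] with q h4 h5
      h6
  refine key _ _ _ _ h5 ?_
  rw [mfderivWithin_of_isOpen hUo h4, ha']
  exact h6 (A q)

end LeftInverse

/-! ### Local models coming from a defining function -/

section Hypersurface

variable {E : Type*} [NormedAddCommGroup E] [NormedSpace ℂ E]
  {X : Type*} [TopologicalSpace X] [ChartedSpace E X]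
  {F : Type*} [NormedAddCommGroup F] [NormedSpace ℝ F]
  {M : Type*} [TopologicalSpace M] [ChartedSpace F M]

/-- The map `ι` in the preferred chart at `x₀`. -/
def chartMap (x₀ : X) (ι : M → X) : M → E := chartAt E x₀ ∘ ι

variable (E) in
/-- The derivative of the preferred chart, as a linear map of the model space. -/
def chartD (x₀ x : X) : E →L[ℝ] E := chartDeriv x₀ x

variable (E) in
/-- The complex structure of `X` at `x`, as a linear map of the model space. -/
def complexJ (x : X) : E →L[ℝ] E := complexStructure x

lemma chartD_complexJ [IsManifold 𝓘(ℂ, E) ω X] {x₀ x : X} (hx : x ∈ (chartAt E x₀).source) (v : E) :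
    chartD E x₀ x (complexJ E x v) = Complex.I • chartD E x₀ x v :=
  chartDeriv_complexStructure hx v

lemma dM_chartMap [IsManifold 𝓘(ℂ, E) ω X] {x₀ : X} {ι : M → X} {q : M}
    (hq : ι q ∈ (chartAt E x₀).source) (hι : MDifferentiableAt 𝓘(ℝ, F) 𝓘(ℝ, E) ι q) (v : F) :
    dM F (chartMap (E := E) x₀ ι) q v = chartD E x₀ (ι q) (dMap E ι q v) := by
  have := isManifold_real E X
  have hc : MDifferentiableAt 𝓘(ℝ, E) 𝓘(ℝ, E) (chartAt E x₀) (ι q) :=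
    mdifferentiableAt_atlas (chart_mem_atlas E x₀) hq
  have h : dM F (chartMap (E := E) x₀ ι) q = (chartD E x₀ (ι q)).comp (dMap E ι q : F →L[ℝ] E) :=
    mfderiv_comp q hc hι
  rw [h]
  rfl

omit [ChartedSpace E X] in
lemma holomorphic_condition_iff {c J : E →L[ℝ] E} (hc : Function.Injective c)
    (hJ : ∀ v, c (J v) = Complex.I • c v) (a b : E) :
    (J a = -b ∧ J b = a) ↔ c b = -(Complex.I • c a) := by
  rw [← hc.eq_iff, ← hc.eq_iff (a := J b), hJ, hJ, map_neg]
  constructor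
  · rintro ⟨h1, -⟩
    rw [h1, neg_neg]
  · intro h
    rw [h, neg_neg, smul_neg, I_smul_I_smul, neg_neg]
    exact ⟨rfl, rfl⟩

lemma mem_inducedCR_iff [IsManifold 𝓘(ℂ, E) ω X] {x₀ : X} {ι : M → X} {q : M}
    (hq : ι q ∈ (chartAt E x₀).source) (hι : MDifferentiableAt 𝓘(ℝ, F) 𝓘(ℝ, E) ι q)
    (Z : ℂ ⊗[ℝ] TangentSpace 𝓘(ℝ, F) q) : Z ∈ inducedCR E ι q ↔
      dM F (chartMap (E := E) x₀ ι) q (imPart Z)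
        = -(Complex.I • dM F (chartMap (E := E) x₀ ι) q (rePart Z)) := by
  obtain ⟨D, hD⟩ : ∃ D : F →L[ℝ] E, D = dMap E ι q := ⟨_, rfl⟩
  have hk : ∀ v, dM F (chartMap (E := E) x₀ ι) q v = chartD E x₀ (ι q) (D v) := by
    rw [hD]; exact dM_chartMap hq hι
  have hcJ := holomorphic_condition_iff (c := chartD E x₀ (ι q)) (chartDeriv_bijective hq).1
    (chartD_complexJ hq)
  have h1 : Z ∈ inducedCR E ι q ↔ complexJ E (ι q) (D (rePart Z)) = -(D (imPart Z))
      ∧ complexJ E (ι q) (D (imPart Z)) = D (rePart Z) := by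
    subst hD
    rw [inducedCR, Submodule.mem_comap, holTangent]
    refine mem_eigenspace_baseChange_I.trans ?_
    rw [rePart_baseChange, imPart_baseChange]
    exact Iff.rfl
  refine h1.trans ((hcJ _ _).trans ?_)
  rw [← hk, ← hk]

lemma dM_eq_inChart [IsManifold 𝓘(ℂ, E) ω X] {u : X → ℝ} {x₀ x : X}
    (hx : x ∈ (chartAt E x₀).source) (hu : MDifferentiableAt 𝓘(ℝ, E) 𝓘(ℝ, ℝ) u x) (v : E) :
    dM E u x v = fderiv ℝ (inChart x₀ u) (chartAt E x₀ x) (chartD E x₀ x v) :=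
  mfderiv_eq_inChart hx hu v

lemma hypersurfaceForm_apply [IsManifold 𝓘(ℂ, E) ω X] {x₀ : X} {ι : M → X} {ρ : X → ℝ} {q : M}
    (hq : ι q ∈ (chartAt E x₀).source) (hι : MDifferentiableAt 𝓘(ℝ, F) 𝓘(ℝ, E) ι q)
    (hρ : MDifferentiableAt 𝓘(ℝ, E) 𝓘(ℝ, ℝ) ρ (ι q)) (v : F) :
    hypersurfaceForm (E := E) ι ρ q v = -(Complex.I / 2) *
      (fderiv ℝ (inChart x₀ ρ) (chartMap (E := E) x₀ ι q)
        (Complex.I • dM F (chartMap (E := E) x₀ ι) q v) : ℂ) := by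
  have h1 : hypersurfaceForm (E := E) ι ρ q v = -(Complex.I / 2) *
    ((dM E ρ (ι q) (complexJ E (ι q) (dMap E ι q v)) : ℝ) : ℂ) := rfl
  rw [h1, dM_eq_inChart hq hρ, dM_chartMap hq hι, ← chartD_complexJ hq]
  rfl

lemma localModel_hypersurface [FiniteDimensional ℂ E] [FiniteDimensional ℝ F]
    [IsManifold 𝓘(ℂ, E) ω X] (hdim : Module.finrank ℝ F + 1 = 2 * Module.finrank ℂ E)
    {ι : M → X} {ρ : X → ℝ} {η : CForm F M} {σ : ℝ} {p : M} {x₀ : X}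
    (hp : ι p ∈ (chartAt E x₀).source)
    (hι : Manifold.IsImmersion 𝓘(ℝ, F) 𝓘(ℝ, E) ∞ ι)
    (hρ : ContMDiff 𝓘(ℝ, E) 𝓘(ℝ, ℝ) ∞ ρ)
    (hzero : ∀ q, ρ (ι q) = 0) (hne : ∀ q, mfderiv 𝓘(ℝ, E) 𝓘(ℝ, ℝ) ρ (ι q) ≠ 0)
    (hη : ∀ᶠ q in 𝓝 p, ∀ v : F, η q v = (σ : ℂ) * hypersurfaceForm (E := E) ι ρ q v)
    (hσ : σ * σ = 1) :
    LocalModel (inducedCR E ι) η (chartMap (E := E) x₀ ι) (inChart x₀ ρ) σ p := by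
  have := isManifold_real E X
  have hιs : ContMDiff 𝓘(ℝ, F) 𝓘(ℝ, E) ∞ ι := hι.contMDiff
  have hsrc : ∀ᶠ q in 𝓝 p, ι q ∈ (chartAt E x₀).source :=
    hιs.continuous.continuousAt.eventually ((chartAt E x₀).open_source.mem_nhds hp)
  have hks : ∀ᶠ q in 𝓝 p, ContMDiffAt 𝓘(ℝ, F) 𝓘(ℝ, E) ∞ (chartMap (E := E) x₀ ι) q := by
    filter_upwards [hsrc] with q hq
    exact ((contMDiffOn_chart (I := 𝓘(ℝ, E)) (x := x₀)).contMDiffAt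
      ((chartAt E x₀).open_source.mem_nhds hq)).comp q hιs.contMDiffAt
  obtain ⟨Λ, hΛ, hΛinv⟩ := exists_local_left_inverse (hι.isImmersionAt p)
  have hsymm : ∀ q, ι q ∈ (chartAt E x₀).source →
      (chartAt E x₀).symm (chartMap (E := E) x₀ ι q) = ι q :=
    fun q hq => (chartAt E x₀).left_inv hq
  have hk0 : chartMap (E := E) x₀ ι p ∈ (chartAt E x₀).target := (chartAt E x₀).map_source hp
  have hsm : ∀ᶠ y in 𝓝 (chartMap (E := E) x₀ ι p), ContDiffAt ℝ ∞ (inChart x₀ ρ) y :=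
    eventually_contDiffAt_inChart hp (Eventually.of_forall fun x => hρ x)
  have hΛk : ∀ᶠ y in 𝓝 (chartMap (E := E) x₀ ι p),
      ContMDiffAt 𝓘(ℝ, E) 𝓘(ℝ, F) ∞ (Λ ∘ (chartAt E x₀).symm) y := by
    have hc := (chartAt E x₀).continuousAt_symm hk0
    rw [ContinuousAt, hsymm p hp] at hc
    filter_upwards [hc.eventually hΛ, (chartAt E x₀).open_target.mem_nhds hk0] with y h1 h2
    exact ContMDiffAt.comp (I' := 𝓘(ℝ, E)) y h1
      ((contMDiffOn_chart_symm (I := 𝓘(ℝ, E)) (x := x₀)).contMDiffAt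
        ((chartAt E x₀).open_target.mem_nhds h2))
  have hΛkinv : ∀ᶠ q in 𝓝 p, (Λ ∘ (chartAt E x₀).symm) (chartMap (E := E) x₀ ι q) = q := by
    filter_upwards [hΛinv, hsrc] with q h1 h2
    rw [Function.comp, hsymm q h2, h1]
  have hinj : ∀ᶠ q in 𝓝 p, Function.Injective (dM F (chartMap (E := E) x₀ ι) q) := by
    filter_upwards [dMap_dM hΛk hΛkinv hks] with q h1
    exact Function.LeftInverse.injective h1
  have hz : ∀ᶠ q in 𝓝 p, inChart x₀ ρ (chartMap (E := E) x₀ ι q) = 0 := by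
    filter_upwards [hsrc] with q hq
    rw [inChart, Function.comp, hsymm q hq, hzero]
  have hsm_ev : ∀ᶠ q in 𝓝 p, ContDiffAt ℝ ∞ (inChart x₀ ρ) (chartMap (E := E) x₀ ι q) :=
    hks.self_of_nhds.continuousAt.eventually hsm
  have hreg : ∀ q, ι q ∈ (chartAt E x₀).source →
      fderiv ℝ (inChart x₀ ρ) (chartMap (E := E) x₀ ι q) ≠ 0 := by
    intro q hq h0
    refine hne q ?_
    have : dM E ρ (ι q) = 0 := by
      ext v
      rw [dM_eq_inChart hq (hρ.mdifferentiable (by simp) _)]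
      change fderiv ℝ (inChart x₀ ρ) (chartMap (E := E) x₀ ι q) _ = 0
      rw [h0]; rfl
    exact this
  refine ⟨hks, hsm, hz, ⟨_, hΛk, hΛkinv⟩, hinj, hsrc.mono hreg, ?_, ?_, ?_, hσ⟩
  · filter_upwards [hsrc, hks, hsm_ev, hinj, hz.eventually_nhds] with q hq h1 h2 h3 h4 e he
    set D := dM F (chartMap (E := E) x₀ ι) q with hD
    set l := fderiv ℝ (inChart x₀ ρ) (chartMap (E := E) x₀ ι q) with hl
    have hl0 : l ≠ 0 := hreg q hq
    have htan : ∀ v, l (D v) = 0 := by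
      intro v
      have a1 := hasDerivAt_path (h1.mdifferentiableAt (by simp)) v
      have a0 : HasFDerivAt (inChart x₀ ρ) l (chartMap (E := E) x₀ ι (path q v 0)) := by
        rw [path_zero]; exact (hasStrictFDerivAt_of_smooth h2).hasFDerivAt
      have a2 : HasDerivAt (fun t => inChart x₀ ρ (chartMap (E := E) x₀ ι (path q v t))) (l (D v))
          0 :=
        HasFDerivAt.comp_hasDerivAt (f := fun t => chartMap (E := E) x₀ ι (path q v t)) 0 a0 a1
      have a3 : (fun t => inChart x₀ ρ (chartMap (E := E) x₀ ι (path q v t))) =ᶠ[𝓝 0] fun _ => 0 :=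
        (tendsto_path q v).eventually h4
      exact a2.unique ((hasDerivAt_const (0 : ℝ) (0 : ℝ)).congr_of_eventuallyEq a3)
    -- Tangency gives one inclusion. Both spaces have real dimension 2 dim_ℂ E - 1, so they
    -- coincide.
    have hle : LinearMap.range D.toLinearMap ≤ LinearMap.ker l.toLinearMap := by
      rintro _ ⟨v, rfl⟩
      exact htan v
    have hfd : FiniteDimensional ℝ E := FiniteDimensional.complexToReal E
    have hr1 : Module.finrank ℝ (LinearMap.range D.toLinearMap) = Module.finrank ℝ F :=
      LinearMap.finrank_range_of_inj h3
    have hr2 : Module.finrank ℝ (LinearMap.ker l.toLinearMap) + 1 = Module.finrank ℝ E :=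
      Module.Dual.finrank_ker_add_one_of_ne_zero (f := l.toLinearMap)
        (fun h => hl0 (ContinuousLinearMap.coe_injective h))
    have hr3 := finrank_real_of_complex E
    have heq := Submodule.eq_of_le_of_finrank_eq hle (by omega)
    have : e ∈ LinearMap.range D.toLinearMap := heq ▸ he
    exact this
  · filter_upwards [hsrc] with q hq Z
    exact mem_inducedCR_iff hq (hιs.mdifferentiable (by simp) q) Z
  · filter_upwards [hsrc, hη] with q hq h1 v
    rw [h1, hypersurfaceForm_apply hq (hιs.mdifferentiable (by simp) q)
      (hρ.mdifferentiable (by simp) _)]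

end Hypersurface

/-! ### Extension of vectors to smooth sections -/

section Existence

variable {E : Type*} [NormedAddCommGroup E] [NormedSpace ℂ E]

lemma exists_normal {l : E →L[ℝ] ℝ} (hl : l ≠ 0) : ∃ N, delB l N = 2 := by
  obtain ⟨v, hv⟩ : ∃ v, l v ≠ 0 := by
    by_contra! h
    exact hl (ContinuousLinearMap.ext h)
  have h0 : delB l v ≠ 0 := fun h => hv (delB_eq_zero_iff.1 h).1
  exact ⟨(2 / delB l v) • v, by rw [delB_smul, div_mul_cancel₀ _ h0]⟩

variable {F : Type*} [NormedAddCommGroup F] [NormedSpace ℝ F]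
  {M : Type*} [TopologicalSpace M] [ChartedSpace F M]
  {T10 : CRBundle F M} {η : CForm F M} {k : M → E} {r : E → ℝ} {σ : ℝ} {p : M}

namespace LocalModel

/-- There is a smooth normal field near `p`. -/
lemma exists_normalField (h : LocalModel T10 η k r σ p) :
    ∃ N : M → E, ∀ᶠ q in 𝓝 p, ContMDiffAt 𝓘(ℝ, F) 𝓘(ℝ, E) ∞ N q ∧
      delB (fderiv ℝ r (k q)) (N q) = 2 := by
  obtain ⟨N₀, hN₀⟩ := exists_normal h.regular.self_of_nhds
  have hne : ∀ᶠ y in 𝓝 (k p), delB (fderiv ℝ r y) N₀ ≠ 0 := by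
    have hc := (contDiffAt_delB h.smooth_fun.self_of_nhds N₀).continuousAt
    exact hc.eventually_ne (by rw [hN₀]; norm_num)
  have hc := h.smooth_map.self_of_nhds.continuousAt
  refine ⟨fun q => (2 / delB (fderiv ℝ r (k q)) N₀) • N₀, ?_⟩
  filter_upwards [h.smooth_map, hc.eventually hne, hc.eventually h.smooth_fun] with q h1 h2 h3
  refine ⟨?_, by rw [delB_smul, div_mul_cancel₀ _ h2]⟩
  have h4 : ContDiffAt ℝ ∞ (fun y => (2 / delB (fderiv ℝ r y) N₀) • N₀) (k q) :=
    have h5 : ContDiffAt ℝ ∞ (fun y => 2 / delB (fderiv ℝ r y) N₀) (k q) := by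
      simp only [div_eq_mul_inv]
      exact contDiffAt_const.mul ((contDiffAt_delB h3 N₀).inv h2)
    h5.smul contDiffAt_const
  exact ContMDiffAt.comp (I' := 𝓘(ℝ, E)) q (contMDiffAt_iff_contDiffAt.2 h4) h1

/-- Every complex tangent vector extends to a smooth complex tangent field. -/
lemma exists_tangentField (h : LocalModel T10 η k r σ p) {a₀ : E}
    (ha₀ : delB (fderiv ℝ r (k p)) a₀ = 0) :
    ∃ a : M → E, a p = a₀ ∧ ∀ᶠ q in 𝓝 p, ContMDiffAt 𝓘(ℝ, F) 𝓘(ℝ, E) ∞ a q ∧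
      delB (fderiv ℝ r (k q)) (a q) = 0 := by
  obtain ⟨N, hN⟩ := h.exists_normalField
  have hc := h.smooth_map.self_of_nhds.continuousAt
  refine ⟨fun q => a₀ - (delB (fderiv ℝ r (k q)) a₀ / 2) • N q, by simp [ha₀], ?_⟩
  filter_upwards [hN, h.smooth_map, hc.eventually h.smooth_fun] with q h1 h2 h3
  constructor
  · have h4 : ContDiffAt ℝ ∞ (fun y => delB (fderiv ℝ r y) a₀ / 2) (k q) :=
      (contDiffAt_delB h3 a₀).div_const 2
    have h5 : ContMDiffAt 𝓘(ℝ, F) 𝓘(ℝ, ℂ) ∞ (fun q => delB (fderiv ℝ r (k q)) a₀ / 2) q :=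
      ContMDiffAt.comp (I' := 𝓘(ℝ, E)) q (contMDiffAt_iff_contDiffAt.2 h4) h2
    refine contMDiffAt_const.sub ?_
    have h6 : ContDiff ℝ ∞ (fun w : ℂ × E => w.1 • w.2) := contDiff_smul
    exact ContMDiffAt.comp (I' := 𝓘(ℝ, ℂ × E)) q
      (contMDiffAt_iff_contDiffAt.2 h6.contDiffAt) (h5.prodMk_space h1.1)
  · rw [delB_sub, delB_smul, h1.2]
    ring

variable [IsManifold 𝓘(ℝ, F) ∞ M]

/-- Fields tangent to the hypersurface are images of fields on `M`. -/
lemma exists_lift (h : LocalModel T10 η k r σ p) {a : M → E}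
    (ha : ∀ᶠ q in 𝓝 p, ContMDiffAt 𝓘(ℝ, F) 𝓘(ℝ, E) ∞ a q)
    (ht : ∀ᶠ q in 𝓝 p, fderiv ℝ r (k q) (a q) = 0) :
    ∃ A : M → F, ∀ᶠ q in 𝓝 p, along k A q = a q ∧
      ContMDiffAt 𝓘(ℝ, F) 𝓘(ℝ, F).tangent ∞
        (fun q => (⟨q, A q⟩ : TangentBundle 𝓘(ℝ, F) M)) q := by
  obtain ⟨Λ, hΛ, hΛk⟩ := h.retract
  have hc := h.smooth_map.self_of_nhds.continuousAt
  have e1 : ∀ᶠ q in 𝓝 p, along k (fun q => dMap F Λ (k q) (a q)) q = a q := by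
    filter_upwards [ht, h.range, dMap_dM hΛ hΛk h.smooth_map] with q h1 h2 h3
    obtain ⟨v, hv⟩ := h2 _ h1
    rw [along, ← hv, h3]
  refine ⟨fun q => dMap F Λ (k q) (a q), ?_⟩
  filter_upwards [e1.eventually_nhds, hc.eventually hΛ.eventually_nhds, hΛk.eventually_nhds,
    h.smooth_map.eventually_nhds, ha] with q h1 h2 h3 h4 h5
  exact ⟨h1.self_of_nhds, contMDiffAt_lift h2 h3 h4 (h5.congr_of_eventuallyEq h1)⟩

end LocalModel

variable [IsManifold 𝓘(ℝ, F) ∞ M]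

/-- The cutoff is supported inside S, so the fields may take arbitrary values off S. -/
lemma exists_global_field [FiniteDimensional ℝ F] [T2Space M]
    {A B : (q : M) → TangentSpace 𝓘(ℝ, F) q} {S : Set M}
    (hS : S ∈ 𝓝 p)
    (hA : ∀ q ∈ S, ContMDiffAt 𝓘(ℝ, F) 𝓘(ℝ, F).tangent ∞
        (fun q => (⟨q, A q⟩ : TangentBundle 𝓘(ℝ, F) M)) q)
    (hB : ∀ q ∈ S, ContMDiffAt 𝓘(ℝ, F) 𝓘(ℝ, F).tangent ∞
        (fun q => (⟨q, B q⟩ : TangentBundle 𝓘(ℝ, F) M)) q) :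
    ∃ χ : M → ℝ, χ p = 1 ∧ (∀ q ∉ S, χ q = 0) ∧
      SmoothField (fun q => (χ q : ℂ) • mkC (A q) (B q)) := by
  obtain ⟨χ, -, hχ⟩ := (SmoothBumpFunction.nhds_basis_tsupport (I := 𝓘(ℝ, F)) p).mem_iff.1
    (interior_mem_nhds.2 hS)
  refine ⟨χ, χ.eq_one, fun q hq => ?_, ?_⟩
  · exact image_eq_zero_of_notMem_tsupport fun h => hq (interior_subset (hχ h))
  · have key : ∀ C : (q : M) → TangentSpace 𝓘(ℝ, F) q, (∀ q ∈ S,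
        ContMDiffAt 𝓘(ℝ, F) 𝓘(ℝ, F).tangent ∞
          (fun q => (⟨q, C q⟩ : TangentBundle 𝓘(ℝ, F) M)) q) →
        ContMDiff 𝓘(ℝ, F) 𝓘(ℝ, F).tangent ∞
        (fun q => (⟨q, χ q • C q⟩ : TangentBundle 𝓘(ℝ, F) M)) := fun C hC =>
      ContMDiffOn.smul_section_of_tsupport (V := fun q : M => TangentSpace 𝓘(ℝ, F) q) (s := C)
        (ψ := χ) χ.contMDiff.contMDiffOn isOpen_interior
        hχ (fun q hq => (hC q (interior_subset hq)).contMDiffWithinAt)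
    constructor
    · simp only [rePart_smul, rePart_mkC, imPart_mkC, Complex.ofReal_re, Complex.ofReal_im,
          zero_smul,
        sub_zero]
      exact key A hA
    · simp only [imPart_smul, rePart_mkC, imPart_mkC, Complex.ofReal_re, Complex.ofReal_im,
          zero_smul,
        add_zero]
      exact key B hB

/-- Every vector of `T^{1,0}` extends to a smooth section. -/
lemma LocalModel.exists_section [FiniteDimensional ℝ F] [T2Space M]
    (h : LocalModel T10 η k r σ p) {a₀ : E} (ha₀ : delB (fderiv ℝ r (k p)) a₀ = 0) :
    ∃ L, IsSection T10 L ∧ along k (reF L) p = a₀ := by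
  obtain ⟨a, hap, ha⟩ := h.exists_tangentField ha₀
  have hI : ∀ {q}, ContMDiffAt 𝓘(ℝ, F) 𝓘(ℝ, E) ∞ a q →
      ContMDiffAt 𝓘(ℝ, F) 𝓘(ℝ, E) ∞ (fun q => -(Complex.I • a q)) q := fun {q} h1 => by
    obtain ⟨m, hm⟩ : ∃ m : E → E, m = fun w => -(Complex.I • w) := ⟨_, rfl⟩
    have h6 : ContDiff ℝ ∞ m := by rw [hm]; exact (contDiff_id.const_smul _).neg
    have h7 : (fun q => -(Complex.I • a q)) = m ∘ a := by rw [hm]; rfl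
    rw [h7]
    exact ContMDiffAt.comp (I' := 𝓘(ℝ, E)) q (contMDiffAt_iff_contDiffAt.2 h6.contDiffAt) h1
  -- A lifts a and B lifts -ia, which makes A + iB of type (1,0) near p; after the cutoff it is so
  -- everywhere.
  obtain ⟨A, hA⟩ := h.exists_lift (ha.mono fun q hq => hq.1)
    (ha.mono fun q hq => (delB_eq_zero_iff.1 hq.2).1)
  obtain ⟨B, hB⟩ := h.exists_lift (ha.mono fun q hq => hI hq.1)
    (ha.mono fun q hq => by rw [map_neg, (delB_eq_zero_iff.1 hq.2).2, neg_zero])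
  obtain ⟨χ, hχp, hχS, hχ⟩ := exists_global_field (A := A) (B := B) (hA.and (hB.and h.mem_iff))
    (fun q hq => hq.1.2) (fun q hq => hq.2.1.2)
  refine ⟨_, ⟨hχ, fun q => ?_⟩, ?_⟩
  · rcases Classical.em _ with hq | hq
    case inr =>
      rw [hχS q hq, Complex.ofReal_zero, zero_smul]
      exact Submodule.zero_mem _
    case inl =>
      refine Submodule.smul_mem _ _ ((hq.2.2 _).2 ?_)
      have h1 : dM F k q (A q) = a q := hq.1.1
      have h2 : dM F k q (B q) = -(Complex.I • a q) := hq.2.1.1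
      rw [← h1] at h2
      refine (congrArg (dM F k q) (imPart_mkC (V := TangentSpace 𝓘(ℝ, F) q) (A q) (B q))).trans
        (h2.trans (congrArg (fun v => -(Complex.I • dM F k q v)) ?_))
      exact (rePart_mkC (V := TangentSpace 𝓘(ℝ, F) q) (A q) (B q)).symm
  · have h1 : dM F k p (A p) = a p := hA.self_of_nhds.1
    rw [← hap, ← h1, along, reF, hχp, Complex.ofReal_one, one_smul]
    exact congrArg (dM F k p) (rePart_mkC (V := TangentSpace 𝓘(ℝ, F) p) (A p) (B p))

end Existence

/-! ### Existence of transversal fields and D'Angelo forms -/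

section Transversal

variable {E : Type*} [NormedAddCommGroup E] [NormedSpace ℂ E]
  {F : Type*} [NormedAddCommGroup F] [NormedSpace ℝ F] [FiniteDimensional ℝ F]
  {M : Type*} [TopologicalSpace M] [ChartedSpace F M] [IsManifold 𝓘(ℝ, F) ∞ M]
  {T10 : CRBundle F M} {η : CForm F M} {k : M → E} {r : E → ℝ} {σ : ℝ} {p : M}

omit [FiniteDimensional ℝ F] in
-- The vector iN is tangent because dr(iN) = 0, so -σ iN lifts to M. The value -i of η on the lift τ
-- is what gives η(iτ) = 1.
lemma LocalModel.exists_transversal_near (h : LocalModel T10 η k r σ p) :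
    ∃ τ : M → F, ∀ᶠ q in 𝓝 p, η q (τ q) = -Complex.I ∧
      ContMDiffAt 𝓘(ℝ, F) 𝓘(ℝ, F).tangent ∞
        (fun q => (⟨q, τ q⟩ : TangentBundle 𝓘(ℝ, F) M)) q := by
  obtain ⟨N, hN⟩ := h.exists_normalField
  obtain ⟨m, hm⟩ : ∃ m : E → E, m = fun w => -(σ • (Complex.I • w)) := ⟨_, rfl⟩
  have hms : ContDiff ℝ ∞ m := by
    rw [hm]; exact ((contDiff_id.const_smul Complex.I).const_smul σ).neg
  obtain ⟨τ, hτ⟩ := h.exists_lift (a := m ∘ N)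
    (hN.mono fun q hq => ContMDiffAt.comp (I' := 𝓘(ℝ, E)) q
      (contMDiffAt_iff_contDiffAt.2 hms.contDiffAt) hq.1)
    (hN.mono fun q hq => by
      rw [Function.comp, hm, map_neg, map_smul, (delB_eq_two_iff.1 hq.2).2, smul_zero, neg_zero])
  refine ⟨τ, ?_⟩
  filter_upwards [hN, hτ, h.form_eq] with q h1 h2 h3
  refine ⟨?_, h2.2⟩
  have h4 : dM F k q (τ q) = m (N q) := h2.1
  rw [h3, h4, hm, smul_neg, I_smul_real, I_smul_I_smul, smul_neg, neg_neg, map_smul,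
    (delB_eq_two_iff.1 h1.2).1]
  have hσ : (σ : ℂ) * σ = 1 := by exact_mod_cast h.sign
  push_cast [smul_eq_mul]
  linear_combination -Complex.I * hσ

/-- Transversal fields exist. -/
lemma exists_transversal [T2Space M] [SigmaCompactSpace M]
    (hloc : ∀ p, ∃ (k : M → E) (r : E → ℝ) (σ : ℝ), LocalModel T10 η k r σ p) :
    ∃ T, IsTransversal η T := by
  -- The normalization is an affine condition on the fibres, so local solutions glue by a partition
  -- of unity.
  obtain ⟨s, hs⟩ := exists_contMDiffSection_forall_mem_convex_of_local (n := (⊤ : ℕ∞)) 𝓘(ℝ, F)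
    (fun q : M => TangentSpace 𝓘(ℝ, F) q) (fun q => {v | η q v = -Complex.I})
    (fun q => by
      intro v hv w hw a b ha hb hab
      simp only [Set.mem_ofPred_eq] at *
      rw [map_add, map_smul, map_smul, hv, hw, ← add_smul, hab, one_smul])
    (fun p => by
      obtain ⟨k, r, σ, h⟩ := hloc p
      obtain ⟨τ, hτ⟩ := h.exists_transversal_near
      exact ⟨_, hτ, τ, fun q hq => hq.2.contMDiffWithinAt, fun q hq => hq.1⟩)
  refine ⟨fun q => mkC 0 (s q), ⟨?_, ?_⟩, fun q => rePart_mkC _ _, fun q => ?_⟩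
  · simp only [rePart_mkC]
    exact contMDiff_zeroSection ℝ (fun q : M => TangentSpace 𝓘(ℝ, F) q)
  · simp only [imPart_mkC]
    exact s.contMDiff
  · have := hs q
    simp only [Set.mem_ofPred_eq] at this
    rw [evalC, rePart_mkC, imPart_mkC, map_zero, this]
    simp

lemma dAngelo_add (B : E →L[ℝ] E →L[ℝ] ℝ) (N a b : E) :
    dAngelo B N (a + b) = dAngelo B N a + dAngelo B N b := by
  simp only [dAngelo, levB_add_apply]; push_cast; ring

lemma dAngelo_real_smul (B : E →L[ℝ] E →L[ℝ] ℝ) (N a : E) (t : ℝ) :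
    dAngelo B N (t • a) = t * dAngelo B N a := by
  simp only [dAngelo, levB_smul_apply]; push_cast; ring

lemma dAngelo_smul (B : E →L[ℝ] E →L[ℝ] ℝ) (N a : E) (z : ℂ) :
    dAngelo B N (z • a) = z * dAngelo B N a := by
  rw [complex_smul_eq, dAngelo_add, dAngelo_real_smul, dAngelo_real_smul, dAngelo_symm_smul]
  conv_rhs => rw [← Complex.re_add_im z]
  ring

/-- The complex linear extension to `ℂ ⊗ V` of a real linear map into a complex space. -/
def holPart {V : Type*} [AddCommGroup V] [Module ℝ V] (D : V →ₗ[ℝ] E) : ℂ ⊗[ℝ] V →ₗ[ℂ] E where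
  toFun Z := (1 / 2 : ℂ) • (D (rePart Z) + Complex.I • D (imPart Z))
  map_add' Z W := by simp only [map_add, smul_add]; abel
  map_smul' z Z := by
    simp only [rePart_smul, imPart_smul, map_add, map_sub, map_smul, RingHom.id_apply]
    rw [smul_comm z]
    congr 1
    rw [complex_smul_eq z]
    simp only [smul_add, I_smul_real, I_smul_I_smul, smul_neg]
    abel

/-- The D'Angelo form as a linear form on `ℂ ⊗ V`. -/
def dAngeloForm {V : Type*} [AddCommGroup V] [Module ℝ V] (D : V →ₗ[ℝ] E)
    (B : E →L[ℝ] E →L[ℝ] ℝ) (l : E →L[ℝ] ℝ) (N : E) : ℂ ⊗[ℝ] V →ₗ[ℂ] ℂ where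
  toFun Z := dAngelo B N (holPart D Z - (delB l (holPart D Z) / 2) • N)
  map_add' Z W := by
    rw [← dAngelo_add, map_add, delB_add, add_div, add_smul]
    congr 1
    abel
  map_smul' z Z := by
    rw [map_smul, delB_smul, RingHom.id_apply, smul_eq_mul, ← dAngelo_smul, mul_div_assoc, mul_smul,
      smul_sub]

omit [FiniteDimensional ℝ F] in
-- On T^{1,0} the map `holPart` is dk of the real part, and it kills T^{0,1}. It sends T to (σ/2)N,
-- which the subtraction of the normal component kills.
lemma LocalModel.exists_form (h : LocalModel T10 η k r σ p) {T : CVectorField F M}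
    (hT : IsTransversal η T) : ∃ θ : (ℂ ⊗[ℝ] TangentSpace 𝓘(ℝ, F) p) →ₗ[ℂ] ℂ,
      (∀ Z ∈ T10 p, θ Z = dAngelo (hes r (k p)) (normalField σ k T p) (dM F k p (rePart Z))) ∧
      (∀ Z ∈ T10 p, θ (conjC Z) = 0) ∧ θ (T p) = 0 := by
  obtain ⟨D, hD⟩ : ∃ D : TangentSpace 𝓘(ℝ, F) p →ₗ[ℝ] E, D = (dM F k p).toLinearMap := ⟨_, rfl⟩
  have hDv : ∀ v : TangentSpace 𝓘(ℝ, F) p, D v = dM F k p v := fun v => by rw [hD]; rfl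
  have htan : ∀ v : TangentSpace 𝓘(ℝ, F) p, fderiv ℝ r (k p) (D v) = 0 := fun v => by
    rw [hDv]; exact h.tangent v
  have hZ : ∀ Z ∈ T10 p, D (imPart Z) = -(Complex.I • D (rePart Z)) := fun Z hZ => by
    rw [hDv, hDv]; exact (h.mem_iff.self_of_nhds Z).1 hZ
  refine ⟨dAngeloForm D (hes r (k p)) (fderiv ℝ r (k p)) (normalField σ k T p), ?_, ?_, ?_⟩
  · intro Z hZ'
    have h1 : holPart D Z = D (rePart Z) := by
      change (1 / 2 : ℂ) • (D (rePart Z) + Complex.I • D (imPart Z)) = _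
      rw [hZ Z hZ', smul_neg, I_smul_I_smul, neg_neg, ← two_smul ℂ, smul_smul]
      norm_num
    have h2 : delB (fderiv ℝ r (k p)) (D (rePart Z)) = 0 := by
      rw [delB_eq_zero_iff]
      refine ⟨htan _, ?_⟩
      have := htan (imPart Z)
      rw [hZ Z hZ', map_neg, neg_eq_zero] at this
      exact this
    change dAngelo _ _ (holPart D Z - (delB _ (holPart D Z) / 2) • _) = _
    rw [h1, h2, zero_div, zero_smul, sub_zero, hDv]
    rfl
  · intro Z hZ'
    have h1 : holPart D (conjC Z) = 0 := by
      change (1 / 2 : ℂ) • (D (rePart (conjC Z)) + Complex.I • D (imPart (conjC Z))) = _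
      rw [rePart_conjC, imPart_conjC, map_neg, hZ Z hZ', neg_neg, I_smul_I_smul, add_neg_cancel,
        smul_zero]
    change dAngelo _ _ (holPart D (conjC Z) - (delB _ (holPart D (conjC Z)) / 2) • _) = _
    rw [h1]
    simp [delB, dAngelo, levB]
  · have h1 : holPart D (T p) = ((σ / 2 : ℝ) : ℂ) • normalField σ k T p := by
      change (1 / 2 : ℂ) • (D (rePart (T p)) + Complex.I • D (imPart (T p))) = _
      have e1 : D (imPart (T p)) = along k (imF T) p := hDv _
      rw [hT.imaginary, map_zero, zero_add, e1, h.along_transversal, smul_neg, I_smul_I_smul,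
          neg_neg,
        ← Complex.coe_smul, smul_smul]
      congr 1
      push_cast
      ring
    change dAngelo _ _ (holPart D (T p) - (delB _ (holPart D (T p)) / 2) • _) = _
    rw [h1, delB_smul, h.delB_normalField hT, mul_div_assoc, div_self two_ne_zero, mul_one,
        sub_self]
    simp [dAngelo, levB]

/-- The D'Angelo form attached to a transversal field. -/
lemma exists_dAngeloForm
    (hloc : ∀ p, ∃ (k : M → E) (r : E → ℝ) (σ : ℝ), LocalModel T10 η k r σ p)
    {T : CVectorField F M} (hT : IsTransversal η T) : ∃ θ, IsDAngeloForm T10 η θ ∧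
      (∀ L, IsSection T10 L → ∀ p, θ p (L p) = evalC η p (bracket T L p)) ∧
      (∀ p, ∀ Z ∈ T10 p, θ p (conjC Z) = 0) := by
  have key : ∀ p, ∃ θ : (ℂ ⊗[ℝ] TangentSpace 𝓘(ℝ, F) p) →ₗ[ℂ] ℂ,
      (∀ L, IsSection T10 L → θ (L p) = evalC η p (bracket T L p)) ∧
      (∀ Z ∈ T10 p, θ (conjC Z) = 0) ∧ θ (T p) = 0 := by
    intro p
    obtain ⟨k, r, σ, h⟩ := hloc p
    obtain ⟨θ, h1, h2, h3⟩ := h.exists_form hT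
    exact ⟨θ, fun L hL => by rw [h1 _ (hL.2 p), h.dAngelo_eq hT hL]; rfl, h2, h3⟩
  choose θ h1 h2 h3 using key
  exact ⟨θ, ⟨T, hT, fun L hL p => h1 p L hL, h2, h3⟩, fun L hL p => h1 p L hL, h2⟩

end Transversal

/-! ### Conditions on the null space as conditions on jets -/

section NullConditions

variable {E : Type*} [NormedAddCommGroup E] [NormedSpace ℂ E]
  {F : Type*} [NormedAddCommGroup F] [NormedSpace ℝ F]
  {M : Type*} [TopologicalSpace M] [ChartedSpace F M]
  {T10 : CRBundle F M} {η : CForm F M} {k : M → E} {r : E → ℝ} {σ : ℝ} {p : M}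

namespace LocalModel

lemma ext_of_re (h : LocalModel T10 η k r σ p) {Z W : ℂ ⊗[ℝ] TangentSpace 𝓘(ℝ, F) p}
    (hZ : Z ∈ T10 p) (hW : W ∈ T10 p) (hZW : dM F k p (rePart Z) = dM F k p (rePart W)) :
    Z = W := by
  refine complexified_ext (h.injective.self_of_nhds hZW) (h.injective.self_of_nhds ?_)
  exact ((h.mem_iff.self_of_nhds Z).1 hZ).trans
    ((congrArg (fun a => -(Complex.I • a)) hZW).trans ((h.mem_iff.self_of_nhds W).1 hW).symm)

lemma delB_re (h : LocalModel T10 η k r σ p) {Z : ℂ ⊗[ℝ] TangentSpace 𝓘(ℝ, F) p}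
    (hZ : Z ∈ T10 p) : delB (fderiv ℝ r (k p)) (dM F k p (rePart Z)) = 0 := by
  rw [delB_eq_zero_iff]
  refine ⟨h.tangent _, ?_⟩
  have h1 := h.tangent (imPart Z)
  have h2 := (h.mem_iff.self_of_nhds Z).1 hZ
  have h3 := (congrArg (fderiv ℝ r (k p)) h2).symm.trans h1
  rwa [map_neg, neg_eq_zero] at h3

variable [IsManifold 𝓘(ℝ, F) ∞ M] [FiniteDimensional ℝ F]

lemma exists_section_eq [T2Space M] (h : LocalModel T10 η k r σ p)
    {Z : ℂ ⊗[ℝ] TangentSpace 𝓘(ℝ, F) p} (hZ : Z ∈ T10 p) : ∃ L, IsSection T10 L ∧ L p = Z := by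
  obtain ⟨L, hL, hLp⟩ := h.exists_section (h.delB_re hZ)
  exact ⟨L, hL, h.ext_of_re (hL.2 p) hZ hLp⟩

/-- For a nonnegative form, vanishing on the diagonal already means lying in the kernel, by
Cauchy–Schwarz. -/
lemma mem_nullSpace_iff (h : LocalModel T10 η k r σ p)
    (hpos : ∀ a, delB (fderiv ℝ r (k p)) a = 0 → 0 ≤ levB (hes r (k p)) a a)
    {L : CVectorField F M} (hL : IsSection T10 L) :
    L p ∈ nullSpace T10 η p ↔
      levB (hes r (k p)) (along k (reF L) p) (along k (reF L) p) = 0 := by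
  have hsym := hes_symm h.smooth_fun.self_of_nhds
  have hσ : σ ≠ 0 := fun h0 => by simpa [h0] using h.sign
  constructor
  · intro hmem
    have h1 := hmem.2 L L hL hL rfl
    rw [h.levi_eq hL hL, levB_self_I hsym] at h1
    simpa [hσ] using h1
  · intro h0
    refine ⟨hL.2 p, fun L₁ L' hL₁ hL' heq => ?_⟩
    have e : along k (reF L₁) p = along k (reF L) p := congrArg (fun Z => dM F k p (rePart Z)) heq
    have ht : delB (fderiv ℝ r (k p)) (along k (reF L) p) = 0 := h.delB_re (hL.2 p)
    have ht' : delB (fderiv ℝ r (k p)) (along k (reF L') p) = 0 := h.delB_re (hL'.2 p)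
    rw [h.levi_eq hL₁ hL', e, levB_eq_zero_of_null hsym hpos ht h0 ht',
      levB_eq_zero_of_null hsym hpos ht h0 (by
        have := delB_apply_I (fderiv ℝ r (k p)) (along k (reF L') p)
        rw [this]
        exact mul_eq_zero_of_right _ ht')]
    simp

lemma isNull_along (h : LocalModel T10 η k r σ p)
    (hpos : ∀ a, delB (fderiv ℝ r (k p)) a = 0 → 0 ≤ levB (hes r (k p)) a a)
    {L : CVectorField F M} (hL : IsSection T10 L) (hmem : L p ∈ nullSpace T10 η p)
    (hne : L p ≠ 0) : IsNull r (k p) (along k (reF L) p) := by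
  refine ⟨h.zero.self_of_nhds, h.delB_re (hL.2 p), (h.mem_nullSpace_iff hpos hL).1 hmem, fun h0 =>
      ?_⟩
  refine hne (h.ext_of_re (hL.2 p) (T10 p).zero_mem ?_)
  have : (rePart (0 : ℂ ⊗[ℝ] TangentSpace 𝓘(ℝ, F) p)) = 0 := map_zero _
  exact h0.trans ((map_zero (dM F k p)).symm.trans (congrArg (dM F k p) this.symm))

end LocalModel

variable [IsManifold 𝓘(ℝ, F) ∞ M] [FiniteDimensional ℝ F] [T2Space M]

/-- The condition `R` holds for the D'Angelo quantities of `r` at `y`. -/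
def JetCondition (r : E → ℝ) (R : ℝ → ℝ → Prop) (y : E) : Prop :=
  ∀ a, IsNull r y a → ∀ N, delB (fderiv ℝ r y) N = 2 → R (dbarD r y N a) (dAngeloSq r y N a)

lemma onNull_of_jetCondition {R : ℝ → ℝ → Prop}
    (hloc : ∀ p, ∃ (k : M → E) (r : E → ℝ) (σ : ℝ), LocalModel T10 η k r σ p ∧ LeviNear r (k p) ∧
      JetCondition r R (k p)) : OnNull T10 η R := by
  rintro θ ⟨T, hT, hθ, hθ', -⟩ L hL p hmem hne
  obtain ⟨k, r, σ, h, hlev, hR⟩ := hloc p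
  have hnull := h.isNull_along (hlev.self h.zero.self_of_nhds) hL hmem hne
  have h1 := h.dbarForm_eq hlev hT hθ hθ' (fun Z hZ => h.exists_section_eq hZ) hL hnull
  have h2 : ‖θ p (L p)‖ ^ 2 = dAngeloSq r (k p) (LocalModel.normalField σ k T p)
      (along k (reF L) p) := by
    rw [hθ L hL, h.dAngelo_eq hT hL, norm_dAngelo_sq]
  rw [h1, h2]
  exact hR _ hnull _ (h.delB_normalField hT)

/-- As `OnNull` quantifies over all D'Angelo forms and sections, using it requires producing one of
each. The normal vector this yields is then exchanged for the given one. -/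
lemma jetCondition_of_onNull [FiniteDimensional ℂ E] [SigmaCompactSpace M] {R : ℝ → ℝ → Prop}
    (hloc : ∀ p, ∃ (k : M → E) (r : E → ℝ) (σ : ℝ), LocalModel T10 η k r σ p)
    (hR : OnNull T10 η R) (h : LocalModel T10 η k r σ p) (hlev : LeviNear r (k p)) :
    JetCondition r R (k p) := by
  intro a ha N hN
  obtain ⟨T, hT⟩ := exists_transversal hloc
  obtain ⟨θ, hθT, hθ, hθ'⟩ := exists_dAngeloForm hloc hT
  obtain ⟨L, hL, hLa⟩ := h.exists_section ha.tangent
  subst hLa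
  have hpos := hlev.self h.zero.self_of_nhds
  have h0 := hR θ hθT L hL p ((h.mem_nullSpace_iff hpos hL).2 ha.null) (fun h0 => ha.ne (by
    have : rePart (L p) = 0 := by rw [h0, map_zero]
    exact (congrArg (dM F k p) this).trans (map_zero _)))
  have h1 := h.dbarForm_eq hlev hT hθ hθ' (fun Z hZ => h.exists_section_eq hZ) hL ha
  have h2 : ‖θ p (L p)‖ ^ 2 = dAngeloSq r (k p) (LocalModel.normalField σ k T p)
      (along k (reF L) p) := by
    rw [hθ L hL, h.dAngelo_eq hT hL, norm_dAngelo_sq]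
  rw [h1, h2] at h0
  have hNT := h.delB_normalField hT
  rwa [dbarD_congr h.smooth_fun.self_of_nhds hlev hNT hN ha,
      dAngeloSq_congr h.smooth_fun.self_of_nhds hlev hNT hN ha] at h0

end NullConditions

/-! ### Defining functions near the boundary -/

section DefiningFunctions

variable {E : Type*} [NormedAddCommGroup E] [NormedSpace ℂ E]
  {X : Type*} [TopologicalSpace X] [ChartedSpace E X]
  {Ω : Set X} {ρ : X → ℝ}

omit [NormedSpace ℂ E] in
lemma tendsto_chartAt_symm {x₀ x : X} (hx : x ∈ (chartAt E x₀).source) :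
    Tendsto (chartAt E x₀).symm (𝓝 (chartAt E x₀ x)) (𝓝 x) := by
  have hc := (chartAt E x₀).continuousAt_symm ((chartAt E x₀).map_source hx)
  rwa [ContinuousAt, (chartAt E x₀).left_inv hx] at hc

omit [NormedSpace ℂ E] in
lemma tendsto_chartAt {x₀ x : X} (hx : x ∈ (chartAt E x₀).source) :
    Tendsto (chartAt E x₀) (𝓝 x) (𝓝 (chartAt E x₀ x)) :=
  (chartAt E x₀).continuousAt hx

omit [NormedSpace ℂ E] in
lemma eventually_mem_source {x₀ x : X} (hx : x ∈ (chartAt E x₀).source) :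
    ∀ᶠ z in 𝓝 x, z ∈ (chartAt E x₀).source := (chartAt E x₀).open_source.mem_nhds hx

omit [NormedSpace ℂ E] in
lemma eventually_mem_target {x₀ x : X} (hx : x ∈ (chartAt E x₀).source) :
    ∀ᶠ y in 𝓝 (chartAt E x₀ x), y ∈ (chartAt E x₀).target :=
  (chartAt E x₀).open_target.mem_nhds ((chartAt E x₀).map_source hx)

omit [NormedSpace ℂ E] in
lemma inChart_chartAt (u : X → ℝ) {x₀ x : X} (hx : x ∈ (chartAt E x₀).source) :
    inChart (E := E) x₀ u (chartAt E x₀ x) = u x := by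
  rw [inChart, Function.comp, (chartAt E x₀).left_inv hx]

namespace IsDefiningFunction

lemma continuous (h : IsDefiningFunction E Ω ρ) : Continuous ρ := h.smooth.continuous

lemma isOpen (h : IsDefiningFunction E Ω ρ) : IsOpen Ω := by
  rw [h.sublevel]
  exact isOpen_lt h.continuous continuous_const

lemma nonpos_of_mem_closure (h : IsDefiningFunction E Ω ρ) {x : X} (hx : x ∈ closure Ω) :
    ρ x ≤ 0 := by
  have : closure Ω ⊆ {x | ρ x ≤ 0} := by
    refine closure_minimal ?_ (isClosed_le h.continuous continuous_const)
    rw [h.sublevel]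
    exact fun x (hx : ρ x < 0) => hx.le
  exact this hx

lemma nonneg_of_notMem (h : IsDefiningFunction E Ω ρ) {x : X} (hx : x ∉ Ω) : 0 ≤ ρ x := by
  rw [h.sublevel] at hx
  exact not_lt.1 hx

lemma zero (h : IsDefiningFunction E Ω ρ) {x : X} (hx : x ∈ frontier Ω) : ρ x = 0 := by
  rw [h.isOpen.frontier_eq] at hx
  exact le_antisymm (h.nonpos_of_mem_closure hx.1) (h.nonneg_of_notMem hx.2)

variable [IsManifold 𝓘(ℂ, E) ω X]

lemma smooth_inChart (h : IsDefiningFunction E Ω ρ) {x₀ x : X} (hx : x ∈ (chartAt E x₀).source) :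
    ∀ᶠ y in 𝓝 (chartAt E x₀ x), ContDiffAt ℝ ∞ (inChart x₀ ρ) y :=
  eventually_contDiffAt_inChart hx (Eventually.of_forall fun z => h.smooth z)

lemma regular (h : IsDefiningFunction E Ω ρ) {x₀ x : X} (hx : x ∈ (chartAt E x₀).source)
    (hxΩ : x ∈ frontier Ω) : fderiv ℝ (inChart x₀ ρ) (chartAt E x₀ x) ≠ 0 := by
  intro h0
  refine h.nondegenerate x hxΩ ?_
  have : dM E ρ x = 0 := by
    ext v
    rw [dM_eq_inChart hx (h.smooth.mdifferentiable (by simp) _), h0]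
    rfl
  exact this

lemma eventually_regular (h : IsDefiningFunction E Ω ρ) {x₀ x : X}
    (hx : x ∈ (chartAt E x₀).source) (hxΩ : x ∈ frontier Ω) :
    ∀ᶠ y in 𝓝 (chartAt E x₀ x), fderiv ℝ (inChart x₀ ρ) y ≠ 0 :=
  (contDiffAt_fderiv (h.smooth_inChart hx).self_of_nhds).continuousAt.eventually_ne
    (h.regular hx hxΩ)

/-- A nonzero differential gives a direction in which ρ becomes negative at once, so x is a limit of
points of Ω. Regularity is needed because ρ may also vanish away from the boundary. -/
lemma mem_frontier_of_regular (h : IsDefiningFunction E Ω ρ) {x₀ x : X}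
    (hx : x ∈ (chartAt E x₀).source) (hx0 : ρ x = 0)
    (hreg : fderiv ℝ (inChart x₀ ρ) (chartAt E x₀ x) ≠ 0) : x ∈ frontier Ω := by
  rw [h.isOpen.frontier_eq]
  refine ⟨?_, by rw [h.sublevel]; exact fun hlt => hlt.ne hx0⟩
  obtain ⟨v, hv⟩ : ∃ v, fderiv ℝ (inChart x₀ ρ) (chartAt E x₀ x) v < 0 := by
    by_contra! hall
    refine hreg (ContinuousLinearMap.ext fun v => le_antisymm ?_ (hall v))
    have := hall (-v)
    rw [map_neg] at this
    simpa using this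
  have h1 : HasDerivAt (fun t : ℝ => chartAt E x₀ x + t • v) v 0 := by
    simpa using ((hasDerivAt_id (0 : ℝ)).smul_const v).const_add (chartAt E x₀ x)
  have h2 : HasDerivAt (fun t : ℝ => inChart (E := E) x₀ ρ (chartAt E x₀ x + t • v))
      (fderiv ℝ (inChart x₀ ρ) (chartAt E x₀ x) v) 0 := by
    have := (hasStrictFDerivAt_of_smooth (h.smooth_inChart hx).self_of_nhds).hasFDerivAt
    exact HasFDerivAt.comp_hasDerivAt (f := fun t : ℝ => chartAt E x₀ x + t • v) 0
      (by simpa using this) h1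
  have h3 : ∀ᶠ t in 𝓝[>] (0 : ℝ), inChart (E := E) x₀ ρ (chartAt E x₀ x + t • v) < 0 := by
    have h4 := (hasDerivAt_iff_tendsto_slope.1 h2).mono_left
      (nhdsWithin_mono (0 : ℝ) (fun t (ht : 0 < t) => ht.ne'))
    filter_upwards [h4.eventually_lt_const hv, self_mem_nhdsWithin] with t ht htp
    have h0 : inChart (E := E) x₀ ρ (chartAt E x₀ x + (0 : ℝ) • v) = 0 := by
      rw [zero_smul, add_zero, inChart_chartAt ρ hx, hx0]
    rw [slope_def_field, h0, sub_zero, sub_zero] at ht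
    exact (div_neg_iff.1 ht).resolve_left (fun h => absurd h.2 (not_lt.2 (le_of_lt htp))) |>.1
  have h5 : Tendsto (fun t : ℝ => (chartAt E x₀).symm (chartAt E x₀ x + t • v)) (𝓝[>] 0) (𝓝 x) := by
    refine (tendsto_chartAt_symm hx).comp ?_
    have := h1.continuousAt.tendsto
    rw [zero_smul, add_zero] at this
    exact this.mono_left nhdsWithin_le_nhds
  refine mem_closure_of_tendsto h5 (h3.mono fun t ht => ?_)
  rw [h.sublevel]
  exact ht

/-- Near the boundary, `ρ` is positive outside the closure of `Ω`. -/
lemma eventually_pos (h : IsDefiningFunction E Ω ρ) {x : X} (hx : x ∈ frontier Ω) :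
    ∀ᶠ z in 𝓝 x, z ∉ closure Ω → 0 < ρ z := by
  have hs := mem_chart_source E x
  filter_upwards [eventually_mem_source hs, (tendsto_chartAt hs).eventually
    (h.eventually_regular hs hx)] with z h1 h2 h3
  refine (h.nonneg_of_notMem fun h4 => h3 (subset_closure h4)).lt_of_ne' fun h0 => h3 ?_
  exact frontier_subset_closure (h.mem_frontier_of_regular h1 h0 h2)

end IsDefiningFunction

end DefiningFunctions

/-! ### The boundary as an embedded CR manifold -/

section Boundary

variable {E : Type*} [NormedAddCommGroup E] [NormedSpace ℂ E]
  {X : Type*} [TopologicalSpace X] [ChartedSpace E X]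
  {F : Type*} [NormedAddCommGroup F] [NormedSpace ℝ F]
  {M : Type*} [TopologicalSpace M] [ChartedSpace F M]

variable (E F) in
/-- The boundary of `Ω` is compact, and the image of the embedding `ι` of a real hypersurface. -/
structure IsSmoothBoundary (Ω : Set X) (ι : M → X) : Prop where
  compact : IsCompact (frontier Ω)
  dim : Module.finrank ℝ F + 1 = 2 * Module.finrank ℂ E
  embedding : Manifold.IsSmoothEmbedding 𝓘(ℝ, F) 𝓘(ℝ, E) ∞ ι
  range : Set.range ι = frontier Ω

/-- The boundary is pseudoconvex with respect to `ρ`. -/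
def LeviCondition (E : Type*) [NormedAddCommGroup E] [NormedSpace ℂ E] [ChartedSpace E X]
    (Ω : Set X) (ρ : X → ℝ) : Prop :=
  ∀ x ∈ frontier Ω, ∀ x₀, x ∈ (chartAt E x₀).source →
    LeviNear (inChart (E := E) x₀ ρ) (chartAt E x₀ x)

/-- The condition `R` holds for the D'Angelo quantities of `ρ` along the boundary. -/
def BoundaryCondition (E : Type*) [NormedAddCommGroup E] [NormedSpace ℂ E] [ChartedSpace E X]
    (Ω : Set X) (ρ : X → ℝ) (R : ℝ → ℝ → Prop) : Prop :=
  ∀ x ∈ frontier Ω, ∀ x₀, x ∈ (chartAt E x₀).source →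
    JetCondition (inChart (E := E) x₀ ρ) R (chartAt E x₀ x)

/-- `η` is locally `± η_ρ`. -/
def IsSignedForm (E : Type*) [NormedAddCommGroup E] [NormedSpace ℂ E] [ChartedSpace E X]
    (ι : M → X) (ρ : X → ℝ) (η : CForm F M) : Prop :=
  ∀ p, ∃ σ : ℝ, σ * σ = 1 ∧ ∀ᶠ q in 𝓝 p, ∀ v : F,
    η q v = (σ : ℂ) * hypersurfaceForm (E := E) ι ρ q v

namespace IsSmoothBoundary

variable {Ω : Set X} {ι : M → X} {ρ : X → ℝ}

lemma mem_frontier (hb : IsSmoothBoundary E F Ω ι) (q : M) : ι q ∈ frontier Ω := by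
  rw [← hb.range]
  exact ⟨q, rfl⟩

lemma compactSpace (hb : IsSmoothBoundary E F Ω ι) : CompactSpace M := by
  refine ⟨?_⟩
  rw [hb.embedding.isEmbedding.isCompact_iff, Set.image_univ, hb.range]
  exact hb.compact

lemma t2Space [T2Space X] (hb : IsSmoothBoundary E F Ω ι) : T2Space M :=
  hb.embedding.isEmbedding.t2Space

variable [FiniteDimensional ℂ E] [FiniteDimensional ℝ F] [IsManifold 𝓘(ℂ, E) ω X]

/-- The sign of η relative to η_ρ is left free: a trivialization need not have a definite one, and
the D'Angelo quantities of ρ do not depend on it. -/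
lemma localModel (hb : IsSmoothBoundary E F Ω ι) (hρ : IsDefiningFunction E Ω ρ) {η : CForm F M}
    (hη : IsSignedForm E ι ρ η) {p : M} {x₀ : X} (hp : ι p ∈ (chartAt E x₀).source) :
    ∃ σ, LocalModel (inducedCR E ι : CRBundle F M) η (chartMap (E := E) x₀ ι) (inChart x₀ ρ) σ p :=
        by
  obtain ⟨σ, hσ, h⟩ := hη p
  exact ⟨σ, localModel_hypersurface hb.dim hp hb.embedding.isImmersion hρ.smooth
    (fun q => hρ.zero (hb.mem_frontier q)) (fun q => hρ.nondegenerate _ (hb.mem_frontier q)) h hσ⟩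

omit [FiniteDimensional ℂ E] [FiniteDimensional ℝ F] [IsManifold 𝓘(ℂ, E) ω X] in
lemma signedForm_self : IsSignedForm E ι ρ (hypersurfaceForm (E := E) (F := F) ι ρ) :=
  fun p => ⟨1, one_mul 1, Eventually.of_forall fun q v => by
    rw [Complex.ofReal_one]; exact (one_mul _).symm⟩

lemma localModel_self (hb : IsSmoothBoundary E F Ω ι) (hρ : IsDefiningFunction E Ω ρ)
    {p : M} {x₀ : X} (hp : ι p ∈ (chartAt E x₀).source) :
    LocalModel (inducedCR E ι : CRBundle F M) (hypersurfaceForm (E := E) (F := F) ι ρ)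
        (chartMap (E := E) x₀ ι) (inChart x₀ ρ) 1 p :=
  localModel_hypersurface hb.dim hp hb.embedding.isImmersion hρ.smooth
    (fun q => hρ.zero (hb.mem_frontier q)) (fun q => hρ.nondegenerate _ (hb.mem_frontier q))
    (Eventually.of_forall fun q v => by rw [Complex.ofReal_one]; exact (one_mul _).symm) (one_mul 1)

variable [IsManifold 𝓘(ℝ, F) ∞ M] [T2Space X]

/-- Zeros of ρ near a boundary point are themselves boundary points, and every complex tangent
vector there extends to a section on which the Levi form can be read. -/
lemma leviCondition (hb : IsSmoothBoundary E F Ω ι) (hρ : IsDefiningFunction E Ω ρ)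
    (hlev : LeviNonneg (inducedCR E ι : CRBundle F M) (hypersurfaceForm (E := E) (F := F) ι ρ)) :
    LeviCondition E Ω ρ := by
  have := hb.t2Space
  intro x hx x₀ hxs
  filter_upwards [eventually_mem_target hxs, hρ.eventually_regular hxs hx] with y h1 h2 h3 a ha
  have hs := (chartAt E x₀).map_target h1
  have hfr : (chartAt E x₀).symm y ∈ frontier Ω :=
    hρ.mem_frontier_of_regular hs h3 (by rwa [(chartAt E x₀).right_inv h1])
  rw [← hb.range] at hfr
  obtain ⟨q, hq⟩ := hfr
  rw [← hq] at hs
  have hky : chartMap (E := E) x₀ ι q = y := by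
    rw [chartMap, Function.comp, hq, (chartAt E x₀).right_inv h1]
  have h := hb.localModel_self hρ hs
  rw [← hky] at ha ⊢
  obtain ⟨L, hL, hLa⟩ := h.exists_section ha
  have h4 := hlev L hL q
  rw [h.levi_eq hL hL, hLa] at h4
  simpa using h4

omit [T2Space X] in
lemma leviNonneg (hb : IsSmoothBoundary E F Ω ι) (hρ : IsDefiningFunction E Ω ρ)
    (hlev : LeviCondition E Ω ρ) :
    LeviNonneg (inducedCR E ι : CRBundle F M) (hypersurfaceForm (E := E) (F := F) ι ρ) := by
  intro L hL p
  have h := hb.localModel_self hρ (mem_chart_source E (ι p))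
  have h1 := (hlev _ (hb.mem_frontier p) _ (mem_chart_source E (ι p))).self
    h.zero.self_of_nhds _ (h.delB_re (hL.2 p))
  rw [h.levi_eq hL hL]
  simp only [Complex.ofReal_one, one_mul, Complex.add_re, Complex.ofReal_re, Complex.mul_re,
    Complex.I_re, zero_mul, Complex.I_im, Complex.ofReal_im, mul_zero, sub_zero, add_zero]
  exact h1

lemma boundaryCondition_of_onNull (hb : IsSmoothBoundary E F Ω ι) (hρ : IsDefiningFunction E Ω ρ)
    (hlev : LeviCondition E Ω ρ) {η : CForm F M} (hη : IsSignedForm E ι ρ η) {R : ℝ → ℝ → Prop}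
    (hR : OnNull (inducedCR E ι) η R) : BoundaryCondition E Ω ρ R := by
  have := hb.t2Space
  have := hb.compactSpace
  intro x hx x₀ hxs
  obtain ⟨p, rfl⟩ : x ∈ Set.range ι := by rwa [hb.range]
  obtain ⟨σ, h⟩ := hb.localModel hρ hη hxs
  exact jetCondition_of_onNull (k := chartMap (E := E) x₀ ι) (p := p) (fun q =>
      ⟨_, _, hb.localModel hρ hη (mem_chart_source E (ι q))⟩)
    hR h (hlev _ hx _ hxs)

/-- One chart at each boundary point is enough, and this is the form in which compactness arguments
provide the inequality. -/
lemma onNull_of_boundaryCondition (hb : IsSmoothBoundary E F Ω ι) (hρ : IsDefiningFunction E Ω ρ)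
    (hlev : LeviCondition E Ω ρ) {η : CForm F M} (hη : IsSignedForm E ι ρ η) {R : ℝ → ℝ → Prop}
    (hR : ∀ x ∈ frontier Ω, ∃ x₀, x ∈ (chartAt E x₀).source ∧
      JetCondition (inChart (E := E) x₀ ρ) R (chartAt E x₀ x)) : OnNull (inducedCR E ι) η R := by
  have := hb.t2Space
  refine onNull_of_jetCondition (E := E) fun p => ?_
  obtain ⟨x₀, hx₀, h⟩ := hR _ (hb.mem_frontier p)
  obtain ⟨σ, hσ⟩ := hb.localModel hρ hη hx₀
  exact ⟨_, _, σ, hσ, hlev _ (hb.mem_frontier p) _ hx₀, h⟩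

end IsSmoothBoundary

end Boundary

/-! ### Trivializations from local models -/

section SmoothForms

variable {E : Type*} [NormedAddCommGroup E] [NormedSpace ℂ E]
  {F : Type*} [NormedAddCommGroup F] [NormedSpace ℝ F]
  {M : Type*} [TopologicalSpace M] [ChartedSpace F M] [IsManifold 𝓘(ℝ, F) ∞ M]

/-- The derivative of a function, composed with a smooth family of linear forms, is a smooth
form. -/
lemma contMDiffAt_form {k : M → E} {l : M → E →L[ℝ] ℂ} {η : CForm F M} {p : M}
    (hk : ContMDiffAt 𝓘(ℝ, F) 𝓘(ℝ, E) ∞ k p)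
    (hl : ContMDiffAt 𝓘(ℝ, F) 𝓘(ℝ, E →L[ℝ] ℂ) ∞ l p)
    (hη : ∀ᶠ q in 𝓝 p, η q = (l q).comp (dM F k q)) :
    ContMDiffAt 𝓘(ℝ, F) (𝓘(ℝ, F).prod 𝓘(ℝ, F →L[ℝ] ℂ)) ∞
      (fun p => TotalSpace.mk' (F →L[ℝ] ℂ)
        (E := fun p : M => TangentSpace 𝓘(ℝ, F) p →L[ℝ] Trivial M ℂ p) p (η p)) p := by
  rw [contMDiffAt_hom_bundle]
  refine ⟨contMDiffAt_id, ?_⟩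
  have h1 := hk.mfderiv_const (m := ∞) (by simp)
  have h2 := hl.clm_comp h1
  refine h2.congr_of_eventuallyEq ?_
  filter_upwards [hη] with q hq
  ext v
  simp [ContinuousLinearMap.inCoordinates, inTangentCoordinates, hq]
  rfl

/-- The form `(∂r - ∂̄r)/2` on `E`. -/
def jetForm (r : E → ℝ) (y : E) : E →L[ℝ] ℂ :=
  (-(Complex.I / 2)) • (Complex.ofRealCLM ∘L fderiv ℝ r y ∘L
    (Complex.I • ContinuousLinearMap.id ℝ E : E →L[ℝ] E))

lemma contDiffAt_jetForm {r : E → ℝ} {y : E} (hr : ContDiffAt ℝ ∞ r y) :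
    ContDiffAt ℝ ∞ (jetForm r) y :=
  ContDiffAt.const_smul (-(Complex.I / 2)) (contDiffAt_const.clm_comp
    ((contDiffAt_fderiv hr).clm_comp contDiffAt_const))

namespace LocalModel

variable {T10 : CRBundle F M} {η : CForm F M} {k : M → E} {r : E → ℝ} {σ : ℝ} {p : M}

lemma contMDiffAt_form (h : LocalModel T10 η k r σ p) :
    ContMDiffAt 𝓘(ℝ, F) (𝓘(ℝ, F).prod 𝓘(ℝ, F →L[ℝ] ℂ)) ∞
      (fun p => TotalSpace.mk' (F →L[ℝ] ℂ)
        (E := fun p : M => TangentSpace 𝓘(ℝ, F) p →L[ℝ] Trivial M ℂ p) p (η p)) p := by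
  have h1 : ContDiffAt ℝ ∞ (fun y => (σ : ℂ) • jetForm r y) (k p) :=
    ContDiffAt.const_smul _ (contDiffAt_jetForm h.smooth_fun.self_of_nhds)
  refine CRIndex.contMDiffAt_form (l := fun q => (σ : ℂ) • jetForm r (k q))
      h.smooth_map.self_of_nhds
    ?_ ?_
  · obtain ⟨m, hm⟩ : ∃ m : E → E →L[ℝ] ℂ, m = fun y => (σ : ℂ) • jetForm r y := ⟨_, rfl⟩
    rw [← hm] at h1
    have h2 := ContMDiffAt.comp (I' := 𝓘(ℝ, E)) p (contMDiffAt_iff_contDiffAt.2 h1)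
      h.smooth_map.self_of_nhds
    rwa [hm] at h2
  filter_upwards [h.form_eq] with q hq
  exact ContinuousLinearMap.ext hq

omit [IsManifold 𝓘(ℝ, F) ∞ M] in
lemma form_apply_eq_zero (h : LocalModel T10 η k r σ p) {v : F}
    (hv : fderiv ℝ r (k p) (Complex.I • dM F k p v) = 0) : η p v = 0 := by
  refine (h.form_eq.self_of_nhds _).trans ?_
  rw [hv, Complex.ofReal_zero, mul_zero, mul_zero]

omit [IsManifold 𝓘(ℝ, F) ∞ M] in
lemma form_eq_zero (h : LocalModel T10 η k r σ p) {Z : ℂ ⊗[ℝ] TangentSpace 𝓘(ℝ, F) p}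
    (hZ : Z ∈ T10 p) : η p (rePart Z) = 0 ∧ η p (imPart Z) = 0 := by
  obtain ⟨h1, h2⟩ := delB_eq_zero_iff.1 (h.delB_re hZ)
  have h3 : dM F k p (imPart Z) = -(Complex.I • dM F k p (rePart Z)) :=
    (h.mem_iff.self_of_nhds Z).1 hZ
  refine ⟨h.form_apply_eq_zero h2, h.form_apply_eq_zero (v := imPart Z) ?_⟩
  refine (congrArg (fun e => fderiv ℝ r (k p) (Complex.I • e)) h3).trans ?_
  rwa [smul_neg, I_smul_I_smul, neg_neg]

lemma form_ne_zero (h : LocalModel T10 η k r σ p) : η p ≠ 0 := by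
  obtain ⟨τ, hτ⟩ := h.exists_transversal_near
  intro h0
  have h1 := hτ.self_of_nhds.1
  rw [h0] at h1
  have h2 : (0 : ℂ) = -Complex.I := h1
  simp at h2

end LocalModel

lemma isTrivialization_of_localModel {T10 : CRBundle F M} {η : CForm F M}
    (hloc : ∀ p, ∃ (k : M → E) (r : E → ℝ) (σ : ℝ), LocalModel T10 η k r σ p) :
    IsTrivialization T10 η where
  smooth p := by
    obtain ⟨k, r, σ, h⟩ := hloc p
    exact h.contMDiffAt_form
  imaginary p v := by
    obtain ⟨k, r, σ, h⟩ := hloc p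
    rw [h.form_eq.self_of_nhds v]
    simp
  nonvanishing p := by
    obtain ⟨k, r, σ, h⟩ := hloc p
    exact h.form_ne_zero
  annihilates p Z hZ := by
    obtain ⟨k, r, σ, h⟩ := hloc p
    obtain ⟨h1, h2⟩ := h.form_eq_zero hZ
    rw [evalC, evalC, rePart_conjC, imPart_conjC, map_neg, h1, h2]
    simp

end SmoothForms

/-! ### Proportionality of trivializations -/

section Ratio

variable {E : Type*} [NormedAddCommGroup E] [NormedSpace ℂ E]
  {F : Type*} [NormedAddCommGroup F] [NormedSpace ℝ F]
  {M : Type*} [TopologicalSpace M] [ChartedSpace F M] [IsManifold 𝓘(ℝ, F) ∞ M]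
  {T10 : CRBundle F M} {η η' : CForm F M} {k : M → E} {r : E → ℝ} {σ : ℝ} {p : M}

omit [IsManifold 𝓘(ℝ, F) ∞ M] in
lemma IsTrivialization.apply_re (h' : ∀ p, ∀ Z ∈ T10 p, evalC η' p Z = 0 ∧ evalC η' p (conjC Z) = 0)
    {Z : ℂ ⊗[ℝ] TangentSpace 𝓘(ℝ, F) p} (hZ : Z ∈ T10 p) : η' p (rePart Z) = 0 := by
  obtain ⟨h1, h2⟩ := h' p Z hZ
  rw [evalC] at h1 h2
  rw [rePart_conjC, imPart_conjC, map_neg] at h2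
  linear_combination (1 / 2 : ℂ) * h1 + (1 / 2 : ℂ) * h2

omit [IsManifold 𝓘(ℝ, F) ∞ M] in
/-- Two forms that annihilate `T^{1,0} ⊕ T^{0,1}` are proportional. -/
lemma LocalModel.form_proportional (h : LocalModel T10 η k r σ p)
    (h' : ∀ p, ∀ Z ∈ T10 p, evalC η' p Z = 0 ∧ evalC η' p (conjC Z) = 0) {τ : F}
    (hτ : η p τ = -Complex.I) (v : F) : η' p v = (Complex.I * η' p τ) * η p v := by
  obtain ⟨c, hc⟩ : ∃ c : ℝ, c = σ / 2 * fderiv ℝ r (k p) (Complex.I • dM F k p v) := ⟨_, rfl⟩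
  have hηv : η p v = -Complex.I * c := by
    rw [h.form_eq.self_of_nhds, hc]
    push_cast
    ring
  -- Removing a real multiple of τ puts w into the kernel of η, where it is the real part of a
  -- vector of T^{1,0}. Hence the other form vanishes on it too.
  obtain ⟨w, hw⟩ : ∃ w : F, w = v - c • τ := ⟨_, rfl⟩
  have e : ∀ ξ : CForm F M, ξ p w = ξ p v - c * ξ p τ := fun ξ => by
    obtain ⟨f, hf⟩ : ∃ f : F →L[ℝ] ℂ, f = ξ p := ⟨_, rfl⟩
    have h1 : f w = f v - c * f τ := by
      rw [hw, map_sub, map_smul]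
      rfl
    subst hf
    exact h1
  have hηw : η p w = 0 := by
    rw [e, hηv, hτ]
    ring
  have hlw : fderiv ℝ r (k p) (Complex.I • dM F k p w) = 0 := by
    have h1 := (h.form_eq.self_of_nhds w).symm.trans hηw
    have hσ : σ ≠ 0 := fun h0 => by simpa [h0] using h.sign
    simpa [hσ] using h1
  obtain ⟨B, hB⟩ := h.range.self_of_nhds (-(Complex.I • dM F k p w))
      (by rw [map_neg, hlw, neg_zero])
  have hmem : (mkC w B : ℂ ⊗[ℝ] TangentSpace 𝓘(ℝ, F) p) ∈ T10 p := by
    refine (h.mem_iff.self_of_nhds _).2 ?_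
    refine (congrArg (dM F k p) (imPart_mkC (V := TangentSpace 𝓘(ℝ, F) p) w B)).trans
      (hB.trans (congrArg (fun v => -(Complex.I • dM F k p v)) ?_))
    exact (rePart_mkC (V := TangentSpace 𝓘(ℝ, F) p) w B).symm
  have hη'w : η' p w = 0 :=
    (congrArg (η' p) (rePart_mkC (V := TangentSpace 𝓘(ℝ, F) p) w B)).symm.trans
      (IsTrivialization.apply_re h' hmem)
  rw [e] at hη'w
  rw [hηv]
  linear_combination hη'w + c * η' p τ * Complex.I_mul_I

end Ratio

/-! ### Defining functions multiplied by e^g on the manifold -/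

section ExpMul

variable {E : Type*} [NormedAddCommGroup E] [NormedSpace ℂ E]
  {X : Type*} [TopologicalSpace X] [ChartedSpace E X]
  {Ω : Set X} {ρ g : X → ℝ}

omit [NormedSpace ℂ E] in
lemma inChart_exp_mul (x₀ : X) (g ρ : X → ℝ) : inChart (E := E) x₀ (fun x => Real.exp (g x) * ρ x)
    = fun y => Real.exp (inChart x₀ g y) * inChart x₀ ρ y := rfl

variable [IsManifold 𝓘(ℂ, E) ω X]

lemma smooth_inChart_of_contMDiff (hg : ContMDiff 𝓘(ℝ, E) 𝓘(ℝ, ℝ) ∞ g) {x₀ x : X}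
    (hx : x ∈ (chartAt E x₀).source) :
    ∀ᶠ y in 𝓝 (chartAt E x₀ x), ContDiffAt ℝ ∞ (inChart x₀ g) y :=
  eventually_contDiffAt_inChart hx (Eventually.of_forall fun z => hg z)

lemma IsDefiningFunction.exp_mul (hρ : IsDefiningFunction E Ω ρ)
    (hg : ContMDiff 𝓘(ℝ, E) 𝓘(ℝ, ℝ) ∞ g) :
    IsDefiningFunction E Ω (fun x => Real.exp (g x) * ρ x) := by
  have hsm : ContMDiff 𝓘(ℝ, E) 𝓘(ℝ, ℝ) ∞ (fun x => Real.exp (g x) * ρ x) :=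
    ((Real.contDiff_exp.contMDiff).comp hg).mul hρ.smooth
  refine ⟨hsm, ?_, fun x hx h0 => ?_⟩
  · rw [hρ.sublevel]
    ext x
    exact ⟨fun h => mul_neg_of_pos_of_neg (Real.exp_pos _) h,
      fun h => (pos_iff_neg_of_mul_neg h).1 (Real.exp_pos _)⟩
  · have hs := mem_chart_source E x
    have h1 : dM E (fun x => Real.exp (g x) * ρ x) x = 0 := h0
    refine hρ.regular hs hx (ContinuousLinearMap.ext fun v => ?_)
    obtain ⟨w, rfl⟩ : ∃ w, chartD E x x w = v := (chartDeriv_bijective hs).2 v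
    have h2 := dM_eq_inChart hs (hsm.mdifferentiable (by simp) x) w
    rw [h1, inChart_exp_mul, fderiv_exp_mul (hρ.smooth_inChart hs).self_of_nhds
      (smooth_inChart_of_contMDiff hg hs).self_of_nhds, inChart_chartAt ρ hs, hρ.zero hx, zero_smul,
      add_zero, smul_apply] at h2
    have h3 := (smul_eq_zero.1 h2.symm).resolve_left (Real.exp_ne_zero _)
    rw [h3]
    rfl

lemma LeviCondition.exp_mul (hlev : LeviCondition E Ω ρ) (hρ : IsDefiningFunction E Ω ρ)
    (hg : ContMDiff 𝓘(ℝ, E) 𝓘(ℝ, ℝ) ∞ g) :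
    LeviCondition E Ω (fun x => Real.exp (g x) * ρ x) := fun x hx x₀ hs =>
  (hlev x hx x₀ hs).exp_mul (hρ.smooth_inChart hs) (smooth_inChart_of_contMDiff hg hs)

end ExpMul

/-! ### Trivializations extended to defining functions -/

section Extension

variable {E : Type*} [NormedAddCommGroup E] [NormedSpace ℂ E] [FiniteDimensional ℂ E]
  {X : Type*} [TopologicalSpace X] [ChartedSpace E X] [IsManifold 𝓘(ℂ, E) ω X]
  [T2Space X] [SecondCountableTopology X]
  {F : Type*} [NormedAddCommGroup F] [NormedSpace ℝ F] [FiniteDimensional ℝ F]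
  {M : Type*} [TopologicalSpace M] [ChartedSpace F M] [IsManifold 𝓘(ℝ, F) ∞ M]
  {Ω : Set X} {ι : M → X} {ρ : X → ℝ}

namespace IsSmoothBoundary

omit [FiniteDimensional ℝ F] [IsManifold 𝓘(ℝ, F) ∞ M] in
/-- Smooth functions on the boundary extend. -/
lemma exists_extension (hb : IsSmoothBoundary E F Ω ι) {f : M → ℝ}
    (hf : ContMDiff 𝓘(ℝ, F) 𝓘(ℝ, ℝ) ∞ f) :
    ∃ g : X → ℝ, ContMDiff 𝓘(ℝ, E) 𝓘(ℝ, ℝ) ∞ g ∧ ∀ q, g (ι q) = f q := by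
  have := isManifold_real E X
  have : FiniteDimensional ℝ E := FiniteDimensional.complexToReal E
  have : LocallyCompactSpace X := ChartedSpace.locallyCompactSpace E X
  -- Prescribing the value on the boundary and nothing elsewhere is a convex condition. Local
  -- solutions are f composed with a left inverse of ι.
  obtain ⟨g, hg⟩ := exists_contMDiffMap_forall_mem_convex_of_local (n := (⊤ : ℕ∞)) 𝓘(ℝ, E)
    (t := fun x : X => {c : ℝ | ∀ q, ι q = x → c = f q})
    (fun x c hc d hd a b ha hb' hab q hq => by
      rw [hc q hq, hd q hq, ← add_smul, hab, one_smul])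
    (fun x => by
      by_cases hx : x ∈ Set.range ι
      · obtain ⟨p, rfl⟩ := hx
        obtain ⟨Λ, hΛ, hΛι⟩ := exists_local_left_inverse (hb.embedding.isImmersion.isImmersionAt p)
        -- Since ι is a topological embedding, Λ(ι q) = q holds for every q with ι q near ι p; no
        -- other sheet of the boundary can come close.
        rw [hb.embedding.isEmbedding.nhds_eq_comap] at hΛι
        obtain ⟨V, hV, hVι⟩ := mem_comap.1 hΛι
        refine ⟨_, hΛ.and hV, f ∘ Λ, fun y hy => (hf.contMDiffAt.comp y hy.1).contMDiffWithinAt, ?_⟩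
        rintro _ hy q rfl
        have h1 : Λ (ι q) = q := hVι hy.2
        rw [Function.comp, h1]
      · refine ⟨(Set.range ι)ᶜ, ?_, fun _ => 0, contMDiffOn_const, fun y hy q hq =>
            absurd ⟨q, hq⟩ hy⟩
        rw [hb.range] at hx ⊢
        exact isClosed_frontier.isOpen_compl.mem_nhds hx)
  exact ⟨g, g.contMDiff, fun q => hg _ q rfl⟩

omit [FiniteDimensional ℂ E] [T2Space X] [SecondCountableTopology X] [FiniteDimensional ℝ F]
  [IsManifold 𝓘(ℝ, F) ∞ M] in
lemma hypersurfaceForm_exp_mul (hb : IsSmoothBoundary E F Ω ι) (hρ : IsDefiningFunction E Ω ρ)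
    {g : X → ℝ} (hg : ContMDiff 𝓘(ℝ, E) 𝓘(ℝ, ℝ) ∞ g) (q : M) (v : F) :
    hypersurfaceForm (E := E) ι (fun x => Real.exp (g x) * ρ x) q v
      = Real.exp (g (ι q)) * hypersurfaceForm (E := E) ι ρ q v := by
  have hs := mem_chart_source E (ι q)
  have hι := hb.embedding.isImmersion.contMDiff.mdifferentiable (by simp) q
  have hk : chartMap (E := E) (ι q) ι q = chartAt E (ι q) (ι q) := rfl
  refine (hypersurfaceForm_apply hs hι
    ((hρ.exp_mul hg).smooth.mdifferentiable (by simp) _) v).trans ?_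
  rw [hypersurfaceForm_apply hs hι (hρ.smooth.mdifferentiable (by simp) _), inChart_exp_mul, hk,
    fderiv_exp_mul (hρ.smooth_inChart hs).self_of_nhds
      (smooth_inChart_of_contMDiff hg hs).self_of_nhds, inChart_chartAt ρ hs,
    hρ.zero (hb.mem_frontier q), zero_smul, add_zero, smul_apply, inChart_chartAt g hs]
  push_cast [smul_eq_mul]
  ring

/-- Every trivialization is, up to sign, `η_ρ` for a defining function `ρ`. -/
lemma exists_isSignedForm (hb : IsSmoothBoundary E F Ω ι) (hρ : IsDefiningFunction E Ω ρ)
    {η : CForm F M} (hη : IsTrivialization (inducedCR E ι) η) :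
    ∃ g : X → ℝ, ContMDiff 𝓘(ℝ, E) 𝓘(ℝ, ℝ) ∞ g ∧
      IsSignedForm E ι (fun x => Real.exp (g x) * ρ x) η := by
  have := hb.t2Space
  have := hb.compactSpace
  have hloc := fun p => hb.localModel_self hρ (mem_chart_source E (ι p))
  obtain ⟨T, hT⟩ := exists_transversal (E := E) (fun p => ⟨_, _, _, hloc p⟩)
  have hτ : ∀ q, hypersurfaceForm (E := E) ι ρ q (imPart (T q)) = -Complex.I := by
    intro q
    have h1 := hT.normalized q
    rw [evalC, hT.imaginary q, map_zero, zero_add] at h1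
    linear_combination -Complex.I * h1
      + hypersurfaceForm (E := E) ι ρ q (imPart (T q)) * Complex.I_mul_I
  obtain ⟨f, hf⟩ : ∃ f : M → ℝ, f = fun q => -(η q (imPart (T q))).im := ⟨_, rfl⟩
  have hfη : ∀ q, Complex.I * η q (imPart (T q)) = f q := by
    intro q
    rw [hf]
    have := hη.imaginary q (imPart (T q))
    apply Complex.ext <;> simp [this]
  have hprop : ∀ q, ∀ v : F, η q v = f q * hypersurfaceForm (E := E) ι ρ q v := by
    intro q v
    rw [← hfη]
    exact (hloc q).form_proportional hη.annihilates (hτ q) v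
  have hfs : ContMDiff 𝓘(ℝ, F) 𝓘(ℝ, ℝ) ∞ f := by
    intro q
    have h1 : ContMDiffAt 𝓘(ℝ, F) (𝓘(ℝ, F).prod 𝓘(ℝ, ℂ)) ∞
        (fun m => TotalSpace.mk' ℂ (E := Trivial M ℂ) m (η m (imPart (T m)))) q :=
      ContMDiffAt.clm_bundle_apply (F₁ := F) (E₁ := fun q : M => TangentSpace 𝓘(ℝ, F) q) (F₂ := ℂ)
        (E₂ := Trivial M ℂ) (hη.smooth q) (hT.smooth.2 q)
    have h2 : ContMDiffAt 𝓘(ℝ, F) 𝓘(ℝ, ℂ) ∞ (fun m => (η m (imPart (T m)) : ℂ)) q :=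
      (Bundle.contMDiffAt_section q).1 h1
    obtain ⟨m, hm⟩ : ∃ m : ℂ → ℝ, m = fun z => -z.im := ⟨_, rfl⟩
    have h3 : ContDiff ℝ ∞ m := by rw [hm]; exact Complex.imCLM.contDiff.neg
    have h4 : f = m ∘ fun q => (η q (imPart (T q)) : ℂ) := by rw [hf, hm]; rfl
    rw [h4]
    exact ContMDiffAt.comp (I' := 𝓘(ℝ, ℂ)) q (contMDiffAt_iff_contDiffAt.2 h3.contDiffAt) h2
  have hf0 : ∀ q, f q ≠ 0 := by
    intro q h0
    refine hη.nonvanishing q (ContinuousLinearMap.ext fun v => ?_)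
    exact (hprop q v).trans (by rw [h0, Complex.ofReal_zero, zero_mul]; rfl)
  -- `Real.log` is log|·| on negative numbers, so e^g restricts to |f| and the sign of f is left to
  -- σ.
  obtain ⟨g, hg, hgf⟩ := hb.exists_extension (f := fun q => Real.log (f q)) (by
    intro q
    exact ((Real.contDiffAt_log.2 (hf0 q)).contMDiffAt).comp q (hfs q))
  refine ⟨g, hg, fun p => ?_⟩
  have key : ∀ (q : M) (s : ℝ), f q = s * |f q| → ∀ v : F,
      η q v = (s : ℂ) * hypersurfaceForm (E := E) ι (fun x => Real.exp (g x) * ρ x) q v := by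
    intro q s hs v
    rw [hprop, hb.hypersurfaceForm_exp_mul hρ hg, hgf, Real.exp_log_eq_abs (hf0 q), ← mul_assoc,
      ← Complex.ofReal_mul, ← hs]
  rcases lt_or_gt_of_ne (hf0 p) with hneg | hpos
  · refine ⟨-1, by norm_num, ?_⟩
    filter_upwards [hfs.continuous.continuousAt.eventually_lt_const hneg] with q hq
    exact key q _ (by rw [abs_of_neg hq]; ring)
  · refine ⟨1, by norm_num, ?_⟩
    filter_upwards [hfs.continuous.continuousAt.eventually_const_lt hpos] with q hq
    exact key q _ (by rw [abs_of_pos hq]; ring)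

end IsSmoothBoundary

end Extension

/-! ### Plurisubharmonic powers of defining functions -/

section Plurisubharmonic

variable {E : Type*} [NormedAddCommGroup E] [NormedSpace ℂ E]
  {X : Type*} [TopologicalSpace X] [ChartedSpace E X] [IsManifold 𝓘(ℂ, E) ω X]
  {Ω S : Set X} {ρ : X → ℝ} {σ m γ : ℝ}

omit [IsManifold 𝓘(ℂ, E) ω X] in
lemma contMDiffAt_signed_rpow (hρ : ContMDiff 𝓘(ℝ, E) 𝓘(ℝ, ℝ) ∞ ρ) {z : X} (hz : 0 < σ * ρ z) :
    ContMDiffAt 𝓘(ℝ, E) 𝓘(ℝ, ℝ) ∞ (fun x => σ * (σ * ρ x) ^ γ) z := by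
  obtain ⟨f, hf⟩ : ∃ f : ℝ → ℝ, f = fun t => σ * (σ * t) ^ γ := ⟨_, rfl⟩
  have h1 : ContDiffAt ℝ ∞ f (ρ z) := by
    rw [hf]
    exact contDiffAt_const.mul ((contDiffAt_const.mul contDiffAt_id).rpow_const_of_ne hz.ne')
  have h2 : (fun x => σ * (σ * ρ x) ^ γ) = f ∘ ρ := by rw [hf]; rfl
  rw [h2]
  exact ContMDiffAt.comp (I' := 𝓘(ℝ, ℝ)) z (contMDiffAt_iff_contDiffAt.2 h1) (hρ z)

lemma complexHessian_signed_rpow (hρ : ContMDiff 𝓘(ℝ, E) 𝓘(ℝ, ℝ) ∞ ρ) (hσ : σ * σ = 1)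
    {x₀ z : X} (hs : z ∈ (chartAt E x₀).source) (hz : 0 < σ * ρ z) (v : E) :
    complexHessian (fun x => σ * (σ * ρ x) ^ γ) z v = γ * (σ * ρ z) ^ (γ - 1)
      * powerForm (inChart x₀ ρ) σ (σ * (γ - 1)) (chartAt E x₀ z) (chartD E x₀ z v) / 4 := by
  have hev : ∀ᶠ z' in 𝓝 z, 0 < σ * ρ z' :=
    (continuousAt_const.mul hρ.continuous.continuousAt).eventually (lt_mem_nhds hz)
  have h0 : inChart (E := E) x₀ ρ (chartAt E x₀ z) = ρ z := inChart_chartAt ρ hs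
  have h1 := complexHessian_eq hs (u := fun x => σ * (σ * ρ x) ^ γ)
    (hev.mono fun z' hz' => contMDiffAt_signed_rpow hρ hz') v
  refine h1.trans ?_
  have h2 := levB_hes_power (r := inChart (E := E) x₀ ρ) (x := chartAt E x₀ z)
    (smooth_inChart_of_contMDiff hρ hs) hσ (by rw [h0]; exact hz) γ (chartD E x₀ z v)
  rw [h0] at h2
  exact congrArg (· / 4) h2

/-- Strict positivity of the D'Angelo quantities gives strictly plurisubharmonic functions. -/
lemma exists_isStrictPSHOn [FiniteDimensional ℂ E] (hρ : IsDefiningFunction E Ω ρ)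
    (hlev : LeviCondition E Ω ρ) (hσ : σ * σ = 1) (hm : 0 < m) (hγ : 0 < γ) (hγm : σ * (γ - 1) = m)
    (hcond : BoundaryCondition E Ω ρ (fun d w => 0 < -σ * d - (σ + 1 / m) * w))
    (hS : ∀ x ∈ frontier Ω, ∀ᶠ z in 𝓝 x, z ∈ S → 0 < σ * ρ z) :
    ∃ W : Set X, IsOpen W ∧ frontier Ω ⊆ W ∧
      IsStrictPSHOn E (fun x => σ * (σ * ρ x) ^ γ) (S ∩ W) := by
  have key : ∀ x ∈ frontier Ω, ∀ᶠ z in 𝓝 x, z ∈ S → 0 < σ * ρ z ∧ ∀ v : E, v ≠ 0 →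
      0 < complexHessian (fun x => σ * (σ * ρ x) ^ γ) z v := by
    intro x hx
    have hs := mem_chart_source E x
    have h0 : inChart (E := E) x ρ (chartAt E x x) = 0 := by rw [inChart_chartAt ρ hs, hρ.zero hx]
    obtain ⟨N, hN⟩ := exists_normal (hρ.regular hs hx)
    have h1 := eventually_powerForm_pos (hρ.smooth_inChart hs) h0 hσ hm (hlev x hx x hs) hN
      (fun a ha => hcond x hx x hs a ha N hN)
    filter_upwards [hS x hx, (tendsto_chartAt hs).eventually h1, eventually_mem_source hs]
      with z hz h2 h3 hzS
    refine ⟨hz hzS, fun v hv => ?_⟩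
    have h4 : inChart (E := E) x ρ (chartAt E x z) = ρ z := inChart_chartAt ρ h3
    rw [complexHessian_signed_rpow hρ.smooth hσ h3 (hz hzS), hγm]
    have h5 : chartD E x z v ≠ 0 := fun h => hv ((chartDeriv_bijective h3).1
      (h.trans (map_zero (chartD E x z)).symm))
    have h6 := h2 (by rw [h4]; exact hz hzS) _ h5
    have h7 := Real.rpow_pos_of_pos (hz hzS) (γ - 1)
    positivity
  -- Taking all points near which the estimate holds makes W open at no cost.
  refine ⟨{z | ∀ᶠ z' in 𝓝 z, z' ∈ S → 0 < σ * ρ z' ∧ ∀ v : E, v ≠ 0 →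
      0 < complexHessian (fun x => σ * (σ * ρ x) ^ γ) z' v}, isOpen_setOfPred_eventually_nhds, key,
    fun z hz => ?_, fun z hz => (hz.2.self_of_nhds hz.1).2⟩
  exact (contMDiffAt_signed_rpow hρ.smooth (hz.2.self_of_nhds hz.1).1).contMDiffWithinAt

section Weak

variable {W : Set X}

lemma eventually_powerForm_nonneg (hρ : IsDefiningFunction E Ω ρ) (hσ : σ * σ = 1) (hγ : 0 < γ)
    (hγm : σ * (γ - 1) = m) (hS : ∀ z, 0 < σ * ρ z → z ∈ S) (hW : IsOpen W) (hΩW : frontier Ω ⊆ W)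
    (hpsh : IsPSHOn E (fun x => σ * (σ * ρ x) ^ γ) (S ∩ W)) {x x₀ : X} (hx : x ∈ frontier Ω)
    (hs : x ∈ (chartAt E x₀).source) : ∀ᶠ y in 𝓝 (chartAt E x₀ x),
      0 < σ * inChart x₀ ρ y → ∀ v, 0 ≤ powerForm (inChart x₀ ρ) σ m y v := by
  filter_upwards [(tendsto_chartAt_symm hs).eventually (hW.mem_nhds (hΩW hx)),
    eventually_mem_target hs] with y h1 h2 hy v
  have h3 := (chartAt E x₀).map_target h2
  have h4 : 0 < σ * ρ ((chartAt E x₀).symm y) := hy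
  obtain ⟨w, hw⟩ : ∃ w, chartD E x₀ ((chartAt E x₀).symm y) w = v := (chartDeriv_bijective h3).2 v
  have h5 := hpsh.2 _ ⟨hS _ h4, h1⟩ w
  rw [complexHessian_signed_rpow hρ.smooth hσ h3 h4, hγm, hw, (chartAt E x₀).right_inv h2] at h5
  have h7 := Real.rpow_pos_of_pos h4 (γ - 1)
  have h8 : 0 < γ * (σ * ρ ((chartAt E x₀).symm y)) ^ (γ - 1) := by positivity
  have h9 := (div_nonneg_iff.1 h5).resolve_right (fun h => absurd h.2 (by norm_num))
  exact nonneg_of_mul_nonneg_right h9.1 h8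

/-- The term of order 0 of the expansion, at each zero of ρ near the boundary, gives pseudoconvexity
with respect to this particular ρ. -/
lemma leviCondition_of_isPSHOn (hρ : IsDefiningFunction E Ω ρ) (hσ : σ * σ = 1) (hγ : 0 < γ)
    (hγm : σ * (γ - 1) = m) (hS : ∀ z, 0 < σ * ρ z → z ∈ S) (hW : IsOpen W) (hΩW : frontier Ω ⊆ W)
    (hpsh : IsPSHOn E (fun x => σ * (σ * ρ x) ^ γ) (S ∩ W)) : LeviCondition E Ω ρ := by
  intro x hx x₀ hs
  filter_upwards [(eventually_powerForm_nonneg hρ hσ hγ hγm hS hW hΩW hpsh hx hs).eventually_nhds,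
    (hρ.smooth_inChart hs).eventually_nhds, hρ.eventually_regular hs hx] with y h1 h2 h3 h4 a ha
  obtain ⟨N, hN⟩ := exists_normal h3
  exact levB_nonneg_of_powerForm_nonneg h2 hσ h1 h4 hN ha

/-- Plurisubharmonic functions give nonnegativity of the D'Angelo quantities. -/
lemma boundaryCondition_of_isPSHOn (hρ : IsDefiningFunction E Ω ρ) (hσ : σ * σ = 1) (hm : 0 < m)
    (hγ : 0 < γ) (hγm : σ * (γ - 1) = m) (hS : ∀ z, 0 < σ * ρ z → z ∈ S) (hW : IsOpen W)
    (hΩW : frontier Ω ⊆ W) (hpsh : IsPSHOn E (fun x => σ * (σ * ρ x) ^ γ) (S ∩ W)) :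
    BoundaryCondition E Ω ρ (fun d w => 0 ≤ -σ * d - (σ + 1 / m) * w) := by
  intro x hx x₀ hs a ha N hN
  exact dAngelo_ineq_of_powerForm_nonneg (hρ.smooth_inChart hs) hσ hm
    (eventually_powerForm_nonneg hρ hσ hγ hγm hS hW hΩW hpsh hx hs) hN ha

end Weak

end Plurisubharmonic

/-! ### Interpolation of defining functions and compactness of the boundary -/

section Uniform

variable {E : Type*} [NormedAddCommGroup E] [NormedSpace ℂ E]

lemma dAngeloSq_nonneg (r : E → ℝ) (y N a : E) : 0 ≤ dAngeloSq r y N a := by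
  rw [dAngeloSq]; positivity

lemma hes_const_mul {g : E → ℝ} {y : E} (hg : ∀ᶠ y in 𝓝 y, ContDiffAt ℝ ∞ g y) (s : ℝ) :
    hes (fun y => s * g y) y = s • hes g y := by
  have h1 : fderiv ℝ (fun y => s * g y) =ᶠ[𝓝 y] fun y => s • fderiv ℝ g y := by
    filter_upwards [hg] with z hz
    exact fderiv_const_mul (hz.differentiableAt (by simp)) s
  rw [hes, h1.fderiv_eq]
  exact fderiv_const_smul ((contDiffAt_fderiv hg.self_of_nhds).differentiableAt (by simp)) s

/-- Interpolation between two defining functions. -/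
lemma jetCondition_interpolate {r g : E → ℝ} {y : E} (hr : ∀ᶠ y in 𝓝 y, ContDiffAt ℝ ∞ r y)
    (hg : ∀ᶠ y in 𝓝 y, ContDiffAt ℝ ∞ g y) {τ κ κ' K s : ℝ}
    (hs : ∀ D₁ D₀ p₁ q₁ p₀ q₀ : ℝ,
      0 ≤ D₁ - κ * ((p₁ ^ 2 + q₁ ^ 2) / 4) → 0 < D₀ → (p₀ ^ 2 + q₀ ^ 2) / 4 ≤ K * D₀ →
      0 < (1 - s) * D₁ + s * D₀ - κ' * ((((1 - s) * p₁ + s * p₀) ^ 2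
        + ((1 - s) * q₁ + s * q₀) ^ 2) / 4))
    (h1 : JetCondition r (fun d w => 0 ≤ τ * d - κ * w) y)
    (h0 : JetCondition (fun y => Real.exp (g y) * r y) (fun d w => 0 < τ * d ∧ w ≤ K * (τ * d)) y) :
    JetCondition (fun y => Real.exp (s * g y) * r y) (fun d w => 0 < τ * d - κ' * w) y := by
  have hsg : ∀ᶠ y in 𝓝 y, ContDiffAt ℝ ∞ (fun y => s * g y) y :=
    hg.mono fun z hz => contDiffAt_const.mul hz
  intro a ha N hN
  have ha1 := (isNull_exp_mul hr hsg).1 ha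
  have ha0 := (isNull_exp_mul hr hg).2 ha1
  obtain ⟨N₁, hN₁⟩ : ∃ N₁, N₁ = Real.exp (s * g y) • N := ⟨_, rfl⟩
  have hN₁' : delB (fderiv ℝ r y) N₁ = 2 := by
    rw [hN₁, delB_real_smul, ← delB_exp_mul hr.self_of_nhds hsg.self_of_nhds ha1.zero, hN]
  have hNs : N = Real.exp (-(s * g y)) • N₁ := by
    rw [hN₁, smul_smul, ← Real.exp_add, neg_add_cancel, Real.exp_zero, one_smul]
  have c1 := h1 a ha1 N₁ hN₁'
  have c0 := h0 a ha0 _ (delB_exp_mul_normal hr.self_of_nhds hg.self_of_nhds ha1.zero hN₁')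
  obtain ⟨p0, q0⟩ := levB_exp_mul_normal hr hg hN₁' ha1
  obtain ⟨ps, qs⟩ := levB_exp_mul_normal hr hsg hN₁' ha1
  have hfd : fderiv ℝ (fun y => s * g y) y = s • fderiv ℝ g y :=
    fderiv_const_mul (hg.self_of_nhds.differentiableAt (by simp)) s
  rw [dAngeloSq, dbarD_exp_mul hr hg hN₁' ha1, p0, q0] at c0
  rw [dAngeloSq] at c1
  rw [hNs, dAngeloSq, dbarD_exp_mul hr hsg hN₁' ha1, ps, qs, hfd, hes_const_mul hg, levB_smul_left,
    smul_apply, smul_apply, smul_eq_mul, smul_eq_mul]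
  -- The null vectors of r, e^g r and e^{sg} r agree. By linearity in g, the quantities for e^{sg} r
  -- are the convex combinations, with weights 1 - s and s, of those for the two end functions.
  have := hs _ _ _ _ _ _ c1 c0.1 c0.2
  refine this.trans_eq ?_
  ring

variable {X : Type*} [TopologicalSpace X] [ChartedSpace E X] [IsManifold 𝓘(ℂ, E) ω X]
  [FiniteDimensional ℂ E] {Ω : Set X} {ρ : X → ℝ}

/-- By compactness, a strict inequality along the boundary can be improved. -/
lemma exists_uniform_boundary_gap (hΩ : IsCompact (frontier Ω)) (hρ : IsDefiningFunction E Ω ρ)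
    (hlev : LeviCondition E Ω ρ) {τ c : ℝ}
    (hcond : BoundaryCondition E Ω ρ (fun d w => 0 < τ * d - c * w)) :
    ∃ ε > 0, ∀ x ∈ frontier Ω, ∃ x₀, x ∈ (chartAt E x₀).source ∧
      JetCondition (inChart (E := E) x₀ ρ) (fun d w => 0 < τ * d - (c + ε) * w) (chartAt E x₀ x) :=
          by
  refine hΩ.induction_on (p := fun s => ∃ ε > 0, ∀ x ∈ s, ∃ x₀, x ∈ (chartAt E x₀).source ∧
      JetCondition (inChart (E := E) x₀ ρ) (fun d w => 0 < τ * d - (c + ε) * w) (chartAt E x₀ x))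
    ⟨1, one_pos, fun x hx => absurd hx (Set.notMem_empty x)⟩ ?_ ?_ ?_
  · rintro s t hst ⟨ε, hε, h⟩
    exact ⟨ε, hε, fun x hx => h x (hst hx)⟩
  · rintro s t ⟨ε, hε, h⟩ ⟨ε', hε', h'⟩
    -- On a union the smaller gap works for both sets, because |ω|² ≥ 0.
    have key : ∀ {δ : ℝ} {x x₀ : X}, min ε ε' ≤ δ →
        JetCondition (inChart (E := E) x₀ ρ) (fun d w => 0 < τ * d - (c + δ) * w) (chartAt E x₀ x) →
        JetCondition (inChart (E := E) x₀ ρ) (fun d w => 0 < τ * d - (c + min ε ε') * w)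
          (chartAt E x₀ x) := by
      intro δ x x₀ hδ hj a ha N hN
      have h1 := hj a ha N hN
      have h2 := mul_le_mul_of_nonneg_right hδ (dAngeloSq_nonneg (inChart (E := E) x₀ ρ)
          (chartAt E x₀ x) N a)
      linarith
    refine ⟨min ε ε', lt_min hε hε', fun x hx => ?_⟩
    rcases hx with hx | hx
    · obtain ⟨x₀, h1, h2⟩ := h x hx
      exact ⟨x₀, h1, key (min_le_left _ _) h2⟩
    · obtain ⟨x₀, h1, h2⟩ := h' x hx
      exact ⟨x₀, h1, key (min_le_right _ _) h2⟩
  · intro x hx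
    have hs := mem_chart_source E x
    obtain ⟨N, hN⟩ := exists_normal (hρ.regular hs hx)
    obtain ⟨ε, hε, h⟩ := exists_uniform_gap (hρ.smooth_inChart hs) (hlev x hx x hs) hN
      (fun a ha => hcond x hx x hs a ha N hN)
    refine ⟨_, mem_nhdsWithin_of_mem_nhds (((tendsto_chartAt hs).eventually h).and
      (eventually_mem_source hs)), ε, hε, fun z hz => ⟨x, hz.2, hz.1⟩⟩

end Uniform

/-! ### From trivializations to plurisubharmonic powers and back -/

section Indices

lemma OnNull.mono {F : Type*} [NormedAddCommGroup F] [NormedSpace ℝ F] {M : Type*}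
    [TopologicalSpace M] [ChartedSpace F M] [IsManifold 𝓘(ℝ, F) ∞ M] {T10 : CRBundle F M}
    {η : CForm F M} {R R' : ℝ → ℝ → Prop} (h : OnNull T10 η R) (hRR : ∀ d w, R d w → R' d w) :
    OnNull T10 η R' :=
  fun θ hθ L hL p hp hne => hRR _ _ (h θ hθ L hL p hp hne)

variable {E : Type*} [NormedAddCommGroup E] [NormedSpace ℂ E] [FiniteDimensional ℂ E]
  {X : Type*} [TopologicalSpace X] [ChartedSpace E X] [IsManifold 𝓘(ℂ, E) ω X]
  [T2Space X] [SecondCountableTopology X]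
  {F : Type*} [NormedAddCommGroup F] [NormedSpace ℝ F] [FiniteDimensional ℝ F]
  {M : Type*} [TopologicalSpace M] [ChartedSpace F M] [IsManifold 𝓘(ℝ, F) ∞ M]
  {Ω : Set X} {ι : M → X} {ρ : X → ℝ}

omit [FiniteDimensional ℂ E] [T2Space X] [SecondCountableTopology X]
  [IsManifold 𝓘(ℂ, E) ω X] in
lemma BoundaryCondition.pointwise {R : ℝ → ℝ → Prop} (h : BoundaryCondition E Ω ρ R) :
    ∀ x ∈ frontier Ω, ∃ x₀, x ∈ (chartAt E x₀).source ∧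
      JetCondition (inChart (E := E) x₀ ρ) R (chartAt E x₀ x) :=
  fun x hx => ⟨x, mem_chart_source E x, h x hx x (mem_chart_source E x)⟩

namespace IsSmoothBoundary

omit [T2Space X] [SecondCountableTopology X] in
lemma isPositiveTrivialization (hb : IsSmoothBoundary E F Ω ι) (hρ : IsDefiningFunction E Ω ρ)
    (hlev : LeviCondition E Ω ρ) : IsPositiveTrivialization (inducedCR E ι)
      (hypersurfaceForm (E := E) (F := F) ι ρ) :=
  ⟨isTrivialization_of_localModel fun p =>
    ⟨_, _, _, hb.localModel_self hρ (mem_chart_source E (ι p))⟩, hb.leviNonneg hρ hlev⟩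

/-- A condition for a trivialization is the same as a condition for a defining function. -/
lemma exists_boundaryCondition (hb : IsSmoothBoundary E F Ω ι) (hρ : IsDefiningFunction E Ω ρ)
    (hlev : LeviCondition E Ω ρ) {η : CForm F M} (hη : IsTrivialization (inducedCR E ι) η)
    {R : ℝ → ℝ → Prop} (hR : OnNull (inducedCR E ι) η R) :
    ∃ g : X → ℝ, ContMDiff 𝓘(ℝ, E) 𝓘(ℝ, ℝ) ∞ g ∧
      IsSignedForm E ι (fun x => Real.exp (g x) * ρ x) η ∧
      BoundaryCondition E Ω (fun x => Real.exp (g x) * ρ x) R := by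
  obtain ⟨g, hg, hs⟩ := hb.exists_isSignedForm hρ hη
  exact ⟨g, hg, hs, hb.boundaryCondition_of_onNull (hρ.exp_mul hg) (hlev.exp_mul hρ hg) hs hR⟩

/-- Strict conditions on the null space of a compact boundary are uniform. -/
lemma exists_onNull_gap (hb : IsSmoothBoundary E F Ω ι) (hρ : IsDefiningFunction E Ω ρ)
    (hlev : LeviCondition E Ω ρ) {η : CForm F M} (hη : IsTrivialization (inducedCR E ι) η)
    {τ c : ℝ} (hR : OnNull (inducedCR E ι) η (fun d w => 0 < τ * d - c * w)) :
    ∃ ε > 0, OnNull (inducedCR E ι) η (fun d w => 0 < τ * d - (c + ε) * w) := by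
  obtain ⟨g, hg, hs, hbc⟩ := hb.exists_boundaryCondition hρ hlev hη hR
  have hlev' := hlev.exp_mul hρ hg
  obtain ⟨ε, hε, h⟩ := exists_uniform_boundary_gap hb.compact (hρ.exp_mul hg) hlev' hbc
  exact ⟨ε, hε, hb.onNull_of_boundaryCondition (hρ.exp_mul hg) hlev' hs h⟩

/-- A weak condition can be improved to a strict one, at the cost of a smaller constant, as soon as
some trivialization satisfies a strict condition. -/
lemma exists_strict_of_weak (hb : IsSmoothBoundary E F Ω ι) (hρ : IsDefiningFunction E Ω ρ)
    (hlev : LeviCondition E Ω ρ) {η₀ η₁ : CForm F M} (hη₀ : IsTrivialization (inducedCR E ι) η₀)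
    (hη₁ : IsTrivialization (inducedCR E ι) η₁) {τ c κ κ' : ℝ} (hc : 0 ≤ c) (hκ' : 0 ≤ κ')
    (hκ : κ' < κ) (h₀ : OnNull (inducedCR E ι) η₀ (fun d w => 0 < τ * d - c * w))
    (h₁ : OnNull (inducedCR E ι) η₁ (fun d w => 0 ≤ τ * d - κ * w)) :
    ∃ η : CForm F M, IsPositiveTrivialization (inducedCR E ι) η ∧
      OnNull (inducedCR E ι) η (fun d w => 0 < τ * d - κ' * w) := by
  obtain ⟨g₀, hg₀, -, hb₀⟩ := hb.exists_boundaryCondition hρ hlev hη₀ h₀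
  obtain ⟨g₁, hg₁, -, hb₁⟩ := hb.exists_boundaryCondition hρ hlev hη₁ h₁
  obtain ⟨ε, hε, hgap⟩ := exists_uniform_boundary_gap hb.compact (hρ.exp_mul hg₀)
    (hlev.exp_mul hρ hg₀) hb₀
  -- The constant K is 1/ε: the gap gives ε|ω|² ≤ τ∂̄_bω for the strict trivialization, as c ≥ 0.
  obtain ⟨s, -, -, hs⟩ := exists_interpolation_bound hκ' hκ (one_div_pos.2 hε)
  obtain ⟨ρ₁, hρ₁⟩ : ∃ ρ₁ : X → ℝ, ρ₁ = fun x => Real.exp (g₁ x) * ρ x := ⟨_, rfl⟩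
  -- With this g, the factor e^{sg} moves from the weak function ρ₁ at s = 0 to the strict one at s
  -- = 1.
  obtain ⟨g, hg⟩ : ∃ g : X → ℝ, g = fun x => g₀ x - g₁ x := ⟨_, rfl⟩
  have hρ₁d : IsDefiningFunction E Ω ρ₁ := hρ₁ ▸ hρ.exp_mul hg₁
  have hρ₁l : LeviCondition E Ω ρ₁ := hρ₁ ▸ hlev.exp_mul hρ hg₁
  have hgs : ContMDiff 𝓘(ℝ, E) 𝓘(ℝ, ℝ) ∞ g := hg ▸ hg₀.sub hg₁
  have hsg : ContMDiff 𝓘(ℝ, E) 𝓘(ℝ, ℝ) ∞ (fun x => s * g x) := contMDiff_const.mul hgs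
  have h01 : (fun x => Real.exp (g₀ x) * ρ x) = fun x => Real.exp (g x) * ρ₁ x := by
    funext x
    rw [hg, hρ₁, ← mul_assoc, ← Real.exp_add, sub_add_cancel]
  rw [h01] at hgap
  rw [← hρ₁] at hb₁
  refine ⟨_, hb.isPositiveTrivialization (hρ₁d.exp_mul hsg) (hρ₁l.exp_mul hρ₁d hsg),
    hb.onNull_of_boundaryCondition (hρ₁d.exp_mul hsg) (hρ₁l.exp_mul hρ₁d hsg) signedForm_self ?_⟩
  intro x hx
  obtain ⟨x₀, hx₀, hj⟩ := hgap x hx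
  refine ⟨x₀, hx₀, jetCondition_interpolate (hρ₁d.smooth_inChart hx₀)
    (smooth_inChart_of_contMDiff hgs hx₀) hs (hb₁ x hx x₀ hx₀) ?_⟩
  intro a ha N hN
  have h := hj a ha N hN
  have hw := dAngeloSq_nonneg (inChart (E := E) x₀ fun x => Real.exp (g x) * ρ₁ x)
    (chartAt E x₀ x) N a
  rw [inChart_exp_mul] at h hw
  have hcw := mul_nonneg hc hw
  have hεw := mul_nonneg hε.le hw
  refine ⟨by linarith, ?_⟩
  rw [one_div, inv_mul_eq_div, le_div_iff₀ hε]
  linarith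

variable {γ : ℝ}

/-- From a trivialization to a strictly plurisubharmonic power. -/
lemma exists_isStrictPSHOn_of_onNull (hb : IsSmoothBoundary E F Ω ι)
    (hρ : IsDefiningFunction E Ω ρ) (hlev : LeviCondition E Ω ρ) {σ m : ℝ} {S : Set X}
    (hσ : σ * σ = 1) (hm : 0 < m) (hγ : 0 < γ) (hγm : σ * (γ - 1) = m) {η : CForm F M}
    (hη : IsTrivialization (inducedCR E ι) η)
    (hR : OnNull (inducedCR E ι) η (fun d w => 0 < -σ * d - (σ + 1 / m) * w))
    (hS : ∀ r, IsDefiningFunction E Ω r → ∀ x ∈ frontier Ω, ∀ᶠ z in 𝓝 x, z ∈ S → 0 < σ * r z) :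
    ∃ r, IsDefiningFunction E Ω r ∧ ∃ W : Set X, IsOpen W ∧ frontier Ω ⊆ W ∧
      IsStrictPSHOn E (fun x => σ * (σ * r x) ^ γ) (S ∩ W) := by
  obtain ⟨g, hg, -, hbc⟩ := hb.exists_boundaryCondition hρ hlev hη hR
  exact ⟨_, hρ.exp_mul hg, exists_isStrictPSHOn (hρ.exp_mul hg) (hlev.exp_mul hρ hg) hσ hm hγ hγm
    hbc (hS _ (hρ.exp_mul hg))⟩

omit [SecondCountableTopology X] in
/-- From a plurisubharmonic power to a positive trivialization. -/
lemma exists_onNull_of_isPSHOn (hb : IsSmoothBoundary E F Ω ι)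
    (hρ : IsDefiningFunction E Ω ρ) {σ m : ℝ} {S W : Set X}
    (hσ : σ * σ = 1) (hm : 0 < m) (hγ : 0 < γ) (hγm : σ * (γ - 1) = m)
    (hS : ∀ z, 0 < σ * ρ z → z ∈ S) (hW : IsOpen W) (hΩW : frontier Ω ⊆ W)
    (hpsh : IsPSHOn E (fun x => σ * (σ * ρ x) ^ γ) (S ∩ W)) :
    ∃ η : CForm F M, IsPositiveTrivialization (inducedCR E ι) η ∧
      OnNull (inducedCR E ι) η (fun d w => 0 ≤ -σ * d - (σ + 1 / m) * w) := by
  have hlev := leviCondition_of_isPSHOn hρ hσ hγ hγm hS hW hΩW hpsh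
  exact ⟨_, hb.isPositiveTrivialization hρ hlev, hb.onNull_of_boundaryCondition hρ hlev
    signedForm_self
    (boundaryCondition_of_isPSHOn hρ hσ hm hγ hγm hS hW hΩW hpsh).pointwise⟩

end IsSmoothBoundary

end Indices

/-! ### Comparison of the indices -/

section Comparison

/-- Suprema of nested sets of exponents in `(0, 1)`. -/
lemma sSup_le_sSup_of_forall_lt {A B : Set ℝ} (hB : ∀ γ ∈ B, 0 < γ ∧ γ < 1)
    (h : ∀ γ ∈ A, ∀ γ', 0 < γ' → γ' < γ → γ' ∈ B) : sSup A ≤ sSup B := by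
  have hbdd : BddAbove B := ⟨1, fun γ hγ => (hB γ hγ).2.le⟩
  -- True for empty B as well, where the supremum is 0 by convention; it disposes of the exponents
  -- γ' ≤ 0.
  have h0 : 0 ≤ sSup B := Real.sSup_nonneg fun γ hγ => (hB γ hγ).1.le
  refine Real.sSup_le (fun γ hγ => le_of_forall_lt_imp_le_of_dense fun γ' hγ' => ?_) h0
  rcases le_or_gt γ' 0 with h1 | h1
  · exact h1.trans h0
  · exact le_csSup hbdd (h γ hγ γ' h1 hγ')

lemma sSup_le_sSup_of_subset {A B : Set ℝ} (hB : ∀ γ ∈ B, 0 < γ ∧ γ < 1) (h : A ⊆ B) :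
    sSup A ≤ sSup B :=
  Real.sSup_le (fun _ hγ => le_csSup ⟨1, fun γ hγ => (hB γ hγ).2.le⟩ (h hγ))
    (Real.sSup_nonneg fun γ hγ => (hB γ hγ).1.le)

/-- Infima of nested sets of exponents in `(1, ∞)`. -/
lemma sInf_le_sInf_of_forall_gt {A B : Set ℝ} (h : ∀ γ ∈ A, ∀ γ', γ < γ' → γ' ∈ B) :
    sInf (Real.toEReal '' B) ≤ sInf (Real.toEReal '' A) := by
  refine le_sInf ?_
  rintro _ ⟨γ, hγ, rfl⟩
  refine EReal.le_of_forall_lt_iff_le.1 fun γ' hγ' => ?_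
  exact sInf_le ⟨γ', h γ hγ γ' (EReal.coe_lt_coe_iff.1 hγ'), rfl⟩

lemma div_one_sub_lt {a b : ℝ} (hab : a < b) (hb : b < 1) : a / (1 - a) < b / (1 - b) := by
  rw [div_lt_div_iff₀ (by linarith) (by linarith)]
  nlinarith

lemma div_sub_one_lt {a b : ℝ} (ha : 1 < a) (hab : a < b) : b / (b - 1) < a / (a - 1) := by
  rw [div_lt_div_iff₀ (by linarith) (by linarith)]
  nlinarith

/-- The constant σ + 1/m for σ = -1 and m = 1 - γ. -/
lemma div_one_sub_eq {γ : ℝ} (hγ : γ < 1) : γ / (1 - γ) = -1 + 1 / (1 - γ) := by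
  have : 1 - γ ≠ 0 := by linarith
  field_simp
  ring

/-- The constant σ + 1/m for σ = 1 and m = γ - 1. -/
lemma div_sub_one_eq {γ : ℝ} (hγ : 1 < γ) : γ / (γ - 1) = 1 + 1 / (γ - 1) := by
  have : γ - 1 ≠ 0 := by linarith
  field_simp
  ring

variable {E : Type*} [NormedAddCommGroup E] [NormedSpace ℂ E]
  {X : Type*} [TopologicalSpace X] [ChartedSpace E X]

lemma complexHessian_zero_right (u : X → ℝ) (x : X) : complexHessian u x (0 : E) = 0 := by
  simp [complexHessian]

lemma IsStrictPSHOn.isPSHOn {u : X → ℝ} {S : Set X} (h : IsStrictPSHOn E u S) : IsPSHOn E u S := by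
  refine ⟨h.1, fun x hx v => ?_⟩
  rcases eq_or_ne v 0 with rfl | hv
  · exact (complexHessian_zero_right u x).ge
  · exact (h.2 x hx v hv).le

variable [FiniteDimensional ℂ E] [IsManifold 𝓘(ℂ, E) ω X]
  [T2Space X] [SecondCountableTopology X]
  {F : Type*} [NormedAddCommGroup F] [NormedSpace ℝ F] [FiniteDimensional ℝ F]
  {M : Type*} [TopologicalSpace M] [ChartedSpace F M] [IsManifold 𝓘(ℝ, F) ∞ M]
  {Ω : Set X} {ι : M → X} {ρ : X → ℝ}

omit [FiniteDimensional ℂ E] [IsManifold 𝓘(ℂ, E) ω X] [T2Space X]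
  [SecondCountableTopology X] in
lemma dfStrong_le_dfWeak : DFStrong E Ω ≤ DFWeak E Ω := by
  refine sSup_le_sSup_of_subset (fun γ hγ => ⟨hγ.1, hγ.2.1⟩) ?_
  rintro γ ⟨h0, h1, r, hr, W, hW, hΩW, h⟩
  exact ⟨h0, h1, r, hr, W, hW, hΩW, h.isPSHOn⟩

omit [FiniteDimensional ℂ E] [IsManifold 𝓘(ℂ, E) ω X] [T2Space X]
  [SecondCountableTopology X] in
lemma steinWeak_le_steinStrong : SteinWeak E Ω ≤ SteinStrong E Ω := by
  refine sInf_le_sInf (Set.image_mono ?_)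
  rintro γ ⟨h1, r, hr, W, hW, hΩW, h⟩
  exact ⟨h1, r, hr, W, hW, hΩW, h.isPSHOn⟩

namespace IsSmoothBoundary

lemma dfStrongCR_le (hb : IsSmoothBoundary E F Ω ι) (hρ : IsDefiningFunction E Ω ρ)
    (hlev : LeviCondition E Ω ρ) :
    DFStrongCR (inducedCR E ι : CRBundle F M) ≤ DFStrong E Ω := by
  refine sSup_le_sSup_of_subset (fun γ hγ => ⟨hγ.1, hγ.2.1⟩) ?_
  rintro γ ⟨h0, h1, η, hη, hR⟩
  rw [div_one_sub_eq h1] at hR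
  obtain ⟨r, hr, W, hW, hΩW, h⟩ := hb.exists_isStrictPSHOn_of_onNull hρ hlev (σ := -1)
    (m := 1 - γ) (S := Ω) (by norm_num) (by linarith) h0 (by ring) hη.1
    (hR.mono fun d w hdw => by rwa [neg_neg, one_mul])
    (fun r hr x _ => Eventually.of_forall fun z hz => by
      rw [hr.sublevel] at hz
      have : r z < 0 := hz
      linarith)
  simp only [neg_one_mul] at h
  exact ⟨h0, h1, r, hr, W, hW, hΩW, h⟩

omit [SecondCountableTopology X] in
lemma dfWeak_le (hb : IsSmoothBoundary E F Ω ι) :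
    DFWeak E Ω ≤ DFWeakCR (inducedCR E ι : CRBundle F M) := by
  refine sSup_le_sSup_of_subset (fun γ hγ => ⟨hγ.1, hγ.2.1⟩) ?_
  rintro γ ⟨h0, h1, r, hr, W, hW, hΩW, h⟩
  obtain ⟨η, hη, hR⟩ := hb.exists_onNull_of_isPSHOn hr (σ := -1) (m := 1 - γ) (S := Ω) (γ := γ)
    (by norm_num) (by linarith) h0 (by ring)
    (fun z hz => by
      rw [hr.sublevel]
      show r z < 0
      linarith) hW hΩW (by simpa only [neg_one_mul] using h)
  refine ⟨h0, h1, η, hη, ?_⟩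
  rw [div_one_sub_eq h1]
  exact hR.mono fun d w hdw => by rwa [neg_neg, one_mul] at hdw

/-- The only inequality of the cycle that needs η₀. As γ/(1-γ) increases, a weak solution at γ
becomes a strict one at every smaller exponent. -/
lemma dfWeakCR_le (hb : IsSmoothBoundary E F Ω ι) (hρ : IsDefiningFunction E Ω ρ)
    (hlev : LeviCondition E Ω ρ) {η₀ : CForm F M} (hη₀ : IsTrivialization (inducedCR E ι) η₀)
    (h₀ : OnNull (inducedCR E ι) η₀ (fun d _ => 0 < d)) :
    DFWeakCR (inducedCR E ι : CRBundle F M) ≤ DFStrongCR (inducedCR E ι : CRBundle F M) := by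
  refine sSup_le_sSup_of_forall_lt (fun γ hγ => ⟨hγ.1, hγ.2.1⟩) ?_
  rintro γ ⟨-, h1, η, hη, hR⟩ γ' hγ' hlt
  obtain ⟨η', hη', hR'⟩ := hb.exists_strict_of_weak hρ hlev hη₀ hη.1 (τ := 1) (c := 0) le_rfl
    (div_nonneg hγ'.le (by linarith)) (div_one_sub_lt hlt h1)
    (h₀.mono fun d w hd => by linarith) (hR.mono fun d w hd => by rwa [one_mul])
  exact ⟨hγ', hlt.trans h1, η', hη', hR'.mono fun d w hd => by rwa [one_mul] at hd⟩

lemma dfStrongCR_pos (hb : IsSmoothBoundary E F Ω ι) (hρ : IsDefiningFunction E Ω ρ)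
    (hlev : LeviCondition E Ω ρ) {η : CForm F M}
    (hη : IsPositiveTrivialization (inducedCR E ι) η)
    (h : OnNull (inducedCR E ι) η (fun d _ => 0 < d)) :
    0 < DFStrongCR (inducedCR E ι : CRBundle F M) := by
  obtain ⟨ε, hε, hgap⟩ := hb.exists_onNull_gap hρ hlev hη.1 (τ := 1) (c := 0)
    (h.mono fun d w hd => by linarith)
  have hε1 : 0 < 1 + ε := by linarith
  -- The exponent ε/(1+ε) is the solution of γ/(1-γ) = ε, the gap supplied by compactness.
  have h1 : ε / (1 + ε) < 1 := by rw [div_lt_one hε1]; linarith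
  refine (div_pos hε hε1).trans_le (le_csSup ⟨1, fun γ hγ => hγ.2.1.le⟩
    ⟨div_pos hε hε1, h1, η, hη, ?_⟩)
  have h2 : ε / (1 + ε) / (1 - ε / (1 + ε)) = ε := by
    field_simp
    ring
  rw [h2]
  exact hgap.mono fun d w hd => by rwa [one_mul, zero_add] at hd

/-- In contrast with the inside, positivity of a defining function outside the closure is available
only near the boundary; this suffices, since W may be shrunk. -/
lemma steinStrong_le (hb : IsSmoothBoundary E F Ω ι) (hρ : IsDefiningFunction E Ω ρ)
    (hlev : LeviCondition E Ω ρ) :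
    SteinStrong E Ω ≤ SteinStrongCR (inducedCR E ι : CRBundle F M) := by
  refine sInf_le_sInf (Set.image_mono ?_)
  rintro γ ⟨h1, η, hη, hR⟩
  rw [div_sub_one_eq h1] at hR
  obtain ⟨r, hr, W, hW, hΩW, h⟩ := hb.exists_isStrictPSHOn_of_onNull hρ hlev (σ := 1)
    (m := γ - 1) (S := (closure Ω)ᶜ) (by norm_num) (by linarith) (by linarith) (by ring) hη.1
    (hR.mono fun d w hdw => by rwa [neg_one_mul])
    (fun r hr x hx => (hr.eventually_pos hx).mono fun z hz hzΩ => by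
      rw [one_mul]
      exact hz hzΩ)
  simp only [one_mul] at h
  exact ⟨h1, r, hr, W, hW, hΩW, h⟩

omit [SecondCountableTopology X] in
lemma steinWeakCR_le (hb : IsSmoothBoundary E F Ω ι) :
    SteinWeakCR (inducedCR E ι : CRBundle F M) ≤ SteinWeak E Ω := by
  refine sInf_le_sInf (Set.image_mono ?_)
  rintro γ ⟨h1, r, hr, W, hW, hΩW, h⟩
  obtain ⟨η, hη, hR⟩ := hb.exists_onNull_of_isPSHOn hr (σ := 1) (m := γ - 1)
    (S := (closure Ω)ᶜ) (γ := γ) (by norm_num) (by linarith) (by linarith) (by ring)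
    (fun z hz hzΩ => by
      have := hr.nonpos_of_mem_closure hzΩ
      linarith) hW hΩW (by simpa only [one_mul] using h)
  refine ⟨h1, η, hη, ?_⟩
  rw [div_sub_one_eq h1]
  exact hR.mono fun d w hdw => by rwa [neg_one_mul] at hdw

/-- Here γ/(γ-1) decreases, so strictness is gained by raising the exponent. The strict form of d +
w < 0 is the case τ = -1, c = 1 of the interpolation. -/
lemma steinStrongCR_le (hb : IsSmoothBoundary E F Ω ι) (hρ : IsDefiningFunction E Ω ρ)
    (hlev : LeviCondition E Ω ρ) {η₀ : CForm F M} (hη₀ : IsTrivialization (inducedCR E ι) η₀)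
    (h₀ : OnNull (inducedCR E ι) η₀ (fun d w => d + w < 0)) :
    SteinStrongCR (inducedCR E ι : CRBundle F M) ≤ SteinWeakCR (inducedCR E ι : CRBundle F M) := by
  refine sInf_le_sInf_of_forall_gt ?_
  rintro γ ⟨h1, η, hη, hR⟩ γ' hlt
  have h1' := h1.trans hlt
  obtain ⟨η', hη', hR'⟩ := hb.exists_strict_of_weak hρ hlev hη₀ hη.1 (τ := -1) (c := 1)
    zero_le_one (div_nonneg (by linarith) (by linarith)) (div_sub_one_lt h1 hlt)
    (h₀.mono fun d w hd => by linarith) (hR.mono fun d w hd => by rwa [neg_one_mul])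
  exact ⟨h1', η', hη', hR'.mono fun d w hd => by rwa [neg_one_mul] at hd⟩

lemma steinStrongCR_lt_top (hb : IsSmoothBoundary E F Ω ι) (hρ : IsDefiningFunction E Ω ρ)
    (hlev : LeviCondition E Ω ρ) {η : CForm F M}
    (hη : IsPositiveTrivialization (inducedCR E ι) η)
    (h : OnNull (inducedCR E ι) η (fun d w => d + w < 0)) :
    SteinStrongCR (inducedCR E ι : CRBundle F M) < ⊤ := by
  obtain ⟨ε, hε, hgap⟩ := hb.exists_onNull_gap hρ hlev hη.1 (τ := -1) (c := 1)
    (h.mono fun d w hd => by linarith)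
  -- The exponent 1 + 1/ε is the solution of γ/(γ-1) = 1 + ε.
  have h1 : 1 < 1 + 1 / ε := by
    have := one_div_pos.2 hε
    linarith
  have h2 : (1 + 1 / ε) / (1 + 1 / ε - 1) = 1 + ε := by
    field_simp
    ring
  have h3 : OnNull (inducedCR E ι) η
      (fun d w => 0 < -d - (1 + 1 / ε) / (1 + 1 / ε - 1) * w) := by
    rw [h2]
    exact hgap.mono fun d w hd => by rwa [neg_one_mul] at hd
  exact lt_of_le_of_lt (sInf_le (Set.mem_image_of_mem Real.toEReal ⟨h1, η, hη, h3⟩))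
    (EReal.coe_lt_top _)

end IsSmoothBoundary

end Comparison

end CRIndex

end

open CRIndex in
theorem mainTheorem4
    (n : ℕ)
    -- the complex manifold `X` of dimension `n + 1`
    {E : Type*} [NormedAddCommGroup E] [NormedSpace ℂ E] [FiniteDimensional ℂ E]
    (hE : Module.finrank ℂ E = n + 1)
    {X : Type*} [TopologicalSpace X] [T2Space X] [SecondCountableTopology X]
    [ChartedSpace E X] [IsManifold 𝓘(ℂ, E) ω X]
    -- the relatively compact domain `Ω`
    (Ω : Set X) (hΩ : IsOpen Ω) (hΩconn : IsConnected Ω) (hΩcpt : IsCompact (closure Ω))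
    -- its boundary, as a smooth manifold `M` of dimension `2 n + 1` embedded in `X`
    {F : Type*} [NormedAddCommGroup F] [NormedSpace ℝ F] [FiniteDimensional ℝ F]
    (hF : Module.finrank ℝ F = 2 * n + 1)
    {M : Type*} [TopologicalSpace M] [ChartedSpace F M] [IsManifold 𝓘(ℝ, F) ∞ M]
    (ι : M → X) (hι : Manifold.IsSmoothEmbedding 𝓘(ℝ, F) 𝓘(ℝ, E) ∞ ι)
    (hιΩ : Set.range ι = frontier Ω)
    (hpsc : HasSmoothPseudoconvexBoundary (E := E) (F := F) Ω ι) :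
    ((∃ η : CForm F M, IsPositiveTrivialization (inducedCR E ι) η ∧
        OnNull (inducedCR E ι) η (fun d _ => 0 < d)) →
      0 < DFStrongCR (inducedCR E ι : CRBundle F M) ∧
      DFStrongCR (inducedCR E ι : CRBundle F M) = DFStrong E Ω ∧
      DFStrong E Ω = DFWeak E Ω ∧
      DFWeak E Ω = DFWeakCR (inducedCR E ι : CRBundle F M)) ∧
    ((∃ η : CForm F M, IsPositiveTrivialization (inducedCR E ι) η ∧
        OnNull (inducedCR E ι) η (fun d w => d + w < 0)) →
      SteinWeakCR (inducedCR E ι : CRBundle F M) = SteinWeak E Ω ∧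
      SteinWeak E Ω = SteinStrong E Ω ∧
      SteinStrong E Ω = SteinStrongCR (inducedCR E ι : CRBundle F M) ∧
      SteinStrongCR (inducedCR E ι : CRBundle F M) < ⊤) := by
  have hb : IsSmoothBoundary E F Ω ι :=
    ⟨hΩcpt.of_isClosed_subset isClosed_frontier frontier_subset_closure, by omega, hι, hιΩ⟩
  obtain ⟨ρ, hρ, hpos⟩ := hpsc
  have hlev := hb.leviCondition hρ hpos
  constructor
  · rintro ⟨η, hη, h⟩
    -- The four inequalities form a cycle, so all four indices agree; only the last one uses η.
    have h1 := hb.dfStrongCR_le hρ hlev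
    have h2 := dfStrong_le_dfWeak (E := E) (Ω := Ω)
    have h3 := hb.dfWeak_le
    have h4 := hb.dfWeakCR_le hρ hlev hη.1 h
    exact ⟨hb.dfStrongCR_pos hρ hlev hη h, le_antisymm h1 (h2.trans (h3.trans h4)),
      le_antisymm h2 (h3.trans (h4.trans h1)), le_antisymm h3 (h4.trans (h1.trans h2))⟩
  · rintro ⟨η, hη, h⟩
    have h1 := hb.steinStrong_le hρ hlev
    have h2 := steinWeak_le_steinStrong (E := E) (Ω := Ω)
    have h3 := hb.steinWeakCR_le
    have h4 := hb.steinStrongCR_le hρ hlev hη.1 h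
    exact ⟨le_antisymm h3 (h2.trans (h1.trans h4)), le_antisymm h2 (h1.trans (h4.trans h3)),
      le_antisymm h1 (h4.trans (h3.trans h2)), hb.steinStrongCR_lt_top hρ hlev hη h⟩
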